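/- Let $\mathcal C$ be a type-theoretic model category: a complete and cocomplete model category that is right proper, in which limits preserve cofibrations (the limit of a natural transformation of diagrams all of whose components are cofibrations is a cofibration), and in which pullback along any fibration has a right adjoint. A $\mathcal C$-inverse category $\mathcal I$ consists of a set $\mathcal I_0$ with a transitive well-founded relation $\prec$; objects $\mathcal I(x)\in\mathcal C$ for $x\in\mathcal I_0$; spans $\mathcal I(x)\leftarrow \mathcal I(x,y)\to\mathcal I(y)$ for $y\prec x$; and associative composition maps $\mathcal I(x,y)\times_{\mathcal I(y)}\mathcal I(y,z)\to\mathcal I(x,z)$ over $\mathcal I(x)$ and $\mathcal I(z)$ for $z\prec y\prec x$. For $X\in\mathcal C$, an $X$-indexed $\mathcal I$-diagram $A$ consists of spans $X\leftarrow A_x\to\mathcal I(x)$ for $x\in\mathcal I_0$ and action maps $A_x\times_{\mathcal I(x)}\mathcal I(x,y)\to A_y$ over $X$ and $\mathcal I(y)$ for $y\prec x$, associative with respect to composition in $\mathcal I$. Morphisms are families of maps $A_x\to B_x$ over $X$ and $\mathcal I(x)$ that commute with the actions; this gives a category $(\mathcal C^{\mathcal I})^X$. Write $\mathcal C^{\mathcal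 I}=(\mathcal C^{\mathcal I})^1$. Pullback of the maps $A_x\to X$ along $f:Z\to X$ defines reindexing $f^*:(\mathcal C^{\mathcal I})^X\to(\mathcal C^{\mathcal I})^Z$. For $A\in(\mathcal C^{\mathcal I})^X$ and $B\in(\mathcal C^{\mathcal I})^Y$, the hom-object $\mathcal C^{\mathcal I}(A,B)\to X\times Y$, if it exists, is an object representing the functor $(\mathcal C/(X\times Y))^{\mathrm{op}}\to\mathrm{Set}$ that sends $(p,q):Z\to X\times Y$ to the set of morphisms $p^*A\to q^*B$ in $(\mathcal C^{\mathcal I})^Z$. For $x\in\mathcal I_0$ let $\mathcal I_{\prec x}$ be the full $\mathcal C$-inverse subcategory of $\mathcal I$ on $\{y\mid y\prec x\}$. The objects $\mathcal I(x,y)$ form a diagram $\mathcal I(x,-)\in(\mathcal C^{\mathcal I_{\prec x}})^{\mathcal I(x)}$. The matching object of $A\in(\mathcal C^{\mathcal I})^X$ at $x$, if it exists, is the hom-object $M_xA=\mathcal C^{\mathcal I_{\prec x}}(\mathcal I(x,-),A|_{\mathcal I_{\prec x}})$ over $\mathcal I(x)\times X$; the actions on $A_x$ induce a map $A_x\to M_xA$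 over $\mathcal I(x)\times X$. The diagram $A$ is Reedy fibrant if for every $x$ the object $M_xA$ exists and $A_x\to M_xA$ is a fibration. The $\mathcal C$-inverse category $\mathcal I$ is fibrant if for every $x\in\mathcal I_0$ the object $\mathcal I(x)$ is fibrant and $\mathcal I(x,-)$ is Reedy fibrant. Theorem. If $\mathcal I$ is a fibrant $\mathcal C$-inverse category, then $\mathcal C^{\mathcal I}$ is complete and cocomplete and carries a model structure in which, for every morphism $f:A\to B$ of $\mathcal C^{\mathcal I}$: (i) $f$ is a fibration (respectively an acyclic fibration) if and only if for every $x\in\mathcal I_0$ the matching objects $M_xA$ and $M_xB$ exist and the induced map $A_x\to B_x\times_{M_xB}M_xA$ is a fibration (respectively an acyclic fibration) in $\mathcal C$; (ii) $f$ is a cofibration, a weak equivalence, or an acyclic cofibration if and only if every $f_x:A_x\to B_x$ is a cofibration, a weak equivalence, or an acyclic cofibration in $\mathcal C$, respectively. -/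

import Mathlib

open CategoryTheory CategoryTheory.Limits HomotopicalAlgebra

universe w v u

noncomputable section

/-- A type-theoretic model category: a (complete and cocomplete) model category that is right
proper, in which limits preserve cofibrations, and in which pullback along any fibration has a
right adjoint.  Limits, colimits and diagram shapes are of size `w`. -/
class IsTypeTheoreticModelCategory (C : Type u) [Category.{v} C] [ModelCategory C] : Prop where
  hasLimits : HasLimitsOfSize.{w, w} C
  hasColimits : HasColimitsOfSize.{w, w} C
  rightProper {P X Y Z : C} (fst : P ⟶ X) (snd : P ⟶ Y) (f : X ⟶ Z) (g : Y ⟶ Z)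
    (sq : IsPullback fst snd f g) [Fibration f] [WeakEquivalence g] : WeakEquivalence fst
  limits_preserve_cofibrations {J : Type w} [Category.{w} J] (F G : J ⥤ C) (α : F ⟶ G)
    (hα : ∀ j, Cofibration (α.app j)) : Cofibration (limMap α)
  pullback_isLeftAdjoint {X Y : C} (f : X ⟶ Y) [Fibration f] :
    (Over.pullback f).IsLeftAdjoint

/-- An inverse category internal to `C` (every morphism of `C` counting as a prefibration).
`obj x` is `I(x)`; for `y ≺ x`, the object `hom` is `I(x,y)`, with its span
`I(x) ⟵ I(x,y) ⟶ I(y)`.  Associativity is stated on generalized elements. -/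
structure InternalInverseCategory (C : Type u) [Category.{v} C] [HasPullbacks C] where
  Ob : Type w
  /-- `rel y x` means `y ≺ x` -/
  rel : Ob → Ob → Prop
  rel_trans : ∀ {x y z : Ob}, rel z y → rel y x → rel z x
  rel_wf : WellFounded rel
  obj : Ob → C
  hom : ∀ {x y : Ob}, rel y x → C
  src : ∀ {x y : Ob} (h : rel y x), hom h ⟶ obj x
  tgt : ∀ {x y : Ob} (h : rel y x), hom h ⟶ obj y
  comp : ∀ {x y z : Ob} (h : rel y x) (k : rel z y),
    pullback (tgt h) (src k) ⟶ hom (rel_trans k h)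
  comp_src : ∀ {x y z : Ob} (h : rel y x) (k : rel z y),
    comp h k ≫ src (rel_trans k h) = pullback.fst (tgt h) (src k) ≫ src h
  comp_tgt : ∀ {x y z : Ob} (h : rel y x) (k : rel z y),
    comp h k ≫ tgt (rel_trans k h) = pullback.snd (tgt h) (src k) ≫ tgt k
  assoc : ∀ {x y z t : Ob} (h : rel y x) (k : rel z y) (l : rel t z) {T : C}
    (a : T ⟶ hom h) (b : T ⟶ hom k) (c : T ⟶ hom l)
    (hab : a ≫ tgt h = b ≫ src k) (hbc : b ≫ tgt k = c ≫ src l),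
    pullback.lift (pullback.lift a b hab ≫ comp h k) c
        (by rw [Category.assoc, comp_tgt, pullback.lift_snd_assoc, hbc]) ≫
      comp (rel_trans k h) l =
    pullback.lift a (pullback.lift b c hbc ≫ comp k l)
        (by rw [Category.assoc, comp_src, pullback.lift_fst_assoc, hab]) ≫
      comp h (rel_trans l k)

namespace InternalInverseCategory

attribute [local simp] pullback.lift_fst pullback.lift_fst_assoc pullback.lift_snd
  pullback.lift_snd_assoc

variable {C : Type u} [Category.{v} C] [HasPullbacks C]

/-- The full internal inverse subcategory on a set of objects. -/
def full (I : InternalInverseCategory.{w} C) (S : Set I.Ob) : InternalInverseCategory.{w} C where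
  Ob := S
  rel y x := I.rel y.1 x.1
  rel_trans k h := I.rel_trans k h
  rel_wf := InvImage.wf Subtype.val I.rel_wf
  obj x := I.obj x.1
  hom h := I.hom h
  src h := I.src h
  tgt h := I.tgt h
  comp h k := I.comp h k
  comp_src h k := I.comp_src h k
  comp_tgt h k := I.comp_tgt h k
  assoc h k l _ a b c hab hbc := I.assoc h k l a b c hab hbc

/-- The full internal inverse subcategory on the objects strictly below `x`. -/
abbrev below (I : InternalInverseCategory.{w} C) (x : I.Ob) : InternalInverseCategory.{w} C :=
  I.full {y | I.rel y x}

/-- An `X`-indexed family of `I`-diagrams: spans `X ⟵ A_x ⟶ I(x)` with actions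
`A_x ×_{I(x)} I(x,y) ⟶ A_y` over `X` and `I(y)`.  Associativity is stated on generalized
elements. -/
structure Diagram (I : InternalInverseCategory.{w} C) (X : C) where
  obj : I.Ob → C
  toBase : ∀ x, obj x ⟶ X
  toObj : ∀ x, obj x ⟶ I.obj x
  act : ∀ {x y : I.Ob} (h : I.rel y x), pullback (toObj x) (I.src h) ⟶ obj y
  act_base : ∀ {x y : I.Ob} (h : I.rel y x),
    act h ≫ toBase y = pullback.fst (toObj x) (I.src h) ≫ toBase x
  act_obj : ∀ {x y : I.Ob} (h : I.rel y x),
    act h ≫ toObj y = pullback.snd (toObj x) (I.src h) ≫ I.tgt h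
  assoc : ∀ {x y z : I.Ob} (h : I.rel y x) (k : I.rel z y) {T : C}
    (a : T ⟶ obj x) (b : T ⟶ I.hom h) (c : T ⟶ I.hom k)
    (hab : a ≫ toObj x = b ≫ I.src h) (hbc : b ≫ I.tgt h = c ≫ I.src k),
    pullback.lift (pullback.lift a b hab ≫ act h) c
        (by rw [Category.assoc, act_obj, pullback.lift_snd_assoc, hbc]) ≫ act k =
    pullback.lift a (pullback.lift b c hbc ≫ I.comp h k)
        (by rw [Category.assoc, I.comp_src, pullback.lift_fst_assoc, hab]) ≫
      act (I.rel_trans k h)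

namespace Diagram

variable {I : InternalInverseCategory.{w} C} {X Y Z Z' Z'' : C}

/-- A map of diagrams: span maps commuting with the actions. -/
@[ext]
structure Hom (A B : Diagram I X) where
  app : ∀ x, A.obj x ⟶ B.obj x
  app_base : ∀ x, app x ≫ B.toBase x = A.toBase x
  app_obj : ∀ x, app x ≫ B.toObj x = A.toObj x
  act_app : ∀ {x y : I.Ob} (h : I.rel y x),
    A.act h ≫ app y =
      pullback.lift (pullback.fst (A.toObj x) (I.src h) ≫ app x)
        (pullback.snd (A.toObj x) (I.src h))
        (by rw [Category.assoc, app_obj, pullback.condition]) ≫ B.act h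

/-- The action on generalized elements. -/
def actEl (A : Diagram I X) {x y : I.Ob} (h : I.rel y x) {T : C} (a : T ⟶ A.obj x)
    (b : T ⟶ I.hom h) (hab : a ≫ A.toObj x = b ≫ I.src h) : T ⟶ A.obj y :=
  pullback.lift a b hab ≫ A.act h

lemma comp_actEl (A : Diagram I X) {x y : I.Ob} (h : I.rel y x) {T T' : C} (t : T' ⟶ T)
    (a : T ⟶ A.obj x) (b : T ⟶ I.hom h) (hab : a ≫ A.toObj x = b ≫ I.src h) :
    t ≫ A.actEl h a b hab = A.actEl h (t ≫ a) (t ≫ b) (by simp [hab]) := by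
  rw [actEl, actEl, ← Category.assoc]
  congr 1
  apply pullback.hom_ext <;> simp

lemma actEl_toBase (A : Diagram I X) {x y : I.Ob} (h : I.rel y x) {T : C}
    (a : T ⟶ A.obj x) (b : T ⟶ I.hom h) (hab : a ≫ A.toObj x = b ≫ I.src h) :
    A.actEl h a b hab ≫ A.toBase y = a ≫ A.toBase x := by
  simp [actEl, A.act_base]

lemma actEl_toObj (A : Diagram I X) {x y : I.Ob} (h : I.rel y x) {T : C}
    (a : T ⟶ A.obj x) (b : T ⟶ I.hom h) (hab : a ≫ A.toObj x = b ≫ I.src h) :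
    A.actEl h a b hab ≫ A.toObj y = b ≫ I.tgt h := by
  simp [actEl, A.act_obj]

lemma actEl_congr (A : Diagram I X) {x y : I.Ob} (h : I.rel y x) {T : C}
    {a a' : T ⟶ A.obj x} {b b' : T ⟶ I.hom h} (ha : a = a') (hb : b = b')
    (hab : a ≫ A.toObj x = b ≫ I.src h) (hab' : a' ≫ A.toObj x = b' ≫ I.src h) :
    A.actEl h a b hab = A.actEl h a' b' hab' := by
  subst ha hb; rfl

lemma assocEl (A : Diagram I X) {x y z : I.Ob} (h : I.rel y x) (k : I.rel z y) {T : C}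
    (a : T ⟶ A.obj x) (b : T ⟶ I.hom h) (c : T ⟶ I.hom k)
    (hab : a ≫ A.toObj x = b ≫ I.src h) (hbc : b ≫ I.tgt h = c ≫ I.src k) :
    A.actEl k (A.actEl h a b hab) c (by rw [actEl_toObj, hbc]) =
      A.actEl (I.rel_trans k h) a (pullback.lift b c hbc ≫ I.comp h k)
        (by rw [Category.assoc, I.comp_src, pullback.lift_fst_assoc, hab]) :=
  A.assoc h k a b c hab hbc

lemma Hom.actEl_app {A B : Diagram I X} (f : Hom A B) {x y : I.Ob} (h : I.rel y x) {T : C}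
    (a : T ⟶ A.obj x) (b : T ⟶ I.hom h) (hab : a ≫ A.toObj x = b ≫ I.src h) :
    A.actEl h a b hab ≫ f.app y =
      B.actEl h (a ≫ f.app x) b (by rw [Category.assoc, f.app_obj, hab]) := by
  rw [actEl, actEl, Category.assoc, f.act_app, ← Category.assoc]
  congr 1
  apply pullback.hom_ext <;> simp

/-- Constructor of maps of diagrams, with compatibility checked on generalized elements. -/
def Hom.ofElements {A B : Diagram I X} (app : ∀ x, A.obj x ⟶ B.obj x)
    (app_base : ∀ x, app x ≫ B.toBase x = A.toBase x)
    (app_obj : ∀ x, app x ≫ B.toObj x = A.toObj x)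
    (act_app : ∀ {x y : I.Ob} (h : I.rel y x) {T : C} (a : T ⟶ A.obj x) (b : T ⟶ I.hom h)
      (hab : a ≫ A.toObj x = b ≫ I.src h),
      A.actEl h a b hab ≫ app y =
        B.actEl h (a ≫ app x) b (by rw [Category.assoc, app_obj, hab])) : Hom A B where
  app := app
  app_base := app_base
  app_obj := app_obj
  act_app {x y} h := by
    refine Eq.trans ?_ (act_app h _ _ pullback.condition)
    have : pullback.lift _ _ (pullback.condition (f := A.toObj x) (g := I.src h)) = 𝟙 _ := by
      apply pullback.hom_ext <;> simp
    rw [actEl, this, Category.id_comp]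

/-- The category `(C^I)^X` of `X`-indexed `I`-diagrams. -/
instance : Category (Diagram I X) where
  Hom := Hom
  id A := Hom.ofElements (fun x => 𝟙 _) (fun x => Category.id_comp _)
    (fun x => Category.id_comp _) (fun h T a b hab => by
      rw [Category.comp_id]
      exact A.actEl_congr h (Category.comp_id _).symm rfl _ _)
  comp {A B D} f g := Hom.ofElements (fun x => f.app x ≫ g.app x)
    (fun x => by rw [Category.assoc, g.app_base, f.app_base])
    (fun x => by rw [Category.assoc, g.app_obj, f.app_obj])
    (fun h T a b hab => by
      rw [← Category.assoc, f.actEl_app, g.actEl_app]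
      exact D.actEl_congr h (Category.assoc _ _ _) rfl _ _)
  id_comp f := Hom.ext (funext fun x => Category.id_comp _)
  comp_id f := Hom.ext (funext fun x => Category.comp_id _)
  assoc f g h := Hom.ext (funext fun x => Category.assoc _ _ _)

@[ext]
lemma hom_ext {A B : Diagram I X} {f g : A ⟶ B} (h : ∀ x, f.app x = g.app x) : f = g :=
  Hom.ext (funext h)

@[simp]
lemma id_app (A : Diagram I X) (x : I.Ob) : Hom.app (𝟙 A) x = 𝟙 (A.obj x) := rfl

@[simp]
lemma comp_app {A B D : Diagram I X} (f : A ⟶ B) (g : B ⟶ D) (x : I.Ob) :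
    Hom.app (f ≫ g) x = f.app x ≫ g.app x := rfl

/-- Restriction of diagrams to a full internal inverse subcategory. -/
def restrict (A : Diagram I X) (S : Set I.Ob) : Diagram (I.full S) X where
  obj x := A.obj x.1
  toBase x := A.toBase x.1
  toObj x := A.toObj x.1
  act h := A.act h
  act_base h := A.act_base h
  act_obj h := A.act_obj h
  assoc h k _ a b c hab hbc := A.assoc h k a b c hab hbc

/-- Restriction of maps of diagrams to a full internal inverse subcategory. -/
def restrictMap {A B : Diagram I X} (f : A ⟶ B) (S : Set I.Ob) :
    A.restrict S ⟶ B.restrict S where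
  app x := f.app x.1
  app_base x := f.app_base x.1
  app_obj x := f.app_obj x.1
  act_app h := f.act_app h

/-- Reindexing of a diagram along `f : Z ⟶ X`, by pullback of `A_x ⟶ X`. -/
def reindex (A : Diagram I X) (f : Z ⟶ X) : Diagram I Z where
  obj x := pullback (A.toBase x) f
  toBase x := pullback.snd (A.toBase x) f
  toObj x := pullback.fst (A.toBase x) f ≫ A.toObj x
  act {x y} h := pullback.lift
    (A.actEl h (pullback.fst _ _ ≫ pullback.fst (A.toBase x) f) (pullback.snd _ _)
      (by rw [Category.assoc, pullback.condition]))
    (pullback.fst _ _ ≫ pullback.snd (A.toBase x) f)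
    (by rw [actEl_toBase, Category.assoc, Category.assoc, pullback.condition])
  act_base h := pullback.lift_snd _ _ _
  act_obj h := by rw [pullback.lift_fst_assoc, actEl_toObj]
  assoc {x y z} h k T a b c hab hbc := by
    have key := A.assoc h k (a ≫ pullback.fst (A.toBase x) f) b c
      (by rw [Category.assoc, hab]) hbc
    apply pullback.hom_ext
    · simp only [Category.assoc, pullback.lift_fst, comp_actEl]
      refine Eq.trans ?_ (key.trans ?_)
      · refine A.actEl_congr k ?_ (by simp) ?_ ?_
        · simp only [pullback.lift_fst_assoc, Category.assoc, pullback.lift_fst, comp_actEl]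
          exact A.actEl_congr h (by simp) (by simp) _ _
      · exact A.actEl_congr _ (by simp) (by simp) _ _
    · simp

/-- The projection `(f^* A)_x ⟶ A_x`. -/
def proj (A : Diagram I X) (f : Z ⟶ X) (x : I.Ob) : (A.reindex f).obj x ⟶ A.obj x :=
  pullback.fst (A.toBase x) f

/-- The map into `(f^* A)_x = A_x ×_X Z` with given components. -/
def reindexLift (A : Diagram I X) (f : Z ⟶ X) (x : I.Ob) {T : C} (a : T ⟶ A.obj x) (b : T ⟶ Z)
    (h : a ≫ A.toBase x = b ≫ f) : T ⟶ (A.reindex f).obj x :=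
  pullback.lift a b h

section

variable (A : Diagram I X) (f : Z ⟶ X) (x : I.Ob)

@[simp]
lemma reindexLift_proj {T : C} (a : T ⟶ A.obj x) (b : T ⟶ Z) (h : a ≫ A.toBase x = b ≫ f) :
    A.reindexLift f x a b h ≫ A.proj f x = a := pullback.lift_fst _ _ _

@[simp]
lemma reindexLift_toBase {T : C} (a : T ⟶ A.obj x) (b : T ⟶ Z) (h : a ≫ A.toBase x = b ≫ f) :
    A.reindexLift f x a b h ≫ (A.reindex f).toBase x = b := pullback.lift_snd _ _ _

@[simp]
lemma reindexLift_proj_assoc {T S : C} (a : T ⟶ A.obj x) (b : T ⟶ Z)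
    (h : a ≫ A.toBase x = b ≫ f) (s : A.obj x ⟶ S) :
    A.reindexLift f x a b h ≫ A.proj f x ≫ s = a ≫ s := pullback.lift_fst_assoc _ _ _ _

@[simp]
lemma reindexLift_toBase_assoc {T S : C} (a : T ⟶ A.obj x) (b : T ⟶ Z)
    (h : a ≫ A.toBase x = b ≫ f) (s : Z ⟶ S) :
    A.reindexLift f x a b h ≫ (A.reindex f).toBase x ≫ s = b ≫ s :=
  pullback.lift_snd_assoc _ _ _ _

lemma proj_toBase : A.proj f x ≫ A.toBase x = (A.reindex f).toBase x ≫ f := pullback.condition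

lemma reindex_toObj : (A.reindex f).toObj x = A.proj f x ≫ A.toObj x := rfl

variable {A f x} in
lemma reindex_hom_ext {T : C} {s t : T ⟶ (A.reindex f).obj x}
    (h₁ : s ≫ A.proj f x = t ≫ A.proj f x)
    (h₂ : s ≫ (A.reindex f).toBase x = t ≫ (A.reindex f).toBase x) : s = t :=
  pullback.hom_ext h₁ h₂

lemma reindex_actEl_proj {x y : I.Ob} (h : I.rel y x) {T : C} (a : T ⟶ (A.reindex f).obj x)
    (b : T ⟶ I.hom h) (hab : a ≫ (A.reindex f).toObj x = b ≫ I.src h) :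
    (A.reindex f).actEl h a b hab ≫ A.proj f y =
      A.actEl h (a ≫ A.proj f x) b (by rw [Category.assoc, ← reindex_toObj, hab]) := by
  have : (A.reindex f).act h ≫ A.proj f y = A.actEl h
      (pullback.fst ((A.reindex f).toObj x) (I.src h) ≫ A.proj f x) (pullback.snd _ _)
      (by rw [Category.assoc, ← reindex_toObj, pullback.condition]) := pullback.lift_fst _ _ _
  rw [actEl, Category.assoc, this, comp_actEl]
  exact A.actEl_congr h (by simp) (by simp) _ _

end

/-- A map `D ⟶ f^* B` given by its components `D_x ⟶ B_x`. -/
def homToReindex {D : Diagram I Z} {B : Diagram I X} {f : Z ⟶ X} (φ : ∀ x, D.obj x ⟶ B.obj x)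
    (φ_base : ∀ x, φ x ≫ B.toBase x = D.toBase x ≫ f)
    (φ_obj : ∀ x, φ x ≫ B.toObj x = D.toObj x)
    (φ_act : ∀ {x y : I.Ob} (h : I.rel y x) {T : C} (a : T ⟶ D.obj x) (b : T ⟶ I.hom h)
      (hab : a ≫ D.toObj x = b ≫ I.src h),
      D.actEl h a b hab ≫ φ y =
        B.actEl h (a ≫ φ x) b (by rw [Category.assoc, φ_obj, hab])) : D ⟶ B.reindex f :=
  Hom.ofElements
    (fun x => B.reindexLift f x (φ x) (D.toBase x) (φ_base x))
    (fun x => by simp)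
    (fun x => by rw [reindex_toObj, reindexLift_proj_assoc, φ_obj])
    (fun h T a b hab => by
      apply reindex_hom_ext
      · rw [Category.assoc, reindexLift_proj, reindex_actEl_proj, φ_act]
        exact B.actEl_congr h (by simp) rfl _ _
      · simp [actEl_toBase])

lemma homToReindex_proj {D : Diagram I Z} {B : Diagram I X} {f : Z ⟶ X}
    (φ : ∀ x, D.obj x ⟶ B.obj x) (h₁ : ∀ x, φ x ≫ B.toBase x = D.toBase x ≫ f)
    (h₂ : ∀ x, φ x ≫ B.toObj x = D.toObj x)
    (h₃ : ∀ {x y : I.Ob} (h : I.rel y x) {T : C} (a : T ⟶ D.obj x) (b : T ⟶ I.hom h)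
      (hab : a ≫ D.toObj x = b ≫ I.src h),
      D.actEl h a b hab ≫ φ y =
        B.actEl h (a ≫ φ x) b (by rw [Category.assoc, h₂, hab])) (x : I.Ob) :
    (homToReindex φ h₁ h₂ h₃).app x ≫ B.proj f x = φ x :=
  reindexLift_proj ..

/-- Reindexing of maps of diagrams. -/
def reindexMap {A B : Diagram I X} (g : A ⟶ B) (f : Z ⟶ X) : A.reindex f ⟶ B.reindex f :=
  homToReindex (fun x => A.proj f x ≫ g.app x)
    (fun x => by rw [Category.assoc, g.app_base, proj_toBase])
    (fun x => by rw [Category.assoc, g.app_obj, reindex_toObj])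
    (fun h T a b hab => by
      rw [← Category.assoc, reindex_actEl_proj, g.actEl_app]
      exact B.actEl_congr h (by simp) rfl _ _)

/-- The canonical projection `(k^* p^* A)_x ⟶ (p^* A)_x`, with `k^* p^* A` identified with the
reindexing along the composite `p' = k ≫ p`. -/
def along (A : Diagram I X) {p : Z ⟶ X} {p' : Z' ⟶ X} (k : Z' ⟶ Z) (hp : k ≫ p = p') (x : I.Ob) :
    (A.reindex p').obj x ⟶ (A.reindex p).obj x :=
  A.reindexLift p x (A.proj p' x) ((A.reindex p').toBase x ≫ k)
    (by rw [Category.assoc, hp, proj_toBase])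

section

variable (A : Diagram I X) {p : Z ⟶ X} {p' : Z' ⟶ X} (k : Z' ⟶ Z) (hp : k ≫ p = p') (x : I.Ob)

@[simp]
lemma along_proj : A.along k hp x ≫ A.proj p x = A.proj p' x := reindexLift_proj ..

@[simp]
lemma along_toBase :
    A.along k hp x ≫ (A.reindex p).toBase x = (A.reindex p').toBase x ≫ k :=
  reindexLift_toBase ..

@[simp]
lemma along_toObj : A.along k hp x ≫ (A.reindex p).toObj x = (A.reindex p').toObj x := by
  rw [reindex_toObj, ← Category.assoc, along_proj, reindex_toObj]

lemma along_id (h : 𝟙 Z ≫ p = p) : A.along (𝟙 Z) h x = 𝟙 _ := by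
  apply reindex_hom_ext <;> simp

lemma along_comp {p'' : Z'' ⟶ X} (l : Z'' ⟶ Z') (hl : l ≫ p' = p'') (h : (l ≫ k) ≫ p = p'') :
    A.along l hl x ≫ A.along k hp x = A.along (l ≫ k) h x := by
  apply reindex_hom_ext
  · simp
  · rw [Category.assoc, along_toBase, ← Category.assoc, along_toBase, along_toBase, Category.assoc]

lemma actEl_along {x y : I.Ob} (h : I.rel y x) {T : C} (a : T ⟶ (A.reindex p').obj x)
    (b : T ⟶ I.hom h) (hab : a ≫ (A.reindex p').toObj x = b ≫ I.src h) :
    (A.reindex p').actEl h a b hab ≫ A.along k hp y =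
      (A.reindex p).actEl h (a ≫ A.along k hp x) b
        (by rw [Category.assoc, along_toObj, hab]) := by
  apply reindex_hom_ext
  · rw [Category.assoc, along_proj, reindex_actEl_proj, reindex_actEl_proj]
    exact A.actEl_congr h (by simp) rfl _ _
  · rw [Category.assoc, along_toBase, ← Category.assoc, actEl_toBase, actEl_toBase]
    simp

end

/-- Pullback of a map `p^* A ⟶ q^* B` of diagrams over `Z` along `k : Z' ⟶ Z`, with
`k^* p^* A` and `k^* q^* B` identified with the reindexings along the composites. -/
def pullHom {A : Diagram I X} {B : Diagram I Y} {p : Z ⟶ X} {q : Z ⟶ Y}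
    (k : Z' ⟶ Z) {p' : Z' ⟶ X} {q' : Z' ⟶ Y} (hp : k ≫ p = p') (hq : k ≫ q = q')
    (g : A.reindex p ⟶ B.reindex q) : A.reindex p' ⟶ B.reindex q' :=
  homToReindex (fun x => A.along k hp x ≫ g.app x ≫ B.proj q x)
    (fun x => by
      rw [Category.assoc, Category.assoc, proj_toBase, ← Category.assoc (g.app x), g.app_base,
        ← Category.assoc, along_toBase, Category.assoc, hq])
    (fun x => by rw [Category.assoc, Category.assoc, ← reindex_toObj, g.app_obj, along_toObj])
    (fun {x y} h T a b hab => by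
      rw [← Category.assoc, actEl_along, ← Category.assoc, g.actEl_app, reindex_actEl_proj]
      exact B.actEl_congr h (by simp) rfl _ _)

/-- A map into a reindexed diagram is determined by its components in the original diagram. -/
lemma hom_reindex_ext {D : Diagram I Z} {B : Diagram I Y} {q : Z ⟶ Y} {f g : D ⟶ B.reindex q}
    (h : ∀ x, f.app x ≫ B.proj q x = g.app x ≫ B.proj q x) : f = g := by
  ext x
  exact reindex_hom_ext (h x) (by rw [f.app_base, g.app_base])

lemma pullHom_proj {A : Diagram I X} {B : Diagram I Y} {p : Z ⟶ X} {q : Z ⟶ Y}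
    (k : Z' ⟶ Z) {p' : Z' ⟶ X} {q' : Z' ⟶ Y} (hp : k ≫ p = p') (hq : k ≫ q = q')
    (g : A.reindex p ⟶ B.reindex q) (x : I.Ob) :
    (pullHom k hp hq g).app x ≫ B.proj q' x = A.along k hp x ≫ g.app x ≫ B.proj q x :=
  reindexLift_proj ..

lemma reindexMap_proj {A B : Diagram I X} (g : A ⟶ B) (f : Z ⟶ X) (x : I.Ob) :
    (reindexMap g f).app x ≫ B.proj f x = A.proj f x ≫ g.app x :=
  reindexLift_proj ..

lemma pullHom_id {A : Diagram I X} {B : Diagram I Y} {p : Z ⟶ X} {q : Z ⟶ Y}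
    (hp : 𝟙 Z ≫ p = p) (hq : 𝟙 Z ≫ q = q) (g : A.reindex p ⟶ B.reindex q) :
    pullHom (𝟙 Z) hp hq g = g :=
  hom_reindex_ext fun x => by rw [pullHom_proj, along_id, Category.id_comp]

lemma pullHom_comp {A : Diagram I X} {B : Diagram I Y} {p : Z ⟶ X} {q : Z ⟶ Y}
    (k : Z' ⟶ Z) {p' : Z' ⟶ X} {q' : Z' ⟶ Y} (hp : k ≫ p = p') (hq : k ≫ q = q')
    (l : Z'' ⟶ Z') {p'' : Z'' ⟶ X} {q'' : Z'' ⟶ Y} (hp' : l ≫ p' = p'') (hq' : l ≫ q' = q'')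
    (h : (l ≫ k) ≫ p = p'') (h' : (l ≫ k) ≫ q = q'') (g : A.reindex p ⟶ B.reindex q) :
    pullHom (l ≫ k) h h' g = pullHom l hp' hq' (pullHom k hp hq g) :=
  hom_reindex_ext fun x => by
    rw [pullHom_proj, pullHom_proj, pullHom_proj, ← A.along_comp k hp x l hp' h, Category.assoc]

lemma pullHom_reindexMap {A : Diagram I X} {B B' : Diagram I Y} {p : Z ⟶ X} {q : Z ⟶ Y}
    (k : Z' ⟶ Z) {p' : Z' ⟶ X} {q' : Z' ⟶ Y} (hp : k ≫ p = p') (hq : k ≫ q = q')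
    (g : A.reindex p ⟶ B.reindex q) (f : B ⟶ B') :
    pullHom k hp hq g ≫ reindexMap f q' = pullHom k hp hq (g ≫ reindexMap f q) :=
  hom_reindex_ext fun x => by
    rw [pullHom_proj, comp_app, comp_app, Category.assoc, Category.assoc, reindexMap_proj,
      reindexMap_proj, ← Category.assoc, pullHom_proj, Category.assoc, Category.assoc]

/-- The functor `(C/(X × Y))ᵒᵖ ⥤ Set`, `((p, q) : Z ⟶ X × Y) ↦ (C^I)^Z (p^* A, q^* B)`.
A representing object is the hom-object `C^I(A, B) ⟶ X × Y`. -/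
def homFunctor [HasBinaryProducts C] (A : Diagram I X) (B : Diagram I Y) :
    (Over (X ⨯ Y))ᵒᵖ ⥤ Type (max w v) where
  obj Z := A.reindex (Z.unop.hom ≫ prod.fst) ⟶ B.reindex (Z.unop.hom ≫ prod.snd)
  map k := ↾fun g => pullHom k.unop.left (by rw [Over.w_assoc]) (by rw [Over.w_assoc]) g
  map_id Z := ConcreteCategory.hom_ext _ _ fun g =>
    pullHom_id (Category.id_comp _) (Category.id_comp _) g
  map_comp k l := ConcreteCategory.hom_ext _ _ fun g =>
    pullHom_comp k.unop.left (by rw [Over.w_assoc]) (by rw [Over.w_assoc])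
      l.unop.left (by rw [Over.w_assoc]) (by rw [Over.w_assoc])
      (by rw [Category.assoc, Over.w_assoc, Over.w_assoc])
      (by rw [Category.assoc, Over.w_assoc, Over.w_assoc]) g

/-- The map of hom-functors `C^I(A, B) ⟶ C^I(A, B')` given by composition with `f : B ⟶ B'`. -/
def homFunctorMap [HasBinaryProducts C] (A : Diagram I X) {B B' : Diagram I Y} (f : B ⟶ B') :
    A.homFunctor B ⟶ A.homFunctor B' where
  app Z := ↾fun g : A.reindex (Z.unop.hom ≫ prod.fst) ⟶ B.reindex (Z.unop.hom ≫ prod.snd) =>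
    g ≫ reindexMap f (Z.unop.hom ≫ prod.snd)
  naturality Z Z' k := ConcreteCategory.hom_ext _ _ fun g =>
    pullHom_reindexMap k.unop.left (by rw [Over.w_assoc]) (by rw [Over.w_assoc]) g f

end Diagram

/-- The diagram `I(x,-)`, an object of `(C^{<x})^{I(x)}`, where `<x` is `I.below x`. -/
def homFrom (I : InternalInverseCategory.{w} C) (x : I.Ob) : Diagram (I.below x) (I.obj x) where
  obj y := I.hom y.2
  toBase y := I.src y.2
  toObj y := I.tgt y.2
  act {y _} h := I.comp y.2 h
  act_base {y _} h := I.comp_src y.2 h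
  act_obj {y _} h := I.comp_tgt y.2 h
  assoc {y _ _} h k _ a b c hab hbc := I.assoc y.2 h k a b c hab hbc

namespace Diagram

variable {I : InternalInverseCategory.{w} C} {X : C}

lemma actHom_aux (A : Diagram I X) (x : I.Ob) {p : A.obj x ⟶ I.obj x} (hp : p = A.toObj x)
    (y : (I.below x).Ob) :
    ((I.homFrom x).reindex p).toBase y ≫ A.toObj x = (I.homFrom x).proj p y ≫ I.src y.2 := by
  rw [← hp]
  exact ((I.homFrom x).proj_toBase p y).symm

/-- The actions on `A_x`, assembled into a map of diagrams over `A_x` from the reindexing of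
`I(x,-)` along `A_x ⟶ I(x)` to the reindexing of the restriction of `A` along `A_x ⟶ X`; its
component at `y ≺ x` is the map `I(x,y) ×_{I(x)} A_x ⟶ A_y ×_X A_x` given by the action and the
projection. -/
def actHom (A : Diagram I X) (x : I.Ob) {p : A.obj x ⟶ I.obj x} {q : A.obj x ⟶ X}
    (hp : p = A.toObj x) (hq : q = A.toBase x) :
    (I.homFrom x).reindex p ⟶ (A.restrict {y | I.rel y x}).reindex q :=
  homToReindex
    (fun y => A.actEl y.2 (((I.homFrom x).reindex p).toBase y) ((I.homFrom x).proj p y)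
      (actHom_aux A x hp y))
    (fun y => by rw [hq]; exact A.actEl_toBase _ _ _ _)
    (fun y => A.actEl_toObj _ _ _ _)
    (fun {y z} h T a b hab => by
      have hbc : (a ≫ (I.homFrom x).proj p y) ≫ I.tgt y.2 = b ≫ I.src h :=
        (Category.assoc _ _ _).trans hab
      have hab' : (a ≫ ((I.homFrom x).reindex p).toBase y) ≫ A.toObj x =
          (a ≫ (I.homFrom x).proj p y) ≫ I.src y.2 :=
        (Category.assoc _ _ _).trans ((congrArg (a ≫ ·) (actHom_aux A x hp y)).trans
          (Category.assoc _ _ _).symm)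
      have key := A.assocEl y.2 h (a ≫ ((I.homFrom x).reindex p).toBase y)
        (a ≫ (I.homFrom x).proj p y) b hab' hbc
      refine (A.comp_actEl _ _ _ _ _).trans ?_
      refine Eq.trans ?_ (key.symm.trans ?_)
      · exact A.actEl_congr _ (actEl_toBase _ _ _ _ _) (reindex_actEl_proj ..) _ _
      · exact A.actEl_congr h (A.comp_actEl _ _ _ _ _).symm rfl _ _)

lemma actHom_proj (A : Diagram I X) (x : I.Ob) {p : A.obj x ⟶ I.obj x} {q : A.obj x ⟶ X}
    (hp : p = A.toObj x) (hq : q = A.toBase x) (y : (I.below x).Ob) :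
    (A.actHom x hp hq).app y ≫ (A.restrict {y | I.rel y x}).proj q y =
      A.actEl y.2 (((I.homFrom x).reindex p).toBase y) ((I.homFrom x).proj p y)
        (actHom_aux A x hp y) :=
  reindexLift_proj ..

variable [HasBinaryProducts C]

/-- The functor that the matching object `M_x A = C^{<x}(I(x,-), A)` represents. -/
def matchingFunctor (A : Diagram I X) (x : I.Ob) : (Over (I.obj x ⨯ X))ᵒᵖ ⥤ Type (max w v) :=
  (I.homFrom x).homFunctor (A.restrict {y | I.rel y x})

/-- `A_x` as an object over `I(x) × X`. -/
def overObj (A : Diagram I X) (x : I.Ob) : Over (I.obj x ⨯ X) :=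
  Over.mk (prod.lift (A.toObj x) (A.toBase x))

/-- The element of the matching functor classifying the map `A_x ⟶ M_x A`. -/
def actElement (A : Diagram I X) (x : I.Ob) :
    (A.matchingFunctor x).obj (Opposite.op (A.overObj x)) :=
  A.actHom x (p := prod.lift (A.toObj x) (A.toBase x) ≫ prod.fst)
    (q := prod.lift (A.toObj x) (A.toBase x) ≫ prod.snd) (prod.lift_fst _ _) (prod.lift_snd _ _)

/-- The map `A_x ⟶ M_x A` over `I(x) × X`, for a matching object `M_x A`. -/
def matchingMap (A : Diagram I X) (x : I.Ob) {M : Over (I.obj x ⨯ X)}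
    (r : (A.matchingFunctor x).RepresentableBy M) : A.overObj x ⟶ M :=
  r.homEquiv.symm (A.actElement x)

variable {A B : Diagram I X} (f : A ⟶ B) (x : I.Ob)

/-- The map `M_x f` on functors represented by matching objects. -/
def matchingFunctorMap : A.matchingFunctor x ⟶ B.matchingFunctor x :=
  homFunctorMap _ (restrictMap f _)

/-- The map `M_x f : M_x A ⟶ M_x B` over `I(x) × X`, for matching objects `M_x A` and `M_x B`. -/
def matchingObjMap {MA MB : Over (I.obj x ⨯ X)} (rA : (A.matchingFunctor x).RepresentableBy MA)
    (rB : (B.matchingFunctor x).RepresentableBy MB) : MA ⟶ MB :=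
  rB.homEquiv.symm ((matchingFunctorMap f x).app _ (rA.homEquiv (𝟙 MA)))

/-- The map `f_x : A_x ⟶ B_x` over `I(x) × X`. -/
def overMap : A.overObj x ⟶ B.overObj x :=
  Over.homMk (f.app x) (by
    apply Limits.prod.hom_ext <;> simp [overObj, f.app_obj, f.app_base])

lemma actHom_naturality {p : A.obj x ⟶ I.obj x} {q : A.obj x ⟶ X} (hp : p = A.toObj x)
    (hq : q = A.toBase x) {p' : B.obj x ⟶ I.obj x} {q' : B.obj x ⟶ X} (hp' : p' = B.toObj x)
    (hq' : q' = B.toBase x) (h : f.app x ≫ p' = p) (h' : f.app x ≫ q' = q) :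
    pullHom (f.app x) h h' (B.actHom x hp' hq') =
      A.actHom x hp hq ≫ reindexMap (restrictMap f {y | I.rel y x}) q :=
  hom_reindex_ext fun y => by
    refine (pullHom_proj _ _ _ _ y).trans ?_
    refine (congrArg (_ ≫ ·) (B.actHom_proj x hp' hq' y)).trans ?_
    refine Eq.trans ?_ (Category.assoc _ _ _).symm
    refine Eq.trans ?_ (congrArg (_ ≫ ·) (reindexMap_proj _ _ y).symm)
    refine Eq.trans ?_ (Category.assoc _ _ _)
    refine Eq.trans ?_ (congrArg (· ≫ _) (A.actHom_proj x hp hq y).symm)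
    refine (B.comp_actEl _ _ _ _ _).trans ?_
    refine Eq.trans ?_ (f.actEl_app _ _ _ _).symm
    exact B.actEl_congr _ (along_toBase ..) (along_proj ..) _ _

lemma actElement_naturality :
    (B.matchingFunctor x).map (overMap f x).op (B.actElement x) =
      (matchingFunctorMap f x).app _ (A.actElement x) :=
  actHom_naturality f x (prod.lift_fst _ _) (prod.lift_snd _ _) (prod.lift_fst _ _)
    (prod.lift_snd _ _)
    (by rw [prod.lift_fst, prod.lift_fst, f.app_obj])
    (by rw [prod.lift_snd, prod.lift_snd, f.app_base])

lemma overMap_matchingMap {MA MB : Over (I.obj x ⨯ X)}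
    (rA : (A.matchingFunctor x).RepresentableBy MA)
    (rB : (B.matchingFunctor x).RepresentableBy MB) :
    overMap f x ≫ B.matchingMap x rB = A.matchingMap x rA ≫ matchingObjMap f x rA rB := by
  rw [matchingMap, matchingObjMap, rB.comp_homEquiv_symm, rB.comp_homEquiv_symm,
    actElement_naturality, ← NatTrans.naturality_apply, ← rA.homEquiv_comp, Category.comp_id,
    matchingMap, Equiv.apply_symm_apply]

/-- The relative matching map `A_x ⟶ B_x ×_{M_x B} M_x A`. -/
def relMatchingMap {MA MB : Over (I.obj x ⨯ X)} (rA : (A.matchingFunctor x).RepresentableBy MA)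
    (rB : (B.matchingFunctor x).RepresentableBy MB) :
    A.obj x ⟶ pullback (B.matchingMap x rB).left (matchingObjMap f x rA rB).left :=
  pullback.lift (f.app x) (A.matchingMap x rA).left
    (congrArg CommaMorphism.left (overMap_matchingMap f x rA rB))

/-- `A` is Reedy fibrant relative to a class `P` of maps of `C`: each matching object `M_x A`
exists and each map `A_x ⟶ M_x A` is in `P`. -/
def IsReedyFibrant (P : MorphismProperty C) (A : Diagram I X) : Prop :=
  ∀ x, (A.matchingFunctor x).IsRepresentable ∧
    ∀ (M : Over (I.obj x ⨯ X)) (r : (A.matchingFunctor x).RepresentableBy M),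
      P (A.matchingMap x r).left

/-- `f : A ⟶ B` is a Reedy fibration relative to a class `P` of maps of `C`: all matching objects
`M_x A` and `M_x B` exist and each relative matching map `A_x ⟶ B_x ×_{M_x B} M_x A` is in `P`. -/
def IsReedyFibration (P : MorphismProperty C) {A B : Diagram I X} (f : A ⟶ B) : Prop :=
  ∀ x, (A.matchingFunctor x).IsRepresentable ∧ (B.matchingFunctor x).IsRepresentable ∧
    ∀ (MA MB : Over (I.obj x ⨯ X)) (rA : (A.matchingFunctor x).RepresentableBy MA)
      (rB : (B.matchingFunctor x).RepresentableBy MB), P (relMatchingMap f x rA rB)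

/-- `f : A ⟶ B` is levelwise in a class `P` of maps of `C`. -/
def IsLevelwise (P : MorphismProperty C) {A B : Diagram I X} (f : A ⟶ B) : Prop :=
  ∀ x, P (f.app x)

end Diagram
end InternalInverseCategory

/-- `I` is fibrant: each `I(x)` is fibrant and each `I(x,-)` is Reedy fibrant. -/
def InternalInverseCategory.IsFibrant {C : Type u} [Category.{v} C] [ModelCategory C]
    (I : InternalInverseCategory.{w} C) : Prop :=
  ∀ x, HomotopicalAlgebra.IsFibrant (I.obj x) ∧ (I.homFrom x).IsReedyFibrant (fibrations C)

end

/-! The whole structure is governed by one lifting condition. A generalized element of the matching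
object `M_x A` is a family of operations taking elements of `I(x,-)` to elements of `A` below `x`.
`InjAt Q f x` says in these terms that the relative matching map of `f` at `x` lifts against `Q`; it
makes sense before any matching object is known to exist. If it holds at every `x`, then `f` lifts
against all levelwise `Q`-maps: a lift below `x`, composed with the actions, is an element of the
matching object, and the condition supplies the component at `x` (`hasLiftingProperty_of_injAt`).

Fibrancy of `I` enters through `IsFibrant.fibration_src`: each `I(x,y) ⟶ I(x)` is the composite
`I(x,y) ⟶ M_y I(x,-) ⟶ I(y) × I(x) ⟶ I(x)` of fibrations, the middle one by induction. This has
three consequences. Pullback along source maps has a right adjoint, so matching objects can be built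
from such right adjoints and limits (`exists_matchingObject`). Pullback along source maps preserves
colimits, so colimits of diagrams are levelwise; limits are levelwise in any case. By right
properness, and since limits preserve cofibrations, acyclic cofibrations are stable under pullback
along source maps.

Cofibrations are stable under all pullbacks. Hence, when `f` is a Reedy acyclic fibration below `x`,
the projection `B_x ×_{M_x B} M_x A ⟶ B_x` is an acyclic fibration. With two-out-of-three this
identifies Reedy acyclic fibrations with Reedy fibrations that are levelwise weak equivalences
(`injAt_cofibrations_iff`). Factorizations are built by well-founded recursion, factoring `A_x ⟶ B_x
×_{M_x B} M_x D` in `C` once the middle diagram `D` is known below `x` (`exists_factorization`).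
Two-out-of-three, and the retract axioms for cofibrations and weak equivalences, hold levelwise. -/

noncomputable section

/-! ### Choice along a well-founded relation; composition on generalized elements. -/

namespace InternalInverseCategory

attribute [local simp] pullback.lift_fst pullback.lift_fst_assoc pullback.lift_snd
  pullback.lift_snd_assoc

/-- Choice along a well-founded relation: if every compatible choice of data below `x` extends to
`x`, there is a global compatible choice. -/
lemma exists_wellFounded_choice {α : Type*} {r : α → α → Prop} (hr : WellFounded r)
    (htrans : ∀ {x y z}, r z y → r y x → r z x) {β : α → Type*}
    (good : ∀ x, (∀ y, r y x → β y) → β x → Prop)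
    (step : ∀ x (s : ∀ y, r y x → β y),
      (∀ y (h : r y x), good y (fun z k => s z (htrans k h)) (s y h)) → ∃ b, good x s b) :
    ∃ s : ∀ x, β x, ∀ x, good x (fun y _ => s y) (s x) := by
  classical
  -- Values in `Option` let the recursion run without carrying goodness along; the value `none` is
  -- shown below never to occur.
  let F : ∀ x, (∀ y, r y x → Option (β y)) → Option (β x) := fun x t =>
    if h : ∃ (s : ∀ y, r y x → β y) (b : β x), (∀ y h, t y h = some (s y h)) ∧ good x s b then
      some h.choose_spec.choose else none
  let G : ∀ x, Option (β x) := hr.fix F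
  have hG : ∀ x, G x = F x (fun y _ => G y) := fun x => hr.fix_eq F x
  have key : ∀ x, ∃ b, G x = some b ∧
      ∃ s : ∀ y, r y x → β y, (∀ y h, G y = some (s y h)) ∧ good x s b := by
    intro x
    induction x using hr.induction with
    | _ x ih =>
      choose s hs hs' using ih
      have h : ∃ (s : ∀ y, r y x → β y) (b : β x), (∀ y h, G y = some (s y h)) ∧ good x s b := by
        refine ⟨s, ?_⟩
        obtain ⟨b, hb⟩ := step x s (fun y h => by
          obtain ⟨s', h₁, h₂⟩ := hs' y h
          -- Both families consist of values of `G`, so the data witnessing goodness at `y` are the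
          -- restriction of those chosen below `x`.
          have : s' = fun z k => s z (htrans k h) := by
            funext z k
            exact Option.some_injective _ ((h₁ z k).symm.trans (hs z (htrans k h)))
          rwa [this] at h₂)
        exact ⟨b, hs, hb⟩
      refine ⟨h.choose_spec.choose, ?_, h.choose, h.choose_spec.choose_spec⟩
      rw [hG]
      exact dif_pos h
  choose s hs s' hs' hg using key
  refine ⟨s, fun x => ?_⟩
  have : s' x = fun y _ => s y := by
    funext y h
    exact Option.some_injective _ ((hs' x y h).symm.trans (hs y))
  exact this ▸ hg x

variable {C : Type u} [Category.{v} C] [HasPullbacks C]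

/-- Composition on generalized elements. -/
def compEl (I : InternalInverseCategory.{w} C) {x y z : I.Ob} (h : I.rel y x) (k : I.rel z y)
    {T : C} (b : T ⟶ I.hom h) (c : T ⟶ I.hom k) (hbc : b ≫ I.tgt h = c ≫ I.src k) :
    T ⟶ I.hom (I.rel_trans k h) :=
  pullback.lift b c hbc ≫ I.comp h k

section

variable (I : InternalInverseCategory.{w} C) {x y z : I.Ob} (h : I.rel y x) (k : I.rel z y)
    {T : C} (b : T ⟶ I.hom h) (c : T ⟶ I.hom k) (hbc : b ≫ I.tgt h = c ≫ I.src k)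

lemma compEl_src : I.compEl h k b c hbc ≫ I.src (I.rel_trans k h) = b ≫ I.src h := by
  simp [compEl, I.comp_src]

lemma compEl_tgt : I.compEl h k b c hbc ≫ I.tgt (I.rel_trans k h) = c ≫ I.tgt k := by
  simp [compEl, I.comp_tgt]

end

/-! ### Diagrams and families of operations through generalized elements. -/

namespace Diagram

variable {I : InternalInverseCategory.{w} C} {X Y : C}

lemma actEl_actEl (A : Diagram I X) {x y z : I.Ob} (h : I.rel y x) (k : I.rel z y) {T : C}
    (a : T ⟶ A.obj x) (b : T ⟶ I.hom h) (c : T ⟶ I.hom k)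
    (hab : a ≫ A.toObj x = b ≫ I.src h) (hbc : b ≫ I.tgt h = c ≫ I.src k) :
    A.actEl k (A.actEl h a b hab) c (by rw [actEl_toObj, hbc]) =
      A.actEl (I.rel_trans k h) a (I.compEl h k b c hbc) (by rw [compEl_src, hab]) :=
  A.assocEl h k a b c hab hbc

/-- Constructor of diagrams with the action given on generalized elements. -/
def ofElements (obj : I.Ob → C) (toBase : ∀ x, obj x ⟶ X) (toObj : ∀ x, obj x ⟶ I.obj x)
    (el : ∀ {x y : I.Ob} (h : I.rel y x) {T : C} (a : T ⟶ obj x) (b : T ⟶ I.hom h)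
      (_ : a ≫ toObj x = b ≫ I.src h), T ⟶ obj y)
    (comp_el : ∀ {x y : I.Ob} (h : I.rel y x) {T T' : C} (t : T' ⟶ T) (a : T ⟶ obj x)
      (b : T ⟶ I.hom h) (hab : a ≫ toObj x = b ≫ I.src h),
      t ≫ el h a b hab = el h (t ≫ a) (t ≫ b) (by simp [hab]))
    (el_toBase : ∀ {x y : I.Ob} (h : I.rel y x) {T : C} (a : T ⟶ obj x) (b : T ⟶ I.hom h)
      (hab : a ≫ toObj x = b ≫ I.src h), el h a b hab ≫ toBase y = a ≫ toBase x)
    (el_toObj : ∀ {x y : I.Ob} (h : I.rel y x) {T : C} (a : T ⟶ obj x) (b : T ⟶ I.hom h)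
      (hab : a ≫ toObj x = b ≫ I.src h), el h a b hab ≫ toObj y = b ≫ I.tgt h)
    (el_el : ∀ {x y z : I.Ob} (h : I.rel y x) (k : I.rel z y) {T : C} (a : T ⟶ obj x)
      (b : T ⟶ I.hom h) (c : T ⟶ I.hom k) (hab : a ≫ toObj x = b ≫ I.src h)
      (hbc : b ≫ I.tgt h = c ≫ I.src k),
      el k (el h a b hab) c (by rw [el_toObj, hbc]) =
        el (I.rel_trans k h) a (I.compEl h k b c hbc) (by rw [compEl_src, hab])) :
    Diagram I X where
  obj := obj
  toBase := toBase
  toObj := toObj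
  act h := el h _ _ pullback.condition
  act_base h := el_toBase h _ _ _
  act_obj h := el_toObj h _ _ _
  assoc h k T a b c hab hbc := by
    simp only [comp_el]
    refine Eq.trans ?_ ((el_el h k a b c hab hbc).trans ?_)
    · congr 1 <;> simp
    · congr 1 <;> simp [compEl]

lemma ofElements_actEl (obj : I.Ob → C) (toBase : ∀ x, obj x ⟶ X) (toObj : ∀ x, obj x ⟶ I.obj x)
    (el : ∀ {x y : I.Ob} (h : I.rel y x) {T : C} (a : T ⟶ obj x) (b : T ⟶ I.hom h)
      (_ : a ≫ toObj x = b ≫ I.src h), T ⟶ obj y)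
    (comp_el : ∀ {x y : I.Ob} (h : I.rel y x) {T T' : C} (t : T' ⟶ T) (a : T ⟶ obj x)
      (b : T ⟶ I.hom h) (hab : a ≫ toObj x = b ≫ I.src h),
      t ≫ el h a b hab = el h (t ≫ a) (t ≫ b) (by simp [hab])) (h₁ h₂ h₃)
    {x y : I.Ob} (h : I.rel y x) {T : C} (a : T ⟶ obj x) (b : T ⟶ I.hom h)
    (hab : a ≫ toObj x = b ≫ I.src h) :
    (ofElements (X := X) obj toBase toObj el comp_el h₁ h₂ h₃).actEl h a b hab =
      el h a b hab := by
  refine (comp_el h (pullback.lift a b hab) (pullback.fst (toObj x) (I.src h))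
    (pullback.snd _ _) pullback.condition).trans ?_
  congr 1
  · exact pullback.lift_fst _ _ _
  · exact pullback.lift_snd _ _ _

/-- A map `p^* P ⟶ q^* B` of diagrams over `W`, as a family of operations on generalized
elements. -/
@[ext]
structure HomEl (P : Diagram I X) (B : Diagram I Y) {W : C} (p : W ⟶ X) (q : W ⟶ Y) where
  el : ∀ (y : I.Ob) {T : C} (w : T ⟶ W) (b : T ⟶ P.obj y) (_ : w ≫ p = b ≫ P.toBase y),
    T ⟶ B.obj y
  comp_el : ∀ (y : I.Ob) {T T' : C} (t : T' ⟶ T) (w : T ⟶ W) (b : T ⟶ P.obj y)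
    (h : w ≫ p = b ≫ P.toBase y),
    t ≫ el y w b h = el y (t ≫ w) (t ≫ b) (by simp [h])
  el_toBase : ∀ (y : I.Ob) {T : C} (w : T ⟶ W) (b : T ⟶ P.obj y) (h : w ≫ p = b ≫ P.toBase y),
    el y w b h ≫ B.toBase y = w ≫ q
  el_toObj : ∀ (y : I.Ob) {T : C} (w : T ⟶ W) (b : T ⟶ P.obj y) (h : w ≫ p = b ≫ P.toBase y),
    el y w b h ≫ B.toObj y = b ≫ P.toObj y
  actEl_el : ∀ {y z : I.Ob} (k : I.rel z y) {T : C} (w : T ⟶ W) (b : T ⟶ P.obj y)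
    (h : w ≫ p = b ≫ P.toBase y) (c : T ⟶ I.hom k) (hbc : b ≫ P.toObj y = c ≫ I.src k),
    B.actEl k (el y w b h) c (by rw [el_toObj, hbc]) =
      el z w (P.actEl k b c hbc) (by rw [actEl_toBase, h])

namespace HomEl

variable {P : Diagram I X} {B B' B'' : Diagram I Y} {W W' : C} {p : W ⟶ X} {q : W ⟶ Y}

lemma ext' {φ ψ : HomEl P B p q}
    (H : ∀ (y : I.Ob) {T : C} (w : T ⟶ W) (b : T ⟶ P.obj y) (h : w ≫ p = b ≫ P.toBase y),
      φ.el y w b h = ψ.el y w b h) : φ = ψ :=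
  HomEl.ext (by funext y T w b h; exact H y w b h)

lemma el_congr (φ : HomEl P B p q) {y : I.Ob} {T : C} {w w' : T ⟶ W} {b b' : T ⟶ P.obj y}
    (hw : w = w') (hb : b = b') (h : w ≫ p = b ≫ P.toBase y) (h' : w' ≫ p = b' ≫ P.toBase y) :
    φ.el y w b h = φ.el y w' b' h' := by
  subst hw hb; rfl

/-- Restriction along `k : W' ⟶ W`. -/
def pre (φ : HomEl P B p q) (k : W' ⟶ W) {p' : W' ⟶ X} {q' : W' ⟶ Y} (hp : k ≫ p = p')
    (hq : k ≫ q = q') : HomEl P B p' q' where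
  el y T w b h := φ.el y (w ≫ k) b (by rw [Category.assoc, hp, h])
  comp_el y T T' t w b h := by
    rw [φ.comp_el]
    exact φ.el_congr (Category.assoc _ _ _).symm rfl _ _
  el_toBase y T w b h := by rw [φ.el_toBase, Category.assoc, hq]
  el_toObj y T w b h := φ.el_toObj ..
  actEl_el k T w b h c hbc := φ.actEl_el ..

@[simp]
lemma pre_el (φ : HomEl P B p q) (k : W' ⟶ W) {p' : W' ⟶ X} {q' : W' ⟶ Y} (hp : k ≫ p = p')
    (hq : k ≫ q = q') (y : I.Ob) {T : C} (w : T ⟶ W') (b : T ⟶ P.obj y)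
    (h : w ≫ p' = b ≫ P.toBase y) : (φ.pre k hp hq).el y w b h =
      φ.el y (w ≫ k) b (by rw [Category.assoc, hp, h]) := rfl

/-- Composition with a map of diagrams. -/
def map (φ : HomEl P B p q) (f : B ⟶ B') : HomEl P B' p q where
  el y T w b h := φ.el y w b h ≫ f.app y
  comp_el y T T' t w b h := by rw [← Category.assoc, φ.comp_el]
  el_toBase y T w b h := by rw [Category.assoc, f.app_base, φ.el_toBase]
  el_toObj y T w b h := by rw [Category.assoc, f.app_obj, φ.el_toObj]
  actEl_el k T w b h c hbc := by
    rw [← f.actEl_app k _ c (by rw [φ.el_toObj, hbc]), φ.actEl_el k w b h c hbc]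

@[simp]
lemma map_el (φ : HomEl P B p q) (f : B ⟶ B') (y : I.Ob) {T : C} (w : T ⟶ W) (b : T ⟶ P.obj y)
    (h : w ≫ p = b ≫ P.toBase y) : (φ.map f).el y w b h = φ.el y w b h ≫ f.app y := rfl

/-- The map of diagrams corresponding to a family of operations. -/
def toHom (φ : HomEl P B p q) : P.reindex p ⟶ B.reindex q :=
  homToReindex (fun y => φ.el y ((P.reindex p).toBase y) (P.proj p y) (P.proj_toBase p y).symm)
    (fun y => φ.el_toBase ..)
    (fun y => φ.el_toObj ..)
    (fun {y z} h T a b hab => by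
      refine (φ.comp_el ..).trans ?_
      rw [B.actEl_congr h (φ.comp_el ..) rfl _ (by
        rw [φ.el_toObj, Category.assoc]; exact (Category.assoc _ _ _).symm.trans
          ((Category.assoc _ _ _).trans hab))]
      rw [φ.actEl_el h (a ≫ (P.reindex p).toBase y) (a ≫ P.proj p y) _ b
        ((Category.assoc _ _ _).trans hab)]
      exact φ.el_congr (actEl_toBase ..) (reindex_actEl_proj ..) _ _)

lemma toHom_proj (φ : HomEl P B p q) (y : I.Ob) : φ.toHom.app y ≫ B.proj q y =
    φ.el y ((P.reindex p).toBase y) (P.proj p y) (P.proj_toBase p y).symm :=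
  reindexLift_proj ..

/-- The operations on generalized elements corresponding to a map of diagrams. -/
def ofHom (g : P.reindex p ⟶ B.reindex q) : HomEl P B p q where
  el y T w b h := P.reindexLift p y b w h.symm ≫ g.app y ≫ B.proj q y
  comp_el y T T' t w b h := by
    rw [← Category.assoc]
    congr 1
    apply reindex_hom_ext <;> simp
  el_toBase y T w b h := by
    rw [Category.assoc, Category.assoc, proj_toBase, ← Category.assoc (g.app y), g.app_base]
    simp
  el_toObj y T w b h := by
    rw [Category.assoc, Category.assoc, ← reindex_toObj, g.app_obj, reindex_toObj]
    simp
  actEl_el {y z} k T w b h c hbc := by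
    have e : P.reindexLift p y b w h.symm ≫ (P.reindex p).toObj y = c ≫ I.src k := by
      rw [reindex_toObj, reindexLift_proj_assoc, hbc]
    have := g.actEl_app k (P.reindexLift p y b w h.symm) c e
    have h₂ := congrArg (· ≫ B.proj q z) this
    simp only [Category.assoc, reindex_actEl_proj] at h₂
    rw [h₂.symm, ← Category.assoc, ← Category.assoc]
    congr 2
    apply reindex_hom_ext
    · rw [reindex_actEl_proj]
      exact (P.actEl_congr k (reindexLift_proj ..) rfl _ hbc).trans (reindexLift_proj ..).symm
    · rw [actEl_toBase, reindexLift_toBase, reindexLift_toBase]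

lemma ofHom_el (g : P.reindex p ⟶ B.reindex q) (y : I.Ob) {T : C} (w : T ⟶ W) (b : T ⟶ P.obj y)
    (h : w ≫ p = b ≫ P.toBase y) : (ofHom g).el y w b h =
      P.reindexLift p y b w h.symm ≫ g.app y ≫ B.proj q y := rfl

/-- Families of operations on generalized elements correspond to maps of diagrams. -/
def equiv : HomEl P B p q ≃ (P.reindex p ⟶ B.reindex q) where
  toFun := toHom
  invFun := ofHom
  left_inv φ := ext' fun y T w b h => by
    rw [ofHom_el, toHom_proj, φ.comp_el]
    exact φ.el_congr (by simp) (by simp) _ _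
  right_inv g := hom_reindex_ext fun y => by
    rw [toHom_proj, ofHom_el, ← Category.assoc]
    have : P.reindexLift p y (P.proj p y) ((P.reindex p).toBase y) (P.proj_toBase p y) = 𝟙 _ := by
      apply reindex_hom_ext <;> simp
    rw [this, Category.id_comp]

/-- This is the advantage of operations over maps of reindexed diagrams: pulling back becomes plain
precomposition, with no comparison of iterated reindexings. -/
lemma equiv_symm_pullHom (g : P.reindex p ⟶ B.reindex q) (k : W' ⟶ W) {p' : W' ⟶ X}
    {q' : W' ⟶ Y} (hp : k ≫ p = p') (hq : k ≫ q = q') :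
    ofHom (pullHom k hp hq g) = (ofHom g).pre k hp hq := ext' fun y T w b h => by
  rw [ofHom_el, pullHom_proj, pre_el, ofHom_el, ← Category.assoc]
  congr 1
  apply reindex_hom_ext <;> simp

lemma equiv_symm_reindexMap (g : P.reindex p ⟶ B.reindex q) (f : B ⟶ B') :
    ofHom (g ≫ reindexMap f q) = (ofHom g).map f := ext' fun y T w b h => by
  rw [ofHom_el, comp_app, Category.assoc, reindexMap_proj, map_el, ofHom_el]
  simp

end HomEl

end Diagram

end InternalInverseCategory

/-! ### Lifting conditions expressed without matching objects. -/

namespace InternalInverseCategory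

namespace Diagram

variable {C : Type u} [Category.{v} C] [HasPullbacks C] {I : InternalInverseCategory.{w} C}
  {X Y : C}

/-- The actions on a generalized element `a` of `A_x`. -/
def ofAct (A : Diagram I X) (x : I.Ob) {W : C} (a : W ⟶ A.obj x) {p : W ⟶ I.obj x} {q : W ⟶ X}
    (hp : a ≫ A.toObj x = p) (hq : a ≫ A.toBase x = q) :
    HomEl (I.homFrom x) (A.restrict {y | I.rel y x}) p q where
  el y T w b h := A.actEl y.2 (w ≫ a) b (by rw [Category.assoc, hp]; exact h)
  comp_el y T T' t w b h := (A.comp_actEl ..).trans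
    (A.actEl_congr _ (Category.assoc _ _ _).symm rfl _ _)
  el_toBase y T w b h := (A.actEl_toBase ..).trans (by rw [Category.assoc, hq])
  el_toObj y T w b h := A.actEl_toObj ..
  actEl_el {y z} k T w b h c hbc := A.actEl_actEl y.2 k (w ≫ a) b c _ hbc

lemma ofAct_pre (A : Diagram I X) (x : I.Ob) {W W' : C} (a : W ⟶ A.obj x) {p : W ⟶ I.obj x}
    {q : W ⟶ X} (hp : a ≫ A.toObj x = p) (hq : a ≫ A.toBase x = q) (k : W' ⟶ W)
    {p' : W' ⟶ I.obj x} {q' : W' ⟶ X} (hp' : k ≫ p = p') (hq' : k ≫ q = q') :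
    (A.ofAct x a hp hq).pre k hp' hq' = A.ofAct x (k ≫ a) (by rw [Category.assoc, hp, hp'])
      (by rw [Category.assoc, hq, hq']) :=
  HomEl.ext' fun _ _ _ _ _ => A.actEl_congr _ (Category.assoc _ _ _) rfl _ _

lemma ofAct_map {A B : Diagram I X} (f : A ⟶ B) (x : I.Ob) {W : C} (a : W ⟶ A.obj x)
    {p : W ⟶ I.obj x} {q : W ⟶ X} (hp : a ≫ A.toObj x = p) (hq : a ≫ A.toBase x = q) :
    (A.ofAct x a hp hq).map (restrictMap f _) = B.ofAct x (a ≫ f.app x)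
      (by rw [Category.assoc, f.app_obj, hp]) (by rw [Category.assoc, f.app_base, hq]) :=
  HomEl.ext' fun _ _ _ _ _ => (f.actEl_app _ _ _ _).trans
    (B.actEl_congr _ (Category.assoc _ _ _) rfl _ _)

/-- The relative matching map of `f` at `x` has the right lifting property with respect to `Q`,
expressed without reference to matching objects. -/
def InjAt (Q : MorphismProperty C) {A B : Diagram I X} (f : A ⟶ B) (x : I.Ob) : Prop :=
  ∀ ⦃Z W : C⦄ (i : Z ⟶ W), Q i → ∀ (a : Z ⟶ A.obj x) (b : W ⟶ B.obj x)
    (hab : a ≫ f.app x = i ≫ b)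
    -- `φ` plays the role of a map from `W` to `M_x A`; the two equations below say that it
    -- restricts to `a` on `Z` and has the same image as `b` in `M_x B`.
    (φ : HomEl (I.homFrom x) (A.restrict {y | I.rel y x}) (b ≫ B.toObj x) (b ≫ B.toBase x)),
    φ.pre i rfl rfl = A.ofAct x a (by rw [← f.app_obj, ← Category.assoc, hab, Category.assoc])
      (by rw [← f.app_base, ← Category.assoc, hab, Category.assoc]) →
    φ.map (restrictMap f _) = B.ofAct x b rfl rfl →
    ∃ (l : W ⟶ A.obj x) (_ : i ≫ l = a) (h : l ≫ f.app x = b),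
      A.ofAct x l (by rw [← h, Category.assoc, f.app_obj])
        (by rw [← h, Category.assoc, f.app_base]) = φ

/-- Levelwise `Q`-maps lift against maps whose relative matching maps are right orthogonal to
`Q`. -/
theorem hasLiftingProperty_of_injAt (Q : MorphismProperty C) {A B U V : Diagram I X} (i : U ⟶ V)
    (f : A ⟶ B) (hi : IsLevelwise Q i) (hf : ∀ x, InjAt Q f x) : HasLiftingProperty i f where
  sq_hasLift {a b} sq := by
    have hsq (x) : a.app x ≫ f.app x = i.app x ≫ b.app x := by
      rw [← comp_app, sq.w, comp_app]
    -- The lift is chosen component by component; the last clause is compatibility with the actions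
    -- out of `x`, which involves only components below `x`.
    obtain ⟨s, hs⟩ := exists_wellFounded_choice I.rel_wf I.rel_trans
      (β := fun x => V.obj x ⟶ A.obj x)
      (fun x s l => i.app x ≫ l = a.app x ∧ l ≫ f.app x = b.app x ∧
        ∀ (y : I.Ob) (h : I.rel y x) {T : C} (t : T ⟶ V.obj x) (c : T ⟶ I.hom h)
          (e : t ≫ V.toObj x = c ≫ I.src h) (e' : (t ≫ l) ≫ A.toObj x = c ≫ I.src h),
          A.actEl h (t ≫ l) c e' = V.actEl h t c e ≫ s y h)
      (fun x s hs => by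
        have hobj (y) (h : I.rel y x) : s y h ≫ A.toObj y = V.toObj y := by
          rw [← f.app_obj, ← Category.assoc, (hs y h).2.1, b.app_obj]
        have hbase (y) (h : I.rel y x) : s y h ≫ A.toBase y = V.toBase y := by
          rw [← f.app_base, ← Category.assoc, (hs y h).2.1, b.app_base]
        -- Acting on `V_x` and then applying the partial lift gives an element of the matching
        -- object of `A`. Compatibility of `s` with the actions below `x` is what makes it a family
        -- of operations.
        let φ : HomEl (I.homFrom x) (A.restrict {y | I.rel y x}) (b.app x ≫ B.toObj x)
            (b.app x ≫ B.toBase x) :=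
          { el := fun y T w c h => V.actEl y.2 w c
              (by rw [b.app_obj] at h; exact h) ≫ s y.1 y.2
            comp_el := fun y T T' t w c h => (Category.assoc _ _ _).symm.trans
              (congrArg (· ≫ s y.1 y.2) (V.comp_actEl ..))
            el_toBase := fun y T w c h => by
              refine (Category.assoc _ _ _).trans ?_
              refine (congrArg (_ ≫ ·) (hbase y.1 y.2)).trans ?_
              rw [b.app_base]
              exact V.actEl_toBase ..
            el_toObj := fun y T w c h => by
              refine (Category.assoc _ _ _).trans ?_
              exact (congrArg (_ ≫ ·) (hobj y.1 y.2)).trans (V.actEl_toObj ..)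
            actEl_el := fun {y z} k T w c h d hcd => by
              rw [b.app_obj] at h
              refine ((hs y.1 y.2).2.2 z.1 k (V.actEl y.2 w c h) d
                ((V.actEl_toObj ..).trans hcd) _).trans ?_
              exact congrArg (· ≫ s z.1 z.2) (V.actEl_actEl y.2 k w c d h hcd) }
        obtain ⟨l, h₁, h₂, h₃⟩ := hf x (i.app x) (hi x) (a.app x) (b.app x) (hsq x) φ
          (HomEl.ext' fun y T w c h => by
            have h' : w ≫ U.toObj x = c ≫ I.src y.2 := by
              rw [b.app_obj, i.app_obj] at h; exact h
            have e₁ := i.actEl_app y.2 w c h'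
            refine Eq.trans (congrArg (· ≫ s y.1 y.2) e₁.symm) ?_
            rw [Category.assoc, (hs y.1 y.2).1]
            exact a.actEl_app ..)
          (HomEl.ext' fun y T w c h => by
            have h' : w ≫ V.toObj x = c ≫ I.src y.2 := by
              rw [b.app_obj] at h; exact h
            refine Eq.trans ?_ (b.actEl_app y.2 w c h')
            exact (Category.assoc _ _ _).trans (congrArg (_ ≫ ·) (hs y.1 y.2).2.1))
        refine ⟨l, h₁, h₂, fun y h T t c e e' => ?_⟩
        exact congrArg (fun ψ : HomEl (I.homFrom x) (A.restrict {y | I.rel y x}) _ _ =>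
          ψ.el (⟨y, h⟩ : {y // I.rel y x}) t c (by rw [b.app_obj]; exact e)) h₃)
    exact ⟨⟨{ l := Hom.ofElements s
                (fun x => by rw [← f.app_base, ← Category.assoc, (hs x).2.1, b.app_base])
                (fun x => by rw [← f.app_obj, ← Category.assoc, (hs x).2.1, b.app_obj])
                (fun h T t c e => ((hs _).2.2 _ h t c e _).symm)
              fac_left := hom_ext fun x => (hs x).1
              fac_right := hom_ext fun x => (hs x).2.1 }⟩⟩

/-- Restriction to a downward closed set of objects preserves `InjAt`. -/
lemma InjAt.restrict {Q : MorphismProperty C} {A B : Diagram I X} {f : A ⟶ B} {S : Set I.Ob}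
    (hS : ∀ {x y}, I.rel y x → x ∈ S → y ∈ S) (x : (I.full S).Ob) (hf : InjAt Q f x.1) :
    InjAt Q (restrictMap f S) x := by
  intro Z W i hi a b hab φ h₁ h₂
  -- As `S` is downward closed, the objects below `x` in the full subcategory and in `I` are the
  -- same, and the lifting problem can be read in `I`.
  let ψ : HomEl (I.homFrom x.1) (A.restrict {y | I.rel y x.1}) (b ≫ B.toObj x.1)
      (b ≫ B.toBase x.1) :=
    { el := fun y T w c h => φ.el ⟨⟨y.1, hS y.2 x.2⟩, y.2⟩ w c h
      comp_el := fun y T T' t w c h => φ.comp_el ..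
      el_toBase := fun y T w c h => φ.el_toBase ⟨⟨y.1, hS y.2 x.2⟩, y.2⟩ w c h
      el_toObj := fun y T w c h => φ.el_toObj ⟨⟨y.1, hS y.2 x.2⟩, y.2⟩ w c h
      actEl_el := fun {y z} k T w c h d hcd =>
        φ.actEl_el (y := ⟨⟨y.1, hS y.2 x.2⟩, y.2⟩) (z := ⟨⟨z.1, hS z.2 x.2⟩, z.2⟩) k w c h d hcd }
  obtain ⟨l, e₁, e₂, e₃⟩ := hf i hi a b hab ψ
    (HomEl.ext' fun y T w c h =>
      congrArg (fun χ : HomEl ((I.full S).homFrom x) ((A.restrict S).restrict _) _ _ =>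
        χ.el (⟨⟨y.1, hS y.2 x.2⟩, y.2⟩ : {y : S // I.rel y.1 x.1}) w c h) h₁)
    (HomEl.ext' fun y T w c h =>
      congrArg (fun χ : HomEl ((I.full S).homFrom x) ((B.restrict S).restrict _) _ _ =>
        χ.el (⟨⟨y.1, hS y.2 x.2⟩, y.2⟩ : {y : S // I.rel y.1 x.1}) w c h) h₂)
  exact ⟨l, e₁, e₂, HomEl.ext' fun y T w c h =>
    congrArg (fun χ : HomEl (I.homFrom x.1) (A.restrict {y | I.rel y x.1}) _ _ =>
      χ.el (⟨y.1.1, y.2⟩ : {y // I.rel y x.1}) w c h) e₃⟩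

/-- Composition of the base maps of a diagram with `q : X ⟶ Y`. -/
abbrev pushBase (A : Diagram I X) (q : X ⟶ Y) : Diagram I Y where
  obj := A.obj
  toBase x := A.toBase x ≫ q
  toObj := A.toObj
  act := A.act
  act_base h := by rw [← Category.assoc, A.act_base, Category.assoc]
  act_obj := A.act_obj
  assoc := A.assoc

/-- Operations on generalized elements correspond to maps from `q_! p^* P`. -/
def HomEl.toPushHom {P : Diagram I X} {B : Diagram I Y} {W : C} {p : W ⟶ X} {q : W ⟶ Y}
    (φ : HomEl P B p q) : (P.reindex p).pushBase q ⟶ B where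
  app y := φ.el y ((P.reindex p).toBase y) (P.proj p y) (P.proj_toBase p y).symm
  app_base y := φ.el_toBase ..
  app_obj y := φ.el_toObj ..
  act_app {y z} h := by
    have e : (φ.toHom.app y ≫ B.proj q y) = _ := φ.toHom_proj y
    have e' : (φ.toHom.app z ≫ B.proj q z) = _ := φ.toHom_proj z
    have := φ.toHom.actEl_app h _ _ pullback.condition
    have h₂ := congrArg (· ≫ B.proj q z) this
    simp only [Category.assoc, reindex_actEl_proj] at h₂
    rw [e'] at h₂
    have h₃ : (P.reindex p).actEl h _ _ pullback.condition = (P.reindex p).act h := by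
      rw [actEl]
      refine (congrArg (· ≫ _) ?_).trans (Category.id_comp _)
      apply pullback.hom_ext
      · exact (pullback.lift_fst _ _ _).trans (Category.id_comp _).symm
      · exact (pullback.lift_snd _ _ _).trans (Category.id_comp _).symm
    rw [h₃] at h₂
    refine h₂.trans ?_
    exact B.actEl_congr h (congrArg (_ ≫ ·) e) rfl _ _

/-- The inverse of `HomEl.toPushHom`. -/
def HomEl.ofPushHom {P : Diagram I X} {B : Diagram I Y} {W : C} {p : W ⟶ X} {q : W ⟶ Y}
    (g : (P.reindex p).pushBase q ⟶ B) : HomEl P B p q where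
  el y T w b h := P.reindexLift p y b w h.symm ≫ g.app y
  comp_el y T T' t w b h := by
    rw [← Category.assoc]
    congr 1
    apply reindex_hom_ext <;> simp
  el_toBase y T w b h := by
    rw [Category.assoc, g.app_base]
    exact P.reindexLift_toBase_assoc ..
  el_toObj y T w b h := by
    rw [Category.assoc, g.app_obj]
    exact P.reindexLift_proj_assoc ..
  actEl_el {y z} k T w b h c hbc := by
    have e : P.reindexLift p y b w h.symm ≫ (P.reindex p).toObj y = c ≫ I.src k := by
      rw [reindex_toObj, reindexLift_proj_assoc, hbc]
    refine (g.actEl_app k (P.reindexLift p y b w h.symm) c e).symm.trans ?_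
    congr 1
    apply reindex_hom_ext
    · refine (reindex_actEl_proj ..).trans ?_
      exact (P.actEl_congr k (reindexLift_proj ..) rfl _ hbc).trans (reindexLift_proj ..).symm
    · refine ((P.reindex p).actEl_toBase ..).trans ?_
      rw [reindexLift_toBase, reindexLift_toBase]

/-- The map `q_! p^* P ⟶ q'_! p'^* P` induced by a map over `X` and `Y`. -/
def pushAlong (P : Diagram I X) {Z W : C} (i : Z ⟶ W) {p : W ⟶ X} {p' : Z ⟶ X} {q : W ⟶ Y}
    {q' : Z ⟶ Y} (hp : i ≫ p = p') (hq : i ≫ q = q') :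
    (P.reindex p').pushBase q' ⟶ (P.reindex p).pushBase q :=
  Hom.ofElements (fun y => P.along i hp y)
    (fun y => by
      refine (Category.assoc _ _ _).symm.trans ?_
      rw [along_toBase, Category.assoc, hq])
    (fun y => P.along_toObj ..)
    (fun h T a b hab => P.actEl_along ..)

/-- Extension of a family of operations along `i : Z ⟶ W`. -/
theorem HomEl.exists_extension {Q : MorphismProperty C} {P : Diagram I X} {A B : Diagram I Y}
    {f : A ⟶ B} (hf : ∀ x, InjAt Q f x) {Z W : C} (i : Z ⟶ W) {p : W ⟶ X} {q : W ⟶ Y}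
    {p' : Z ⟶ X} {q' : Z ⟶ Y} (hp : i ≫ p = p') (hq : i ≫ q = q')
    (hi : ∀ y, Q (P.along i hp y)) (α : HomEl P A p' q') (β : HomEl P B p q)
    (h : α.map f = β.pre i hp hq) : ∃ γ : HomEl P A p q, γ.pre i hp hq = α ∧ γ.map f = β := by
  -- Operations from `P` over `p` to `A` over `q` are maps `q_! p^* P ⟶ A` of `Y`-indexed diagrams.
  -- Extending them along `i` is thus a lifting problem for the map `pushAlong`, whose components
  -- are the maps `along`.
  have := hasLiftingProperty_of_injAt Q (P.pushAlong i hp hq) f (fun y => hi y) hf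
  have sq : CommSq α.toPushHom (P.pushAlong i hp hq) f β.toPushHom := ⟨hom_ext fun y => by
    refine (congrArg (fun χ => HomEl.el χ y ((P.reindex p').toBase y) (P.proj p' y)
      (P.proj_toBase p' y).symm) h).trans ?_
    refine Eq.trans ?_ (β.comp_el ..).symm
    exact β.el_congr (P.along_toBase i hp y).symm (P.along_proj i hp y).symm _ _⟩
  refine ⟨HomEl.ofPushHom sq.lift, HomEl.ext' fun y T w b e => ?_, HomEl.ext' fun y T w b e => ?_⟩
  · have h₁ : P.along i hp y ≫ sq.lift.app y = _ := congrArg (fun g => Hom.app g y) sq.fac_left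
    have h₂ : P.reindexLift p y b (w ≫ i) (by rw [Category.assoc, hp, e]) =
        P.reindexLift p' y b w e.symm ≫ P.along i hp y := by
      apply reindex_hom_ext
      · simp
      · refine (reindexLift_toBase ..).trans ?_
        rw [Category.assoc, along_toBase, reindexLift_toBase_assoc]
    refine (congrArg (· ≫ _) h₂).trans ?_
    rw [Category.assoc, h₁]
    refine (α.comp_el ..).trans ?_
    exact α.el_congr (reindexLift_toBase ..) (reindexLift_proj ..) _ _
  · have h₁ : sq.lift.app y ≫ f.app y = _ := congrArg (fun g => Hom.app g y) sq.fac_right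
    refine (Category.assoc _ _ _).trans ?_
    rw [h₁]
    refine (β.comp_el ..).trans ?_
    exact β.el_congr (reindexLift_toBase ..) (reindexLift_proj ..) _ _

end Diagram

end InternalInverseCategory

/-! ### Existence of hom-objects. -/

namespace InternalInverseCategory

namespace Diagram

attribute [local simp] pullback.lift_fst pullback.lift_fst_assoc pullback.lift_snd
  pullback.lift_snd_assoc prod.lift_fst prod.lift_fst_assoc prod.lift_snd prod.lift_snd_assoc

variable {C : Type u} [Category.{v} C]

/-- Maps over `K` and `Y` from the pullback along `s : E ⟶ X` of `p : W ⟶ X` to `B`, as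
operations on generalized elements. -/
structure SpanEl {X Y K E B : C} (s : E ⟶ X) (t : E ⟶ K) (k : B ⟶ K) (l : B ⟶ Y) {W : C}
    (p : W ⟶ X) (q : W ⟶ Y) where
  el : ∀ {T : C} (w : T ⟶ W) (b : T ⟶ E) (_ : w ≫ p = b ≫ s), T ⟶ B
  comp_el : ∀ {T T' : C} (t : T' ⟶ T) (w : T ⟶ W) (b : T ⟶ E) (h : w ≫ p = b ≫ s),
    t ≫ el w b h = el (t ≫ w) (t ≫ b) (by simp [h])
  el_obj : ∀ {T : C} (w : T ⟶ W) (b : T ⟶ E) (h : w ≫ p = b ≫ s), el w b h ≫ k = b ≫ t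
  el_base : ∀ {T : C} (w : T ⟶ W) (b : T ⟶ E) (h : w ≫ p = b ≫ s), el w b h ≫ l = w ≫ q

lemma SpanEl.el_congr {X Y K E B : C} {s : E ⟶ X} {t : E ⟶ K} {k : B ⟶ K} {l : B ⟶ Y} {W : C}
    {p : W ⟶ X} {q : W ⟶ Y} (φ : SpanEl s t k l p q) {T : C} {w w' : T ⟶ W} {b b' : T ⟶ E}
    (hw : w = w') (hb : b = b') (h : w ≫ p = b ≫ s) (h' : w' ≫ p = b' ≫ s) :
    φ.el w b h = φ.el w' b' h' := by
  subst hw hb; rfl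

variable [HasBinaryProducts C]

/-- Restriction of operations along a map over `X ⨯ Y`. -/
def SpanEl.preOver {X Y K E B : C} {s : E ⟶ X} {t : E ⟶ K} {k : B ⟶ K} {l : B ⟶ Y}
    {M Z : Over (X ⨯ Y)} (μ : SpanEl s t k l (M.hom ≫ prod.fst) (M.hom ≫ prod.snd)) (m : Z ⟶ M) :
    SpanEl s t k l (Z.hom ≫ prod.fst) (Z.hom ≫ prod.snd) where
  el w b h := μ.el (w ≫ m.left) b (by rw [Category.assoc, Over.w_assoc, h])
  comp_el t w b h := (μ.comp_el ..).trans (μ.el_congr (Category.assoc _ _ _).symm rfl _ _)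
  el_obj w b h := μ.el_obj ..
  el_base w b h := (μ.el_base ..).trans (by rw [Category.assoc, Over.w_assoc])

lemma SpanEl.preOver_comp_el {X Y K E B : C} {s : E ⟶ X} {t : E ⟶ K} {k : B ⟶ K} {l : B ⟶ Y}
    {M Z Z' : Over (X ⨯ Y)} (μ : SpanEl s t k l (M.hom ≫ prod.fst) (M.hom ≫ prod.snd))
    (m : Z ⟶ M) (r : Z' ⟶ Z) {T : C} (w : T ⟶ Z'.left) (b : T ⟶ E)
    (h : w ≫ Z'.hom ≫ prod.fst = b ≫ s) :
    (μ.preOver (r ≫ m)).el w b h =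
      (μ.preOver m).el (w ≫ r.left) b (by rw [Category.assoc, Over.w_assoc, h]) :=
  μ.el_congr (by simp) rfl _ _

variable [HasPullbacks C]

/-- The functors of operations along a span with powerful first leg are representable. -/
theorem SpanEl.exists_universal {X Y K E B : C} (s : E ⟶ X) (t : E ⟶ K) (k : B ⟶ K) (l : B ⟶ Y)
    (hs : (Over.pullback (pullback.snd s (prod.fst : X ⨯ Y ⟶ X))).IsLeftAdjoint) :
    ∃ (M : Over (X ⨯ Y)) (μ : SpanEl s t k l (M.hom ≫ prod.fst) (M.hom ≫ prod.snd)),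
      ∀ (Z : Over (X ⨯ Y)) (φ : SpanEl s t k l (Z.hom ≫ prod.fst) (Z.hom ≫ prod.snd)),
        ∃! m : Z ⟶ M, ∀ {T : C} (w : T ⟶ Z.left) (b : T ⟶ E)
          (h : w ≫ Z.hom ≫ prod.fst = b ≫ s),
          φ.el w b h = μ.el (w ≫ m.left) b (by rw [Category.assoc, Over.w_assoc, h]) := by
  let g := pullback.snd s (prod.fst : X ⨯ Y ⟶ X)
  have : (Over.pullback g).IsLeftAdjoint := hs
  let adj := Adjunction.ofIsLeftAdjoint (Over.pullback g)
  let d : pullback s (prod.fst : X ⨯ Y ⟶ X) ⟶ K ⨯ Y :=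
    prod.lift (pullback.fst _ _ ≫ t) (g ≫ prod.snd)
  -- The domain of `g` is `E × Y`, and `D` is `B` pulled back to it from `K × Y`. A map from `Z` to
  -- the right adjoint applied to `D` transposes to a map `Z ×_X E ⟶ B` over `K` and `Y`.
  let D : Over (pullback s (prod.fst : X ⨯ Y ⟶ X)) := Over.mk (pullback.snd (prod.lift k l) d)
  let M := (Over.pullback g).rightAdjoint.obj D
  let pair (Z : Over (X ⨯ Y)) {T : C} (w : T ⟶ Z.left) (b : T ⟶ E)
      (h : w ≫ Z.hom ≫ prod.fst = b ≫ s) : T ⟶ ((Over.pullback g).obj Z).left :=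
    pullback.lift w (pullback.lift b (w ≫ Z.hom) (by rw [Category.assoc, h])) (by simp [g])
  have pair_fst (Z : Over (X ⨯ Y)) {T : C} (w : T ⟶ Z.left) (b : T ⟶ E)
      (h : w ≫ Z.hom ≫ prod.fst = b ≫ s) : pair Z w b h ≫ pullback.fst Z.hom g = w :=
    pullback.lift_fst _ _ _
  have pair_snd (Z : Over (X ⨯ Y)) {T : C} (w : T ⟶ Z.left) (b : T ⟶ E)
      (h : w ≫ Z.hom ≫ prod.fst = b ≫ s) : pair Z w b h ≫ pullback.snd Z.hom g =
        pullback.lift b (w ≫ Z.hom) (by rw [Category.assoc, h]) :=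
    pullback.lift_snd _ _ _
  let ofHom (Z : Over (X ⨯ Y)) (r : (Over.pullback g).obj Z ⟶ D) :
      SpanEl s t k l (Z.hom ≫ prod.fst) (Z.hom ≫ prod.snd) :=
    have key {T : C} (w : T ⟶ Z.left) (b : T ⟶ E) (h : w ≫ Z.hom ≫ prod.fst = b ≫ s) :
        (pair Z w b h ≫ r.left ≫ pullback.fst (prod.lift k l) d) ≫ prod.lift k l =
          pullback.lift b (w ≫ Z.hom) (by rw [Category.assoc, h]) ≫ d := by
      rw [Category.assoc, Category.assoc, pullback.condition, ← pair_snd Z w b h, Category.assoc]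
      exact congrArg (_ ≫ ·) ((Category.assoc _ _ _).symm.trans (congrArg (· ≫ d) (Over.w r)))
    { el := fun {T} w b h => pair Z w b h ≫ r.left ≫ pullback.fst _ _
      comp_el := fun {T T'} t w b h => by
        rw [← Category.assoc]
        congr 1
        apply pullback.hom_ext
        · simp [pair]
        · apply pullback.hom_ext <;> simp [pair]
      el_obj := fun {T} w b h => by
        have := congrArg (· ≫ prod.fst) (key w b h)
        simpa [d] using this
      el_base := fun {T} w b h => by
        have := congrArg (· ≫ prod.snd) (key w b h)
        simpa [d, g] using this }
  have comp_ofHom (Z Z' : Over (X ⨯ Y)) (m : Z ⟶ Z') (r : (Over.pullback g).obj Z' ⟶ D) {T : C}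
      (w : T ⟶ Z.left) (b : T ⟶ E) (h : w ≫ Z.hom ≫ prod.fst = b ≫ s) :
      (ofHom Z ((Over.pullback g).map m ≫ r)).el w b h =
        (ofHom Z' r).el (w ≫ m.left) b (by rw [Category.assoc, Over.w_assoc, h]) := by
    change pair Z w b h ≫ (((Over.pullback g).map m).left ≫ r.left) ≫ _ =
      pair Z' (w ≫ m.left) b (by rw [Category.assoc, Over.w_assoc, h]) ≫ r.left ≫ _
    rw [← Category.assoc, ← Category.assoc, ← Category.assoc]
    congr 2
    apply pullback.hom_ext
    · simp [pair]
    · apply pullback.hom_ext <;> simp [pair]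
  have ofHom_inj (Z : Over (X ⨯ Y)) (r r' : (Over.pullback g).obj Z ⟶ D)
      (H : ∀ {T : C} (w : T ⟶ Z.left) (b : T ⟶ E) (h : w ≫ Z.hom ≫ prod.fst = b ≫ s),
        (ofHom Z r).el w b h = (ofHom Z r').el w b h) : r = r' := by
    ext1
    apply pullback.hom_ext
    · have h : pullback.fst Z.hom g ≫ Z.hom ≫ prod.fst =
          (pullback.snd Z.hom g ≫ pullback.fst _ _) ≫ s := by
        rw [pullback.condition_assoc, Category.assoc, ← pullback.condition]
      -- The two projections form the generic pair of elements, so evaluating there recovers the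
      -- whole map.
      have e : pair Z _ _ h = 𝟙 _ := by
        apply pullback.hom_ext
        · simp [pair]
        · apply pullback.hom_ext
          · simp [pair]
          · simp [pair, g, pullback.condition]
      have := H _ _ h
      change pair Z _ _ h ≫ _ = pair Z _ _ h ≫ _ at this
      rwa [e, Category.id_comp, Category.id_comp] at this
    · exact (Over.w r).trans (Over.w r').symm
  refine ⟨M, ofHom M (adj.counit.app D), fun Z φ => ?_⟩
  have hcond : pullback.fst Z.hom g ≫ Z.hom ≫ prod.fst =
      (pullback.snd Z.hom g ≫ pullback.fst _ _) ≫ s := by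
    rw [pullback.condition_assoc, Category.assoc, ← pullback.condition]
  let r : (Over.pullback g).obj Z ⟶ D := Over.homMk
    (pullback.lift (φ.el (pullback.fst Z.hom g) (pullback.snd Z.hom g ≫ pullback.fst _ _) hcond)
      (pullback.snd Z.hom g) (by
        apply Limits.prod.hom_ext
        · simp [d, φ.el_obj]
        · simp [d, g, φ.el_base, pullback.condition_assoc]))
    (pullback.lift_snd _ _ _)
  have hr {T : C} (w : T ⟶ Z.left) (b : T ⟶ E) (h : w ≫ Z.hom ≫ prod.fst = b ≫ s) :
      φ.el w b h = (ofHom Z r).el w b h := by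
    change _ = pair Z w b h ≫ pullback.lift _ _ _ ≫ pullback.fst _ _
    rw [pullback.lift_fst, φ.comp_el]
    exact φ.el_congr (by simp [pair]) (by simp [pair]) _ _
  refine ⟨adj.homEquiv Z D r, fun {T} w b h => ?_, fun m hm => ?_⟩
  · rw [hr, ← comp_ofHom, ← adj.homEquiv_counit, Equiv.symm_apply_apply]
  · rw [← Equiv.symm_apply_eq, adj.homEquiv_counit]
    refine ofHom_inj Z _ _ fun {T} w b h => ?_
    rw [comp_ofHom, ← hr, hm]

variable {I : InternalInverseCategory.{w} C} {X Y : C}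

/-- The leg `P_y ×_{I(y)} I(y,z) ⟶ X`. -/
abbrev actSource (P : Diagram I X) {y z : I.Ob} (h : I.rel z y) :
    pullback (P.toObj y) (I.src h) ⟶ X :=
  pullback.fst _ _ ≫ P.toBase y

/-- The hom-object of two diagrams exists if the legs of the first one are powerful. -/
theorem HomEl.exists_universal [HasLimitsOfSize.{w, w} C] (P : Diagram I X) (B : Diagram I Y)
    (h₁ : ∀ y, (Over.pullback
      (pullback.snd (P.toBase y) (prod.fst : X ⨯ Y ⟶ X))).IsLeftAdjoint)
    (h₂ : ∀ {y z : I.Ob} (h : I.rel z y), (Over.pullback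
      (pullback.snd (P.actSource h) (prod.fst : X ⨯ Y ⟶ X))).IsLeftAdjoint) :
    ∃ (M : Over (X ⨯ Y)) (μ : HomEl P B (M.hom ≫ prod.fst) (M.hom ≫ prod.snd)),
      ∀ (Z : Over (X ⨯ Y)) (φ : HomEl P B (Z.hom ≫ prod.fst) (Z.hom ≫ prod.snd)),
        ∃! m : Z ⟶ M, φ = μ.pre m.left (Over.w_assoc ..) (Over.w_assoc ..) := by
  choose M μ hμ using fun y => SpanEl.exists_universal (P.toBase y) (P.toObj y) (B.toObj y)
    (B.toBase y) (h₁ y)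
  let L := Σ y z : I.Ob, PLift (I.rel z y)
  -- `M y` represents operations at the single object `y`, with no compatibility imposed. `N l`
  -- represents operations along `P_y ×_{I(y)} I(y,z)` with values in `B_z`, where the two sides of
  -- a compatibility condition live.
  choose N ν hν using fun l : L => SpanEl.exists_universal (P.actSource l.2.2.down)
    (pullback.snd _ _ ≫ I.tgt l.2.2.down) (B.toObj l.2.1) (B.toBase l.2.1) (h₂ l.2.2.down)
  let R : Over (X ⨯ Y) := ∏ᶜ M
  let π (y) : R ⟶ M y := Pi.π M y
  -- One side of the compatibility condition: apply the operation at `y`, then act in `B`.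
  let σ (l : L) : SpanEl (P.actSource l.2.2.down) (pullback.snd _ _ ≫ I.tgt l.2.2.down)
      (B.toObj l.2.1) (B.toBase l.2.1) (R.hom ≫ prod.fst) (R.hom ≫ prod.snd) :=
    { el := fun {T} w b h => B.actEl l.2.2.down
          (((μ l.1).preOver (π l.1)).el w (b ≫ pullback.fst _ _)
          (by rw [h, Category.assoc]))
        (b ≫ pullback.snd _ _) (by
          refine (SpanEl.el_obj _ _ _ (by rw [h, Category.assoc])).trans ?_
          rw [Category.assoc, Category.assoc, pullback.condition])
      comp_el := fun {T T'} t w b h => by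
        have h₁ : w ≫ R.hom ≫ prod.fst =
            (b ≫ pullback.fst _ (I.src l.2.2.down)) ≫ P.toBase l.1 := by rw [h, Category.assoc]
        refine (B.comp_actEl ..).trans (B.actEl_congr _
          ((((μ l.1).preOver (π l.1)).comp_el t w _ h₁).trans
            (SpanEl.el_congr _ rfl (Category.assoc _ _ _).symm ?_ ?_))
          (Category.assoc _ _ _).symm _ _)
        · rw [Category.assoc, h₁, Category.assoc t]
        · simp only [Category.assoc, h]
      el_obj := fun {T} w b h => (B.actEl_toObj ..).trans (Category.assoc _ _ _)
      el_base := fun {T} w b h => (B.actEl_toBase ..).trans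
        (SpanEl.el_base _ _ _ (by rw [h, Category.assoc])) }
  -- The other side: act in `P`, then apply the operation at `z`. The hom-object is the equalizer of
  -- the maps classifying `σ` and `τ`.
  let τ (l : L) : SpanEl (P.actSource l.2.2.down) (pullback.snd _ _ ≫ I.tgt l.2.2.down)
      (B.toObj l.2.1) (B.toBase l.2.1) (R.hom ≫ prod.fst) (R.hom ≫ prod.snd) :=
    { el := fun {T} w b h => ((μ l.2.1).preOver (π l.2.1)).el w (b ≫ P.act l.2.2.down)
        (by rw [Category.assoc, P.act_base, h])
      comp_el := fun {T T'} t w b h => (SpanEl.comp_el ..).trans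
        (SpanEl.el_congr _ rfl (Category.assoc _ _ _).symm _ _)
      el_obj := fun {T} w b h => (SpanEl.el_obj ..).trans (by rw [Category.assoc, P.act_obj])
      el_base := fun {T} w b h => SpanEl.el_base .. }
  choose s hs hs' using fun l => hν l R (σ l)
  choose t ht ht' using fun l => hν l R (τ l)
  let ι := equalizer.ι (Pi.lift s) (Pi.lift t)
  have hι (l : L) : ι ≫ s l = ι ≫ t l := by
    have := congrArg (· ≫ Pi.π N l) (equalizer.condition (Pi.lift s) (Pi.lift t))
    simpa using this
  -- Equality of the classifying maps, translated into the compatibility equation. One direction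
  -- produces the universal family on the equalizer, the other the factorization of a given family
  -- through it.
  have key {Z : Over (X ⨯ Y)} (r : Z ⟶ R) (y z : I.Ob) (k : I.rel z y) :
      r ≫ s ⟨y, z, ⟨k⟩⟩ = r ≫ t ⟨y, z, ⟨k⟩⟩ ↔
      ∀ {T : C} (w : T ⟶ Z.left) (b : T ⟶ P.obj y) (c : T ⟶ I.hom k)
        (h : w ≫ Z.hom ≫ prod.fst = b ≫ P.toBase y) (hbc : b ≫ P.toObj y = c ≫ I.src k),
        B.actEl k (((μ y).preOver (π y)).el (w ≫ r.left) b
          (by rw [Category.assoc, Over.w_assoc, h])) c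
          ((SpanEl.el_obj _ _ _ (by rw [Category.assoc, Over.w_assoc, h])).trans hbc) =
        ((μ z).preOver (π z)).el (w ≫ r.left) (P.actEl k b c hbc)
          (by rw [Category.assoc, Over.w_assoc, h, actEl_toBase]) := by
    constructor
    · intro H T w b c h hbc
      have hw : (w ≫ r.left) ≫ R.hom ≫ prod.fst = pullback.lift b c hbc ≫ P.actSource k := by
        rw [Category.assoc, Over.w_assoc, h]; simp
      have h₁ := hs ⟨y, z, ⟨k⟩⟩ (w ≫ r.left) (pullback.lift b c hbc) hw
      have h₂ := ht ⟨y, z, ⟨k⟩⟩ (w ≫ r.left) (pullback.lift b c hbc) hw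
      have h₃ : (w ≫ r.left) ≫ (s ⟨y, z, ⟨k⟩⟩).left = (w ≫ r.left) ≫ (t ⟨y, z, ⟨k⟩⟩).left := by
        have := congrArg (fun m => w ≫ CommaMorphism.left m) H
        simpa using this
      have h₄ := h₁.trans (((ν ⟨y, z, ⟨k⟩⟩).el_congr h₃ rfl _ _).trans h₂.symm)
      refine Eq.trans ?_ h₄
      exact B.actEl_congr _ (SpanEl.el_congr _ rfl (pullback.lift_fst _ _ _).symm _ _)
        (pullback.lift_snd _ _ _).symm _ _
    · intro H
      let φ : SpanEl (P.actSource k) (pullback.snd _ _ ≫ I.tgt k)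
          (B.toObj z) (B.toBase z) (Z.hom ≫ prod.fst) (Z.hom ≫ prod.snd) :=
        { el := fun {T} w b h => ((μ z).preOver (π z)).el (w ≫ r.left) (b ≫ P.act k)
            (by rw [Category.assoc, Over.w_assoc, Category.assoc, P.act_base, h])
          comp_el := fun {T T'} t w b h => (SpanEl.comp_el ..).trans
            (SpanEl.el_congr _ (Category.assoc _ _ _).symm (Category.assoc _ _ _).symm _ _)
          el_obj := fun {T} w b h => (SpanEl.el_obj ..).trans (by rw [Category.assoc, P.act_obj])
          el_base := fun {T} w b h => (SpanEl.el_base ..).trans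
            (by rw [Category.assoc, Over.w_assoc]) }
      refine (hν ⟨y, z, ⟨k⟩⟩ Z φ).unique (fun {T} w b h => ?_) (fun {T} w b h => ?_)
      · have hw : (w ≫ r.left) ≫ R.hom ≫ prod.fst = b ≫ P.actSource k := by
          rw [Category.assoc, Over.w_assoc, h]
        refine Eq.trans ?_ ((hs ⟨y, z, ⟨k⟩⟩ (w ≫ r.left) b hw).trans ?_)
        · have hb : (b ≫ pullback.fst _ _) ≫ P.toObj y = (b ≫ pullback.snd _ _) ≫ I.src k := by
            rw [Category.assoc, pullback.condition, Category.assoc]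
          refine Eq.trans ?_ (H w (b ≫ pullback.fst _ _) (b ≫ pullback.snd _ _)
            (by rw [h, Category.assoc]) hb).symm
          refine ((μ z).preOver (π z)).el_congr rfl ?_
            (by rw [Category.assoc, Over.w_assoc, h, Category.assoc, P.act_base]) _
          rw [actEl]
          congr 1
          apply pullback.hom_ext <;> simp
        · exact (ν _).el_congr (by simp) rfl _ _
      · have hw : (w ≫ r.left) ≫ R.hom ≫ prod.fst = b ≫ P.actSource k := by
          rw [Category.assoc, Over.w_assoc, h]
        refine Eq.trans ?_ ((ht ⟨y, z, ⟨k⟩⟩ (w ≫ r.left) b hw).trans ?_)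
        · rfl
        · exact (ν _).el_congr (by simp) rfl _ _
  let M' : Over (X ⨯ Y) := equalizer (Pi.lift s) (Pi.lift t)
  let μ' : HomEl P B (M'.hom ≫ prod.fst) (M'.hom ≫ prod.snd) :=
    { el := fun y {T} w b h => ((μ y).preOver (ι ≫ π y)).el w b h
      comp_el := fun y {T T'} t w b h => SpanEl.comp_el ..
      el_toBase := fun y {T} w b h => SpanEl.el_base ..
      el_toObj := fun y {T} w b h => SpanEl.el_obj ..
      actEl_el := fun {y z} k {T} w b h c hbc =>
        (B.actEl_congr k (SpanEl.preOver_comp_el ..) rfl _ _).trans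
          (((key ι y z k).1 (hι _) w b c h hbc).trans (SpanEl.preOver_comp_el ..).symm) }
  refine ⟨M', μ', fun Z φ => ?_⟩
  choose r hr hr' using fun y => hμ y Z
    { el := fun {T} w b h => φ.el y w b h
      comp_el := fun {T T'} t w b h => φ.comp_el ..
      el_obj := fun {T} w b h => φ.el_toObj ..
      el_base := fun {T} w b h => φ.el_toBase .. }
  have hπ (y) : Pi.lift r ≫ π y = r y := by simp [π]
  have hπ' (y) {T : C} (w : T ⟶ Z.left) : (w ≫ (Pi.lift r).left) ≫ (π y).left =
      w ≫ (r y).left := by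
    rw [Category.assoc, ← Over.comp_left, hπ]
  have hcond (l : L) : Pi.lift r ≫ s l = Pi.lift r ≫ t l := by
    obtain ⟨y, z, ⟨k⟩⟩ := l
    refine (key (Pi.lift r) y z k).2 fun {T} w b c h hbc => ?_
    have E (y : I.Ob) (b : T ⟶ P.obj y) (h : w ≫ Z.hom ≫ prod.fst = b ≫ P.toBase y) :
        ((μ y).preOver (π y)).el (w ≫ (Pi.lift r).left) b
          (by rw [Category.assoc, Over.w_assoc, h]) =
          φ.el y w b h :=
      ((μ y).el_congr (hπ' y w) rfl _ _).trans (hr y w b h).symm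
    refine (B.actEl_congr k (E y b h) rfl _ (by rw [φ.el_toObj, hbc])).trans ?_
    exact (φ.actEl_el k w b h c hbc).trans (E z _ _).symm
  refine ⟨equalizer.lift (Pi.lift r) ?_, ?_, fun m hm => ?_⟩
  · refine Pi.hom_ext _ _ fun l => ?_
    simpa using hcond l
  · refine HomEl.ext' fun y T w b h => (hr y w b h).trans ?_
    refine (μ y).el_congr ?_ rfl _ _
    rw [Category.assoc, ← Over.comp_left, ← Category.assoc, equalizer.lift_ι, hπ]
  · apply equalizer.hom_ext
    rw [equalizer.lift_ι]
    refine Pi.hom_ext _ _ fun y => (Eq.trans ?_ (hπ y).symm)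
    refine hr' y _ fun {T} w b h => ?_
    refine (congrArg (fun ψ => HomEl.el ψ y w b h) hm).trans ?_
    exact (μ y).el_congr (by simp [ι, π]) rfl _ _

end Diagram

end InternalInverseCategory

/-! ### Universal operations, and `InjAt` in terms of relative matching maps. -/

namespace InternalInverseCategory

namespace Diagram

attribute [local simp] pullback.lift_fst pullback.lift_fst_assoc pullback.lift_snd
  pullback.lift_snd_assoc prod.lift_fst prod.lift_fst_assoc prod.lift_snd prod.lift_snd_assoc

variable {C : Type u} [Category.{v} C] [HasPullbacks C] {I : InternalInverseCategory.{w} C}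
  {X Y : C}

namespace HomEl

variable {P : Diagram I X} {A B : Diagram I Y}

lemma pre_congr {W W' : C} {p : W ⟶ X} {q : W ⟶ Y} (φ : HomEl P B p q) {k k' : W' ⟶ W}
    (h : k = k') {p' : W' ⟶ X} {q' : W' ⟶ Y} (hp : k ≫ p = p') (hq : k ≫ q = q') :
    φ.pre k hp hq = φ.pre k' (by rw [← h, hp]) (by rw [← h, hq]) := by
  subst h; rfl

lemma pre_pre {W W' W'' : C} {p : W ⟶ X} {q : W ⟶ Y} (φ : HomEl P B p q) (k : W' ⟶ W)
    {p' : W' ⟶ X} {q' : W' ⟶ Y} (hp : k ≫ p = p') (hq : k ≫ q = q') (k' : W'' ⟶ W')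
    {p'' : W'' ⟶ X} {q'' : W'' ⟶ Y} (hp' : k' ≫ p' = p'') (hq' : k' ≫ q' = q'') :
    (φ.pre k hp hq).pre k' hp' hq' = φ.pre (k' ≫ k) (by rw [Category.assoc, hp, hp'])
      (by rw [Category.assoc, hq, hq']) :=
  ext' fun _ _ _ _ _ => φ.el_congr (Category.assoc _ _ _) rfl _ _

lemma map_pre {W W' : C} {p : W ⟶ X} {q : W ⟶ Y} (φ : HomEl P A p q) (f : A ⟶ B) (k : W' ⟶ W)
    {p' : W' ⟶ X} {q' : W' ⟶ Y} (hp : k ≫ p = p') (hq : k ≫ q = q') :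
    (φ.map f).pre k hp hq = (φ.pre k hp hq).map f := rfl

variable [HasBinaryProducts C] {M : Over (X ⨯ Y)}

/-- `μ` exhibits `M` as the hom-object of `P` and `B`. -/
def IsUniversal (μ : HomEl P B (M.hom ≫ prod.fst) (M.hom ≫ prod.snd)) : Prop :=
  ∀ (Z : Over (X ⨯ Y)) (φ : HomEl P B (Z.hom ≫ prod.fst) (Z.hom ≫ prod.snd)),
    ∃! m : Z ⟶ M, φ = μ.pre m.left (Over.w_assoc ..) (Over.w_assoc ..)

namespace IsUniversal

variable {μ : HomEl P B (M.hom ≫ prod.fst) (M.hom ≫ prod.snd)} (hμ : μ.IsUniversal)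
include hμ

/-- The pair of legs makes `W` an object over `X × Y`, to which universality applies. Allowing
arbitrary legs avoids rewriting them as composites with the product projections. -/
lemma exists_eq {W : C} {p : W ⟶ X} {q : W ⟶ Y} (φ : HomEl P B p q) :
    ∃ (m : W ⟶ M.left) (hp : m ≫ M.hom ≫ prod.fst = p) (hq : m ≫ M.hom ≫ prod.snd = q),
      μ.pre m hp hq = φ := by
  obtain ⟨m, hm, -⟩ := hμ (Over.mk (prod.lift p q)) (φ.pre (𝟙 _) (by simp) (by simp))
  refine ⟨m.left, by rw [Over.w_assoc]; simp, by rw [Over.w_assoc]; simp, ?_⟩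
  refine ext' fun y T w b h => ?_
  have := congrArg (fun ψ => el ψ y w b (by simpa using h)) hm
  refine Eq.trans ?_ (this.symm.trans ?_)
  · rfl
  · exact φ.el_congr (Category.comp_id _) rfl _ _

lemma hom_ext {W : C} {m m' : W ⟶ M.left} (h : m ≫ M.hom = m' ≫ M.hom)
    (H : μ.pre m rfl rfl = μ.pre m' (by rw [← Category.assoc, ← h, Category.assoc])
      (by rw [← Category.assoc, ← h, Category.assoc])) : m = m' := by
  have e := (hμ (Over.mk (m ≫ M.hom)) (μ.pre m (Category.assoc _ _ _).symm
    (Category.assoc _ _ _).symm)).unique (y₁ := Over.homMk m) (y₂ := Over.homMk m' h.symm)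
    rfl (ext' fun y T w b h' => by
      have h'' : w ≫ m ≫ M.hom ≫ prod.fst = b ≫ P.toBase y := by simpa using h'
      exact congrArg (fun ψ : HomEl P B (m ≫ M.hom ≫ prod.fst) (m ≫ M.hom ≫ prod.snd) =>
        ψ.el y w b h'') H)
  exact congrArg CommaMorphism.left e

end IsUniversal

variable (r : (P.homFunctor B).RepresentableBy M)

/-- The universal family of operations of a hom-object. -/
def universal : HomEl P B (M.hom ≫ prod.fst) (M.hom ≫ prod.snd) :=
  ofHom (r.homEquiv (𝟙 M))

lemma universal_pre {Z : Over (X ⨯ Y)} (m : Z ⟶ M) :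
    (universal r).pre m.left (Over.w_assoc ..) (Over.w_assoc ..) = ofHom (r.homEquiv m) := by
  rw [r.homEquiv_eq m]
  exact (equiv_symm_pullHom _ _ _ _).symm

lemma isUniversal_universal : (universal r).IsUniversal := fun Z φ => by
  refine ⟨r.homEquiv.symm φ.toHom, ?_, fun m hm => ?_⟩
  · refine Eq.trans ?_ (universal_pre r _).symm
    refine Eq.trans ?_ (congrArg ofHom (Equiv.apply_symm_apply r.homEquiv _)).symm
    exact (equiv.left_inv φ).symm
  · replace hm := hm.trans (universal_pre r m)
    subst hm
    exact (r.homEquiv.eq_symm_apply).2 (equiv.right_inv _).symm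

lemma IsUniversal.isRepresentable {μ : HomEl P B (M.hom ≫ prod.fst) (M.hom ≫ prod.snd)}
    (hμ : μ.IsUniversal) : (P.homFunctor B).IsRepresentable := by
  refine Functor.RepresentableBy.isRepresentable (Y := M)
    { homEquiv := fun {Z} => Equiv.ofBijective (fun m =>
        (μ.pre m.left (Over.w_assoc ..) (Over.w_assoc ..)).toHom) ⟨fun m m' h => ?_, fun g => ?_⟩
      homEquiv_comp := fun {Z Z'} k m => ?_ }
  · have h' : μ.pre m.left (Over.w_assoc ..) (Over.w_assoc ..) =
      μ.pre m'.left (Over.w_assoc ..) (Over.w_assoc ..) := equiv.injective h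
    exact (hμ Z _).unique rfl h'
  · obtain ⟨m, hm, -⟩ := hμ Z (ofHom g)
    exact ⟨m, (congrArg toHom hm.symm).trans (equiv.right_inv g)⟩
  · refine equiv.symm.injective ?_
    refine (equiv.left_inv _).trans ?_
    refine Eq.trans ?_ (equiv_symm_pullHom (toHom (μ.pre m.left (Over.w_assoc ..)
      (Over.w_assoc ..))) k.left (p' := Z.hom ≫ prod.fst) (q' := Z.hom ≫ prod.snd)
      (Over.w_assoc ..) (Over.w_assoc ..)).symm
    refine Eq.trans ?_ (congrArg (fun ψ => pre ψ k.left (Over.w_assoc ..) (Over.w_assoc ..))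
      (equiv.left_inv _).symm)
    exact (μ.pre_congr (Over.comp_left ..) _ _).trans (pre_pre ..).symm

end HomEl

section

variable [HasBinaryProducts C] (A B : Diagram I X) (f : A ⟶ B) (x : I.Ob) {M N : Over (I.obj x ⨯ X)}
  (r : (A.matchingFunctor x).RepresentableBy M) (t : (B.matchingFunctor x).RepresentableBy N)

/-- The map `A_x ⟶ M_x A` in `C`. -/
def toMatching : A.obj x ⟶ M.left := (A.matchingMap x r).left

lemma toMatching_hom : A.toMatching x r ≫ M.hom = prod.lift (A.toObj x) (A.toBase x) :=
  Over.w (A.matchingMap x r)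

lemma toMatching_fst : A.toMatching x r ≫ M.hom ≫ prod.fst = A.toObj x := by
  rw [← Category.assoc, toMatching_hom, prod.lift_fst]

lemma toMatching_snd : A.toMatching x r ≫ M.hom ≫ prod.snd = A.toBase x := by
  rw [← Category.assoc, toMatching_hom, prod.lift_snd]

/-- The map `A_x ⟶ M_x A` classifies `actElement`, and as a family of operations this element is the
action on the generic element of `A_x`. -/
lemma universal_pre_toMatching :
    (HomEl.universal r).pre (A.toMatching x r) (A.toMatching_fst x r) (A.toMatching_snd x r) =
    A.ofAct x (𝟙 _) (Category.id_comp _) (Category.id_comp _) := by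
  have h := (HomEl.universal_pre r (A.matchingMap x r)).trans
    (congrArg HomEl.ofHom (Equiv.apply_symm_apply r.homEquiv (A.actElement x)))
  refine HomEl.ext' fun y T w b e => ?_
  have e' : w ≫ (A.overObj x).hom ≫ prod.fst = b ≫ (I.homFrom x).toBase y := by
    rw [← e]; simp [overObj]
  refine (congrArg (fun ψ => HomEl.el ψ y w b e') h).trans ?_
  refine (congrArg (_ ≫ ·) (A.actHom_proj x _ _ y)).trans ?_
  refine (A.comp_actEl ..).trans ?_
  refine A.actEl_congr _ ?_ ?_ _ _
  · exact (reindexLift_toBase ..).trans (Category.comp_id _).symm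
  · exact reindexLift_proj ..

variable {A B}

lemma universal_pre_matchingObjMap :
    (HomEl.universal t).pre (matchingObjMap f x r t).left (Over.w_assoc ..) (Over.w_assoc ..) =
      (HomEl.universal r).map (restrictMap f _) :=
  (HomEl.universal_pre t _).trans ((congrArg HomEl.ofHom (Equiv.apply_symm_apply _ _)).trans
    (HomEl.equiv_symm_reindexMap _ _))

lemma ofAct_eq_pre_toMatching {W : C} (a : W ⟶ A.obj x) {p : W ⟶ I.obj x} {q : W ⟶ X}
    (hp : a ≫ A.toObj x = p) (hq : a ≫ A.toBase x = q) {k : W ⟶ M.left}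
    (hk : a ≫ A.toMatching x r = k) (hp' : k ≫ M.hom ≫ prod.fst = p)
    (hq' : k ≫ M.hom ≫ prod.snd = q) :
    A.ofAct x a hp hq = (HomEl.universal r).pre k hp' hq' := by
  subst hk
  rw [← HomEl.pre_pre _ _ (A.toMatching_fst x r) (A.toMatching_snd x r) _ hp hq,
    universal_pre_toMatching, ofAct_pre]
  exact HomEl.ext' fun _ _ _ _ _ => A.actEl_congr _ (by simp) rfl _ _

/-- The relative matching map lifts against `Q` if and only if `InjAt Q f x`. -/
theorem rlp_relMatchingMap_iff (Q : MorphismProperty C) :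
    Q.rlp (relMatchingMap f x r t) ↔ InjAt Q f x := by
  let g := (matchingObjMap f x r t).left
  have hg : g ≫ N.hom = M.hom := Over.w (matchingObjMap f x r t)
  let ρ : A.obj x ⟶ pullback (B.toMatching x t) g := relMatchingMap f x r t
  change Q.rlp ρ ↔ _
  have hρ₁ : ρ ≫ pullback.fst _ _ = f.app x := pullback.lift_fst _ _ _
  have hρ₂ : ρ ≫ pullback.snd _ _ = A.toMatching x r := pullback.lift_snd _ _ _
  have hμ := HomEl.isUniversal_universal r
  have hν := HomEl.isUniversal_universal t
  have hμν := universal_pre_matchingObjMap f x r t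
  constructor
  · intro H Z W i hi a b hab φ h₁ h₂
    have ha₁ : a ≫ A.toObj x = i ≫ b ≫ B.toObj x := by
      rw [← f.app_obj, ← Category.assoc, hab, Category.assoc]
    have ha₂ : a ≫ A.toBase x = i ≫ b ≫ B.toBase x := by
      rw [← f.app_base, ← Category.assoc, hab, Category.assoc]
    -- The operations `φ` amount to a map `m` into `M_x A`. Then `h₂` makes `b` and `m` agree in
    -- `M_x B`, so they give a map into the pullback, and `h₁` makes the square with `ρ` commute.
    obtain ⟨m, hp, hq, hm⟩ := hμ.exists_eq φ
    have hmM : m ≫ M.hom = b ≫ prod.lift (B.toObj x) (B.toBase x) := by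
      apply Limits.prod.hom_ext <;> simp [hp, hq]
    have hbm : b ≫ B.toMatching x t = m ≫ g := by
      refine hν.hom_ext ?_ ?_
      · rw [Category.assoc, Category.assoc, hg, hmM, toMatching_hom]
      · have e := congrArg (fun ψ => HomEl.pre ψ m hp hq) hμν
        rw [HomEl.map_pre, hm, h₂, ofAct_eq_pre_toMatching x t b rfl rfl rfl
          (by rw [Category.assoc, toMatching_fst]) (by rw [Category.assoc, toMatching_snd])] at e
        refine HomEl.ext' fun y T w c h => ?_
        have h' : w ≫ b ≫ B.toObj x = c ≫ (I.homFrom x).toBase y := by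
          rw [← h, Category.assoc, toMatching_fst]
        refine (congrArg (fun ψ : HomEl (I.homFrom x) _ (b ≫ B.toObj x) (b ≫ B.toBase x) =>
          ψ.el y w c h') e).symm.trans ?_
        exact (HomEl.universal t).el_congr (Category.assoc w m g) rfl
          (by simp only [Category.assoc]; rw [← Category.assoc g, hg, hp, h'])
          (by simp only [Category.assoc]; rw [← Category.assoc g, hg, hp, h'])
    have sq : CommSq a i ρ (pullback.lift b m hbm) := ⟨by
      apply pullback.hom_ext
      · rw [Category.assoc, Category.assoc, hρ₁, pullback.lift_fst, hab]
      · rw [Category.assoc, Category.assoc, hρ₂, pullback.lift_snd]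
        have e₁ : (a ≫ A.toMatching x r) ≫ M.hom = (i ≫ m) ≫ M.hom := by
          rw [Category.assoc, Category.assoc, hmM, toMatching_hom, ← Category.assoc i, ← hab]
          apply Limits.prod.hom_ext <;> simp [f.app_obj, f.app_base]
        refine hμ.hom_ext e₁ ?_
        have e := (congrArg (fun ψ => HomEl.pre ψ i rfl rfl) hm).trans h₁
        rw [ofAct_eq_pre_toMatching x r a ha₁ ha₂ rfl
          (by rw [Category.assoc, toMatching_fst, ha₁])
          (by rw [Category.assoc, toMatching_snd, ha₂])] at e
        refine HomEl.ext' fun y T w c h => ?_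
        have h' : w ≫ i ≫ b ≫ B.toObj x = c ≫ (I.homFrom x).toBase y := by
          rw [← h, Category.assoc, toMatching_fst, ha₁]
        refine (congrArg (fun ψ : HomEl (I.homFrom x) _ (i ≫ b ≫ B.toObj x)
          (i ≫ b ≫ B.toBase x) => ψ.el y w c h') e).symm.trans ?_
        exact (HomEl.universal r).el_congr (Category.assoc _ _ _) rfl
          (by rw [Category.assoc, Category.assoc, hp, h'])
          (by rw [Category.assoc, Category.assoc, hp, h'])⟩
    have := H i hi
    refine ⟨sq.lift, sq.fac_left, ?_, ?_⟩
    · rw [← hρ₁, ← Category.assoc, sq.fac_right, pullback.lift_fst]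
    · refine (ofAct_eq_pre_toMatching x r _ _ _ ?_ hp hq).trans hm
      rw [← hρ₂, ← Category.assoc, sq.fac_right, pullback.lift_snd]
  · intro H Z W i hi
    constructor
    intro a c sq
    obtain ⟨b, hb⟩ : ∃ b, b = c ≫ pullback.fst _ _ := ⟨_, rfl⟩
    obtain ⟨m, hm⟩ : ∃ m, m = c ≫ pullback.snd _ _ := ⟨_, rfl⟩
    have hbm : b ≫ B.toMatching x t = m ≫ g := by
      rw [hb, hm, Category.assoc, Category.assoc, pullback.condition]
    have hab : a ≫ f.app x = i ≫ b := by
      rw [hb, ← hρ₁, ← Category.assoc, sq.w, Category.assoc]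
    have ham : a ≫ A.toMatching x r = i ≫ m := by
      rw [hm, ← hρ₂, ← Category.assoc, sq.w, Category.assoc]
    have hmM : m ≫ M.hom = b ≫ prod.lift (B.toObj x) (B.toBase x) := by
      rw [← hg, ← Category.assoc, ← hbm, Category.assoc, toMatching_hom]
    have hp : m ≫ M.hom ≫ prod.fst = b ≫ B.toObj x := by
      rw [← Category.assoc, hmM]; simp
    have hq : m ≫ M.hom ≫ prod.snd = b ≫ B.toBase x := by
      rw [← Category.assoc, hmM]; simp
    -- A map into the pullback is a pair `b`, `m`; the operations classified by `m` pose a problem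
    -- that `InjAt` solves.
    obtain ⟨l, h₁, h₂, h₃⟩ := H i hi a b hab ((HomEl.universal r).pre m hp hq)
      (by
        rw [HomEl.pre_pre]
        exact (ofAct_eq_pre_toMatching x r _ _ _ ham _ _).symm)
      (by
        rw [← HomEl.map_pre, ← hμν, HomEl.pre_pre]
        exact (ofAct_eq_pre_toMatching x t _ _ _ hbm _ _).symm)
    refine ⟨⟨{ l := l, fac_left := h₁, fac_right := ?_ }⟩⟩
    have hl₁ : l ≫ A.toObj x = b ≫ B.toObj x := by rw [← f.app_obj, ← Category.assoc, h₂]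
    have hl₂ : l ≫ A.toBase x = b ≫ B.toBase x := by rw [← f.app_base, ← Category.assoc, h₂]
    apply pullback.hom_ext
    · rw [Category.assoc, hρ₁, h₂, hb]
    · rw [Category.assoc, hρ₂, ← hm]
      refine hμ.hom_ext ?_ ?_
      · rw [hmM, Category.assoc, toMatching_hom]
        apply Limits.prod.hom_ext <;> simp [hl₁, hl₂]
      · rw [ofAct_eq_pre_toMatching x r l hl₁ hl₂ rfl
          (by rw [Category.assoc, toMatching_fst, hl₁])
          (by rw [Category.assoc, toMatching_snd, hl₂])] at h₃
        refine HomEl.ext' fun y T w c h => ?_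
        have h' : w ≫ b ≫ B.toObj x = c ≫ (I.homFrom x).toBase y := by
          rw [← h, Category.assoc, toMatching_fst, hl₁]
        exact congrArg (fun ψ : HomEl (I.homFrom x) _ (b ≫ B.toObj x) (b ≫ B.toBase x) =>
          ψ.el y w c h') h₃

end

end Diagram

end InternalInverseCategory

/-! ### Absolute matching maps, pullbacks of cofibrations, and source maps. -/

namespace InternalInverseCategory

namespace Diagram

attribute [local simp] pullback.lift_fst pullback.lift_fst_assoc pullback.lift_snd
  pullback.lift_snd_assoc prod.lift_fst prod.lift_fst_assoc prod.lift_snd prod.lift_snd_assoc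

variable {C : Type u} [Category.{v} C] [HasPullbacks C] [HasBinaryProducts C]
  {I : InternalInverseCategory.{w} C} {X Y : C}

variable (I X) in
/-- The terminal `X`-indexed diagram. -/
def terminal : Diagram I X :=
  ofElements (fun x => I.obj x ⨯ X) (fun _ => prod.snd) (fun _ => prod.fst)
    (fun h _ a b _ => prod.lift (b ≫ I.tgt h) (a ≫ prod.snd))
    (fun h T T' t a b hab => by apply Limits.prod.hom_ext <;> simp)
    (fun _ _ _ _ _ => prod.lift_snd _ _)
    (fun _ _ _ _ _ => prod.lift_fst _ _)
    (fun h k T a b c hab hbc => by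
      apply Limits.prod.hom_ext <;> simp [compEl_tgt])

/-- The map to the terminal diagram. -/
def toTerminal (A : Diagram I X) : A ⟶ terminal I X :=
  Hom.ofElements (fun x => prod.lift (A.toObj x) (A.toBase x)) (fun _ => prod.lift_snd _ _)
    (fun _ => prod.lift_fst _ _)
    (fun h T a b hab => by
      apply Limits.prod.hom_ext
      · refine Eq.trans ?_ ((terminal I X).actEl_toObj ..).symm
        refine (Category.assoc _ _ _).trans ((congrArg (_ ≫ ·) (prod.lift_fst _ _)).trans ?_)
        rw [actEl_toObj]
      · refine Eq.trans ?_ ((terminal I X).actEl_toBase ..).symm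
        refine Eq.trans ?_ (Category.assoc _ _ _).symm
        refine Eq.trans ?_ (congrArg (_ ≫ ·) (prod.lift_snd _ _)).symm
        refine (Category.assoc _ _ _).trans ((congrArg (_ ≫ ·) (prod.lift_snd _ _)).trans ?_)
        rw [actEl_toBase])

/-- Operations with values in the terminal diagram are determined by their legs, so its matching
object is `I(x) × X` and the relative matching map of `A.toTerminal` is the absolute map `A_x ⟶ M_x
A`. -/
lemma injAt_toTerminal {Q : MorphismProperty C} (A : Diagram I X) (x : I.Ob)
    {M : Over (I.obj x ⨯ X)} (r : (A.matchingFunctor x).RepresentableBy M)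
    (H : Q.rlp (A.matchingMap x r).left) : InjAt Q A.toTerminal x := by
  intro Z W i hi a (b : W ⟶ I.obj x ⨯ X) hab φ h₁ h₂
  have hab' : a ≫ prod.lift (A.toObj x) (A.toBase x) = i ≫ b := hab
  have hμ := HomEl.isUniversal_universal r
  obtain ⟨m, hp, hq, hm⟩ := hμ.exists_eq φ
  replace hp : m ≫ M.hom ≫ prod.fst = b ≫ prod.fst := hp
  replace hq : m ≫ M.hom ≫ prod.snd = b ≫ prod.snd := hq
  have hmM : m ≫ M.hom = b := by
    apply Limits.prod.hom_ext <;> simp [hp, hq]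
  have ha₁ : a ≫ A.toObj x = i ≫ b ≫ prod.fst := by
    rw [← Category.assoc i, ← hab', Category.assoc, prod.lift_fst]
  have ha₂ : a ≫ A.toBase x = i ≫ b ≫ prod.snd := by
    rw [← Category.assoc i, ← hab', Category.assoc, prod.lift_snd]
  have sq : CommSq a i (A.toMatching x r) m := ⟨by
    refine hμ.hom_ext (by rw [Category.assoc, Category.assoc, hmM, toMatching_hom, hab']) ?_
    have e := ((congrArg (fun ψ => HomEl.pre ψ i rfl rfl) hm).trans h₁).trans
      (ofAct_eq_pre_toMatching x r a ha₁ ha₂ rfl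
        (by rw [Category.assoc, toMatching_fst, ha₁])
        (by rw [Category.assoc, toMatching_snd, ha₂]))
    refine HomEl.ext' fun y T w c h => ?_
    have h' : w ≫ i ≫ b ≫ prod.fst = c ≫ (I.homFrom x).toBase y := by
      rw [← h, Category.assoc, toMatching_fst, ha₁]
    refine (congrArg (fun ψ : HomEl (I.homFrom x) _ (i ≫ b ≫ prod.fst) (i ≫ b ≫ prod.snd) =>
      ψ.el y w c h') e).symm.trans ?_
    exact (HomEl.universal r).el_congr (Category.assoc _ _ _) rfl
      (by rw [Category.assoc, Category.assoc, hp, h'])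
      (by rw [Category.assoc, Category.assoc, hp, h'])⟩
  have : HasLiftingProperty i (A.toMatching x r) := H i hi
  refine ⟨sq.lift, sq.fac_left, ?_, ?_⟩
  · refine (congrArg (sq.lift ≫ ·) (A.toMatching_hom x r).symm).trans ?_
    rw [← Category.assoc, sq.fac_right, hmM]
  · exact (ofAct_eq_pre_toMatching x r _ _ _ sq.fac_right hp hq).trans hm

-- Pasting of pullbacks. Through this square the maps `along` inherit from `i` the classes stable
-- under the relevant base change.
omit [HasBinaryProducts C] in
lemma isPullback_along (P : Diagram I X) {Z W : C} (i : Z ⟶ W) {p : W ⟶ X} {p' : Z ⟶ X}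
    (hp : i ≫ p = p') (y : I.Ob) :
    IsPullback (P.along i hp y) ((P.reindex p').toBase y) ((P.reindex p).toBase y) i := by
  have h₁ : IsPullback (P.proj p y) ((P.reindex p).toBase y) (P.toBase y) p :=
    IsPullback.of_hasPullback _ _
  have h₂ : IsPullback (P.proj p' y) ((P.reindex p').toBase y) (P.toBase y) p' :=
    IsPullback.of_hasPullback _ _
  refine IsPullback.of_right ?_ (P.along_toBase i hp y) h₁
  rw [along_proj, hp]
  exact h₂

end Diagram

section ModelCategory

open Diagram

variable {C : Type u} [Category.{v} C] [ModelCategory C]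

variable (C) in
lemma fibrations_eq_rlp : (fibrations C) = (trivialCofibrations C).rlp :=
  (MorphismProperty.rlp_eq_of_wfs _ _).symm

variable (C) in
lemma trivialFibrations_eq_rlp : (trivialFibrations C) = (cofibrations C).rlp :=
  (MorphismProperty.rlp_eq_of_wfs _ _).symm

section

variable [IsTypeTheoreticModelCategory.{w} C]

-- The pullback of `g` along `f` is the limit of a transformation from the cospan of `g` and `f` to
-- that of the identity and `f`, with components `g` and identities.
variable (C) in
lemma isStableUnderBaseChange_cofibrations : (cofibrations C).IsStableUnderBaseChange := by
  refine ⟨fun {X Y Y' S f g f' g'} sq hg => ?_⟩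
  have := IsTypeTheoreticModelCategory.hasLimits.{w} (C := C)
  -- The hypothesis on limits concerns shapes in universe `w`, so the walking cospan is replaced by
  -- an equivalent category there.
  let e : ULiftHom.{w} (ULift.{w} WalkingCospan) ≌ WalkingCospan :=
    (ULiftHomULiftCategory.equiv.{w, w} WalkingCospan).symm
  let α : cospan g f ⟶ cospan (𝟙 S) f := cospanHomMk (𝟙 S) g (𝟙 X) (by simp) (by simp)
  have hα (j) : Cofibration (α.app j) := by
    rcases j with _ | _ | _
    · exact inferInstanceAs (Cofibration (𝟙 S))
    · exact ⟨hg⟩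
    · exact inferInstanceAs (Cofibration (𝟙 X))
  have key := IsTypeTheoreticModelCategory.limits_preserve_cofibrations.{w}
    (e.functor ⋙ cospan g f) (e.functor ⋙ cospan (𝟙 S) f) (Functor.whiskerLeft e.functor α)
    (fun j => hα _)
  have sq' : IsPullback f (𝟙 X) (𝟙 S) f := IsPullback.of_vert_isIso ⟨by simp⟩
  let l₁ := sq.isLimit.whiskerEquivalence e
  let l₂ := sq'.isLimit.whiskerEquivalence e
  have hiso : Arrow.mk g' ≅ Arrow.mk (limMap (Functor.whiskerLeft e.functor α)) := by
    refine Arrow.isoMk (l₁.conePointUniqueUpToIso (limit.isLimit _))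
      (l₂.conePointUniqueUpToIso (limit.isLimit _)) ?_
    have hk (k : WalkingCospan) : sq.cone.π.app k ≫ α.app k = g' ≫ sq'.cone.π.app k := by
      rcases k with _ | _ | _
      · have h₁ : sq.cone.π.app .one = f' ≫ g := PullbackCone.condition_one _
        have h₂ : sq'.cone.π.app .one = f ≫ 𝟙 S := PullbackCone.condition_one _
        have h₃ : α.app .one = 𝟙 S := rfl
        change sq.cone.π.app .one ≫ α.app .one = g' ≫ sq'.cone.π.app .one
        rw [h₁, h₂, h₃, Category.comp_id f]
        exact (Category.comp_id _).trans sq.w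
      · exact sq.w
      · exact (Category.comp_id g').trans (Category.comp_id g').symm
    refine limit.hom_ext fun j => ?_
    have h₁ := l₁.conePointUniqueUpToIso_hom_comp (limit.isLimit _) j
    have h₂ := l₂.conePointUniqueUpToIso_hom_comp (limit.isLimit _) j
    refine (Category.assoc _ _ _).trans ?_
    refine Eq.trans ?_ (Category.assoc _ _ _).symm
    refine Eq.trans ?_ (congrArg (_ ≫ ·) h₂).symm
    refine (congrArg (_ ≫ ·) (limMap_π _ _)).trans ?_
    refine (Category.assoc _ _ _).symm.trans ?_
    exact (congrArg (· ≫ _) h₁).trans (hk _)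
  exact ((cofibrations C).arrow_mk_iso_iff hiso).2 key.mem

lemma powerful_of_fibration {X Y Z : C} (s : X ⟶ Y) [Fibration s] :
    (Over.pullback (pullback.snd s (prod.fst : Y ⨯ Z ⟶ Y))).IsLeftAdjoint :=
  IsTypeTheoreticModelCategory.pullback_isLeftAdjoint.{w} _

/-- Stability of cofibrations handles one half and right properness the other; only the latter needs
`f` to be a fibration. -/
lemma trivialCofibrations_of_isPullback {P X Y S : C} {fst : P ⟶ X} {snd : P ⟶ Y} {f : X ⟶ S}
    {g : Y ⟶ S} (sq : IsPullback fst snd f g) [Fibration f] (hg : trivialCofibrations C g) :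
    trivialCofibrations C fst := by
  have : WeakEquivalence g := ⟨hg.2⟩
  have := isStableUnderBaseChange_cofibrations.{w} C
  exact ⟨(cofibrations C).of_isPullback sq.flip hg.1,
    (IsTypeTheoreticModelCategory.rightProper.{w} fst snd f g sq).mem⟩

variable {I : InternalInverseCategory.{w} C} {X Y : C}

lemma trivialCofibrations_along (P : Diagram I X) {Z W : C} (i : Z ⟶ W)
    (hi : trivialCofibrations C i) {p : W ⟶ X} {p' : Z ⟶ X}
    (hp : i ≫ p = p') (y : I.Ob) [Fibration (P.toBase y)] :
    trivialCofibrations C (P.along i hp y) := by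
  have : Fibration ((P.reindex p).toBase y) :=
    inferInstanceAs (Fibration (pullback.snd (P.toBase y) p))
  exact trivialCofibrations_of_isPullback.{w} (P.isPullback_along i hp y) hi

lemma cofibrations_along (P : Diagram I X) {Z W : C} (i : Z ⟶ W)
    (hi : cofibrations C i) {p : W ⟶ X} {p' : Z ⟶ X} (hp : i ≫ p = p') (y : I.Ob) :
    cofibrations C (P.along i hp y) :=
  have := isStableUnderBaseChange_cofibrations.{w} C
  (cofibrations C).of_isPullback (P.isPullback_along i hp y).flip hi

/-- The source maps of a fibrant inverse category are fibrations. -/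
theorem IsFibrant.fibration_src (hI : I.IsFibrant) (x : I.Ob) :
    ∀ (y : I.Ob) (h : I.rel y x), Fibration (I.src h) := by
  induction x using I.rel_wf.induction with
  | _ x ih =>
    intro y h
    have := (hI y).1
    let D := I.homFrom x
    have hinj (z : (I.below x).Ob) : InjAt (trivialCofibrations C) D.toTerminal z := by
      obtain ⟨⟨M, ⟨r⟩⟩, hM⟩ := (hI x).2 z
      refine injAt_toTerminal D z r ?_
      rw [← fibrations_eq_rlp]
      exact hM M r
    let y' : (I.below x).Ob := ⟨y, h⟩
    obtain ⟨⟨M, ⟨r⟩⟩, hM⟩ := (hI x).2 y'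
    have : Fibration (D.toMatching y' r) := ⟨hM M r⟩
    have hμ := HomEl.isUniversal_universal r
    -- A lifting problem for `M_y I(x,-) ⟶ I(y) × I(x)` asks to extend, along an acyclic
    -- cofibration, a family of operations from `I(y,-)` to `I(x,-)` below `y`.
    have : Fibration M.hom := by
      rw [fibration_iff, fibrations_eq_rlp]
      intro Z W i hi
      constructor
      intro a b sq
      have hinj' (z : ((I.below x).below y').Ob) : InjAt (trivialCofibrations C)
          (restrictMap D.toTerminal {z | (I.below x).rel z y'}) z :=
        InjAt.restrict (fun h k => (I.below x).rel_trans h k) z (hinj _)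
      -- The induction hypothesis at `y`: the sources `I(y,z) ⟶ I(y)` are fibrations, so the maps
      -- `along` of the extension problem are acyclic cofibrations.
      have hP (z : ((I.below x).below y').Ob) :
          Fibration (((I.below x).homFrom y').toBase z) := ih y h z.1.1 z.2
      let β : HomEl ((I.below x).homFrom y') ((terminal (I.below x) (I.obj x)).restrict
          {z | (I.below x).rel z y'}) (b ≫ prod.fst) (b ≫ prod.snd) :=
        ofAct _ y' b rfl rfl
      obtain ⟨γ, hγ, -⟩ := HomEl.exists_extension hinj' i (p := b ≫ prod.fst)
        (q := b ≫ prod.snd) (p' := a ≫ M.hom ≫ prod.fst) (q' := a ≫ M.hom ≫ prod.snd)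
        (by rw [← Category.assoc, ← sq.w, Category.assoc])
        (by rw [← Category.assoc, ← sq.w, Category.assoc])
        (fun z => trivialCofibrations_along _ _ hi _ _)
        ((HomEl.universal r).pre a rfl rfl) β
        (HomEl.ext' fun z T w c e => by
          apply Limits.prod.hom_ext
          · exact (HomEl.el_toObj (HomEl.map _ _) z w c e).trans (HomEl.el_toObj _ z w c e).symm
          · exact (HomEl.el_toBase (HomEl.map _ _) z w c e).trans
              (HomEl.el_toBase _ z w c e).symm)
      obtain ⟨m, hp, hq, hm⟩ := hμ.exists_eq γ
      have hmM : m ≫ M.hom = b := by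
        apply Limits.prod.hom_ext <;> simp [hp, hq]
      refine ⟨⟨{ l := m, fac_left := ?_, fac_right := hmM }⟩⟩
      refine hμ.hom_ext (by rw [Category.assoc, hmM, sq.w]) ?_
      rw [← hm, HomEl.pre_pre] at hγ
      refine HomEl.ext' fun z T w c e => ?_
      have e' : w ≫ a ≫ M.hom ≫ prod.fst = c ≫ ((I.below x).homFrom y').toBase z := by
        rw [← e, Category.assoc, ← Category.assoc m, hmM, ← Category.assoc a, sq.w,
          Category.assoc]
      exact congrArg (fun ψ : HomEl ((I.below x).homFrom y') _ (a ≫ M.hom ≫ prod.fst)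
        (a ≫ M.hom ≫ prod.snd) => ψ.el z w c e') hγ
    -- The composite `I(x,y) ⟶ M_y I(x,-) ⟶ I(y) × I(x) ⟶ I(x)`; the final projection is a fibration
    -- because `I(y)` is fibrant.
    have e : I.src h = D.toMatching y' r ≫ M.hom ≫ prod.snd := (D.toMatching_snd y' r).symm
    have : Fibration (prod.snd : I.obj y ⨯ I.obj x ⟶ I.obj x) := inferInstance
    rw [e]
    exact ⟨(fibrations C).comp_mem _ _ (mem_fibrations (D.toMatching y' r))
      ((fibrations C).comp_mem _ _ (mem_fibrations M.hom) this.mem)⟩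

end

end ModelCategory

end InternalInverseCategory

/-! ### Relative matching objects and Reedy acyclic fibrations. -/

namespace InternalInverseCategory

namespace Diagram

attribute [local simp] pullback.lift_fst pullback.lift_fst_assoc pullback.lift_snd
  pullback.lift_snd_assoc prod.lift_fst prod.lift_fst_assoc prod.lift_snd prod.lift_snd_assoc

section

variable {C : Type u} [Category.{v} C] [HasPullbacks C] {I : InternalInverseCategory.{w} C}
  {X Y : C} {x : I.Ob} {B : Diagram I X} {E : Diagram (I.below x) X}

lemma ofAct_pre_of_eq (A : Diagram I X) (x : I.Ob) {W W' : C} (a : W ⟶ A.obj x) {p : W ⟶ I.obj x}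
    {q : W ⟶ X} (hp : a ≫ A.toObj x = p) (hq : a ≫ A.toBase x = q) (k : W' ⟶ W)
    {p' : W' ⟶ I.obj x} {q' : W' ⟶ X} (hp' : k ≫ p = p') (hq' : k ≫ q = q')
    {a' : W' ⟶ A.obj x} (ha' : k ≫ a = a') :
    (A.ofAct x a hp hq).pre k hp' hq' = A.ofAct x a' (by rw [← ha', Category.assoc, hp, hp'])
      (by rw [← ha', Category.assoc, hq, hq']) := by
  subst ha'; exact ofAct_pre ..

/-- An object representing pairs of a generalized element `b` of `B_x` and a family of operations
with values in `E` over the one given by the actions on `b`. -/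
structure RelMatching (g : E ⟶ B.restrict {y | I.rel y x}) where
  obj : C
  hom : obj ⟶ B.obj x
  el : HomEl (I.homFrom x) E (hom ≫ B.toObj x) (hom ≫ B.toBase x)
  el_map : el.map g = B.ofAct x hom rfl rfl
  exists_lift : ∀ {W : C} (b : W ⟶ B.obj x)
    (φ : HomEl (I.homFrom x) E (b ≫ B.toObj x) (b ≫ B.toBase x)), φ.map g = B.ofAct x b rfl rfl →
    ∃ (k : W ⟶ obj) (h : k ≫ hom = b),
      el.pre k (by rw [← h, Category.assoc]) (by rw [← h, Category.assoc]) = φ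
  hom_ext : ∀ {W : C} {k k' : W ⟶ obj} (h : k ≫ hom = k' ≫ hom),
    el.pre k rfl rfl = el.pre k' (by rw [← Category.assoc, ← h, Category.assoc])
      (by rw [← Category.assoc, ← h, Category.assoc]) → k = k'

namespace RelMatching

variable {g : E ⟶ B.restrict {y | I.rel y x}} (R : RelMatching g)

/-- Extension of generalized elements along maps left orthogonal to `ρ`. -/
lemma exists_of_rlp {D : C} (ρ : D ⟶ R.obj) {Z W : C} (i : Z ⟶ W) [HasLiftingProperty i ρ]
    (a : Z ⟶ D) (b : W ⟶ B.obj x) (hab : a ≫ ρ ≫ R.hom = i ≫ b)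
    (φ : HomEl (I.homFrom x) E (b ≫ B.toObj x) (b ≫ B.toBase x))
    (h₁ : φ.map g = B.ofAct x b rfl rfl)
    (h₂ : φ.pre i rfl rfl = R.el.pre (a ≫ ρ)
      (by rw [← Category.assoc i, ← hab]; simp) (by rw [← Category.assoc i, ← hab]; simp)) :
    ∃ (l : W ⟶ D) (_ : i ≫ l = a) (h : l ≫ ρ ≫ R.hom = b),
      R.el.pre (l ≫ ρ) (by rw [← h]; simp) (by rw [← h]; simp) = φ := by
  obtain ⟨k, hk, hk'⟩ := R.exists_lift b φ h₁
  have sq : CommSq a i ρ k := ⟨by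
    refine R.hom_ext (by rw [Category.assoc, hab, Category.assoc, hk]) ?_
    rw [← hk', HomEl.pre_pre] at h₂
    refine HomEl.ext' fun y T w c h => ?_
    have h' : w ≫ i ≫ b ≫ B.toObj x = c ≫ (I.homFrom x).toBase y := by
      rw [← h, ← Category.assoc i, ← hab]; simp
    exact (congrArg (fun ψ : HomEl (I.homFrom x) E (i ≫ b ≫ B.toObj x) (i ≫ b ≫ B.toBase x) =>
      ψ.el y w c h') h₂).symm⟩
  refine ⟨sq.lift, sq.fac_left, ?_, ?_⟩
  · rw [← Category.assoc, sq.fac_right, hk]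
  · exact (R.el.pre_congr sq.fac_right _ _).trans hk'

/-- If `g` is right orthogonal to `Q`, then so is the projection from the relative matching
object. -/
lemma hasLiftingProperty_hom {Q : MorphismProperty C} (hg : ∀ y, InjAt Q g y) {Z W : C}
    (i : Z ⟶ W) (hi : ∀ {p : W ⟶ I.obj x} {p' : Z ⟶ I.obj x} (hp : i ≫ p = p') (y),
      Q ((I.homFrom x).along i hp y)) : HasLiftingProperty i R.hom := by
  constructor
  intro a b sq
  -- A lift through `R.hom` is an extension along `i` of the operations given by `a`, with
  -- prescribed image under `g`, namely the actions on `b`.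
  obtain ⟨γ, h₁, h₂⟩ := HomEl.exists_extension hg i (p := b ≫ B.toObj x) (q := b ≫ B.toBase x)
    (p' := a ≫ R.hom ≫ B.toObj x) (q' := a ≫ R.hom ≫ B.toBase x)
    (by rw [← Category.assoc, ← sq.w, Category.assoc])
    (by rw [← Category.assoc, ← sq.w, Category.assoc]) (hi _) (R.el.pre a rfl rfl)
    (B.ofAct x b rfl rfl) (by
      rw [← HomEl.map_pre, R.el_map, ofAct_pre_of_eq _ _ _ _ _ _ _ _ rfl,
        ofAct_pre_of_eq _ _ _ _ _ _ _ _ sq.w.symm])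
  obtain ⟨k, hk, hk'⟩ := R.exists_lift b γ h₂
  refine ⟨⟨{ l := k, fac_left := ?_, fac_right := hk }⟩⟩
  refine R.hom_ext (by rw [Category.assoc, hk, sq.w]) ?_
  rw [← hk', HomEl.pre_pre] at h₁
  refine HomEl.ext' fun y T w c h => ?_
  have h' : w ≫ a ≫ R.hom ≫ B.toObj x = c ≫ (I.homFrom x).toBase y := by
    rw [← h, Category.assoc, ← Category.assoc k, hk, ← Category.assoc a, sq.w, Category.assoc]
  exact congrArg (fun ψ : HomEl (I.homFrom x) E (a ≫ R.hom ≫ B.toObj x)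
    (a ≫ R.hom ≫ B.toBase x) => ψ.el y w c h') h₁

end RelMatching

variable {A : Diagram I X} {f : A ⟶ B} (R : RelMatching (restrictMap f {y | I.rel y x}))

/-- The relative matching map of `f`, classified by `f.app x` and the actions on the generic element
of `A_x`. -/
lemma RelMatching.exists_map : ∃ (ρ : A.obj x ⟶ R.obj) (h : ρ ≫ R.hom = f.app x),
    R.el.pre ρ (by rw [← Category.assoc, h, f.app_obj]) (by rw [← Category.assoc, h, f.app_base]) =
      A.ofAct x (𝟙 _) (Category.id_comp _) (Category.id_comp _) := by
  obtain ⟨ρ, h, h'⟩ := R.exists_lift (f.app x)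
    (A.ofAct x (𝟙 _) (by rw [Category.id_comp, f.app_obj])
      (by rw [Category.id_comp, f.app_base])) (by
      rw [ofAct_map]
      exact HomEl.ext' fun _ _ _ _ _ => B.actEl_congr _ (by simp) rfl _ _)
  refine ⟨ρ, h, HomEl.ext' fun y T w c e => ?_⟩
  have e' : w ≫ f.app x ≫ B.toObj x = c ≫ (I.homFrom x).toBase y := by rw [f.app_obj, e]
  exact congrArg (fun ψ : HomEl (I.homFrom x) _ (f.app x ≫ B.toObj x) (f.app x ≫ B.toBase x) =>
    ψ.el y w c e') h'

lemma RelMatching.ofAct_eq {ρ : A.obj x ⟶ R.obj} (h : ρ ≫ R.hom = f.app x)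
    (hρ : R.el.pre ρ (by rw [← Category.assoc, h, f.app_obj])
      (by rw [← Category.assoc, h, f.app_base]) =
      A.ofAct x (𝟙 _) (Category.id_comp _) (Category.id_comp _)) {W : C} (a : W ⟶ A.obj x)
    {p : W ⟶ I.obj x} {q : W ⟶ X} (hp : a ≫ A.toObj x = p) (hq : a ≫ A.toBase x = q) :
    R.el.pre (a ≫ ρ) (by rw [← hp, Category.assoc, ← Category.assoc ρ, h, f.app_obj])
      (by rw [← hq, Category.assoc, ← Category.assoc ρ, h, f.app_base]) = A.ofAct x a hp hq := by
  rw [← HomEl.pre_pre _ _ (by rw [← Category.assoc, h, f.app_obj])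
      (by rw [← Category.assoc, h, f.app_base]) _ hp hq, hρ]
  exact ofAct_pre_of_eq _ _ _ _ _ _ _ _ (Category.comp_id _)

/-- The pairs `b`, `φ` in the definition of `InjAt` are the maps `W ⟶ R.obj`, so the two lifting
problems coincide. -/
theorem RelMatching.injAt_iff {ρ : A.obj x ⟶ R.obj} (h : ρ ≫ R.hom = f.app x)
    (hρ : R.el.pre ρ (by rw [← Category.assoc, h, f.app_obj])
      (by rw [← Category.assoc, h, f.app_base]) =
      A.ofAct x (𝟙 _) (Category.id_comp _) (Category.id_comp _)) (Q : MorphismProperty C) :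
    InjAt Q f x ↔ Q.rlp ρ := by
  constructor
  · intro H Z W i hi
    constructor
    intro a k sq
    have hab : a ≫ f.app x = i ≫ k ≫ R.hom := by
      rw [← h, ← Category.assoc, sq.w, Category.assoc]
    obtain ⟨l, h₁, h₂, h₃⟩ := H i hi a (k ≫ R.hom) hab
      (R.el.pre k (Category.assoc _ _ _).symm (Category.assoc _ _ _).symm)
      (by
        rw [HomEl.pre_pre, ← R.ofAct_eq h hρ a]
        exact HomEl.pre_congr _ sq.w.symm _ _)
      (by
        rw [← HomEl.map_pre, R.el_map]
        exact ofAct_pre_of_eq _ _ _ _ _ _ _ _ rfl)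
    refine ⟨⟨{ l := l, fac_left := h₁, fac_right := ?_ }⟩⟩
    refine R.hom_ext (by rw [Category.assoc, h, h₂]) ?_
    rw [← R.ofAct_eq h hρ l] at h₃
    refine HomEl.ext' fun y T w c e => ?_
    have e' : w ≫ (k ≫ R.hom) ≫ B.toObj x = c ≫ (I.homFrom x).toBase y := by
      rw [← e, ← h₂, ← h]; simp
    exact congrArg (fun ψ : HomEl (I.homFrom x) _ ((k ≫ R.hom) ≫ B.toObj x)
      ((k ≫ R.hom) ≫ B.toBase x) => ψ.el y w c e') h₃
  · intro H Z W i hi a b hab φ h₁ h₂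
    have := H i hi
    obtain ⟨l, e₁, e₂, e₃⟩ := R.exists_of_rlp ρ i a b (by rw [h, hab]) φ h₂
      (h₁.trans (R.ofAct_eq h hρ a _ _).symm)
    refine ⟨l, e₁, by rw [← h, e₂], ?_⟩
    rw [← e₃]
    exact (R.ofAct_eq h hρ l _ _).symm

end

section ModelCategory

variable {C : Type u} [Category.{v} C] [ModelCategory C] [IsTypeTheoreticModelCategory.{w} C]
  {I : InternalInverseCategory.{w} C} (hI : I.IsFibrant) {X : C}

/-- Cofibrations are stable under arbitrary pullback, so lifting a cofibration against the
projection is an extension problem for operations, which only involves `f` below `x`. -/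
lemma RelMatching.trivialFibrations_hom {A B : Diagram I X} {x : I.Ob} {f : A ⟶ B}
    (R : RelMatching (restrictMap f {y | I.rel y x}))
    (hf : ∀ y, I.rel y x → InjAt (cofibrations C) f y) : trivialFibrations C R.hom := by
  rw [trivialFibrations_eq_rlp]
  intro Z W i hi
  refine R.hasLiftingProperty_hom (Q := cofibrations C) (fun y => ?_) i (fun hp y => ?_)
  · exact InjAt.restrict (fun h k => I.rel_trans h k) y (hf y.1 y.2)
  · exact cofibrations_along.{w} _ i hi hp y

include hI

lemma fibration_homFrom (x : I.Ob) (y : (I.below x).Ob) : Fibration ((I.homFrom x).toBase y) :=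
  hI.fibration_src x y.1 y.2

/-- The legs of `I(x,-)` are source maps, and the legs of its actions are composites of a
pulled-back source map with a source map. All are fibrations, hence so are their base changes, and
pullback along these has a right adjoint. -/
theorem exists_matchingObject (x : I.Ob) (B : Diagram (I.below x) X) :
    ∃ (M : Over (I.obj x ⨯ X))
      (μ : HomEl (I.homFrom x) B (M.hom ≫ prod.fst) (M.hom ≫ prod.snd)), μ.IsUniversal := by
  have := IsTypeTheoreticModelCategory.hasLimits.{w} (C := C)
  refine HomEl.exists_universal _ _ (fun y => ?_) (fun {y z} h => ?_)
  · have := fibration_homFrom hI x y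
    exact powerful_of_fibration.{w} _
  · have := fibration_homFrom hI x y
    have : Fibration ((I.below x).src h) := hI.fibration_src y.1 z.1 h
    exact powerful_of_fibration.{w} _

lemma matchingFunctor_isRepresentable (A : Diagram I X) (x : I.Ob) :
    (A.matchingFunctor x).IsRepresentable := by
  obtain ⟨M, μ, hμ⟩ := exists_matchingObject hI x (A.restrict {y | I.rel y x})
  exact hμ.isRepresentable

/-- The pullback `B_x ×_{M_x B} M_x E`. Since `E` is defined only below `x`, this is available
during the recursion for factorizations, before the middle object at `x` exists. -/
theorem nonempty_relMatching {x : I.Ob} {B : Diagram I X} {E : Diagram (I.below x) X}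
    (g : E ⟶ B.restrict {y | I.rel y x}) : Nonempty (RelMatching g) := by
  obtain ⟨M, μ, hμ⟩ := exists_matchingObject hI x E
  obtain ⟨N, ν, hν⟩ := exists_matchingObject hI x (B.restrict {y | I.rel y x})
  obtain ⟨m, hm₁, hm₂, hm⟩ := hν.exists_eq (μ.map g)
  obtain ⟨t, ht₁, ht₂, ht⟩ := hν.exists_eq
    (B.ofAct x (𝟙 _) (Category.id_comp _) (Category.id_comp _))
  have hmM : m ≫ N.hom = M.hom := by
    apply Limits.prod.hom_ext <;> simp [hm₁, hm₂]
  have e₁ : pullback.fst t m ≫ B.toObj x = pullback.snd t m ≫ M.hom ≫ prod.fst := by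
    rw [← ht₁, ← Category.assoc, pullback.condition, ← hmM]; simp
  have e₂ : pullback.fst t m ≫ B.toBase x = pullback.snd t m ≫ M.hom ≫ prod.snd := by
    rw [← ht₂, ← Category.assoc, pullback.condition, ← hmM]; simp
  have key {W : C} (b : W ⟶ B.obj x) : B.ofAct x b rfl rfl =
      ν.pre (b ≫ t) (by rw [Category.assoc, ht₁]) (by rw [Category.assoc, ht₂]) := by
    rw [← HomEl.pre_pre _ _ ht₁ ht₂ _ rfl rfl, ht]
    exact (ofAct_pre_of_eq _ _ _ _ _ _ _ _ (Category.comp_id _)).symm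
  have key' {W : C} (k : W ⟶ M.left) {p : W ⟶ I.obj x} {q : W ⟶ X}
      (hp : k ≫ M.hom ≫ prod.fst = p) (hq : k ≫ M.hom ≫ prod.snd = q) :
      (μ.pre k hp hq).map g = ν.pre (k ≫ m) (by rw [Category.assoc, hm₁, hp])
        (by rw [Category.assoc, hm₂, hq]) := by
    rw [← HomEl.map_pre, ← hm, HomEl.pre_pre]
  refine ⟨{ obj := pullback t m, hom := pullback.fst t m,
            el := μ.pre (pullback.snd t m) e₁.symm e₂.symm, el_map := ?_,
            exists_lift := fun {W} b φ hφ => ?_, hom_ext := fun {W k k'} h hk => ?_ }⟩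
  · rw [key', key]
    exact HomEl.pre_congr _ pullback.condition.symm _ _
  · obtain ⟨k, hp, hq, hk⟩ := hμ.exists_eq φ
    have hkM : k ≫ M.hom = b ≫ t ≫ N.hom := by
      apply Limits.prod.hom_ext <;> simp [hp, hq, ht₁, ht₂]
    have hbk : b ≫ t = k ≫ m := by
      refine hν.hom_ext (by rw [Category.assoc, Category.assoc, hmM, hkM]) ?_
      rw [← hk, key', key] at hφ
      refine HomEl.ext' fun y T w c e => ?_
      have e' : w ≫ b ≫ B.toObj x = c ≫ (I.homFrom x).toBase y := by
        rw [← e, Category.assoc, ht₁]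
      exact (congrArg (fun ψ : HomEl (I.homFrom x) _ (b ≫ B.toObj x) (b ≫ B.toBase x) =>
        ψ.el y w c e') hφ).symm
    refine ⟨pullback.lift b k hbk, pullback.lift_fst _ _ _, ?_⟩
    rw [HomEl.pre_pre, ← hk]
    exact HomEl.pre_congr _ (pullback.lift_snd _ _ _) _ _
  · apply pullback.hom_ext h
    refine hμ.hom_ext ?_ ?_
    · rw [Category.assoc, Category.assoc, ← hmM, ← Category.assoc (pullback.snd t m),
        ← pullback.condition, Category.assoc, ← Category.assoc k, h, Category.assoc]
    · rw [HomEl.pre_pre, HomEl.pre_pre] at hk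
      refine HomEl.ext' fun y T w c e => ?_
      have e' : w ≫ k ≫ pullback.fst t m ≫ B.toObj x = c ≫ (I.homFrom x).toBase y := by
        rw [← e, e₁]; simp
      exact congrArg (fun ψ : HomEl (I.homFrom x) _ (k ≫ pullback.fst t m ≫ B.toObj x)
        (k ≫ pullback.fst t m ≫ B.toBase x) => ψ.el y w c e') hk

variable {A B : Diagram I X} (f : A ⟶ B)

/-- A map is a Reedy acyclic fibration if and only if it is a Reedy fibration and a levelwise weak
equivalence. -/
theorem injAt_cofibrations_iff : (∀ x, InjAt (cofibrations C) f x) ↔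
    (∀ x, InjAt (trivialCofibrations C) f x) ∧ IsLevelwise (weakEquivalences C) f := by
  constructor
  · intro H
    refine ⟨fun x Z W i hi => H x i hi.1, fun x => ?_⟩
    obtain ⟨R⟩ := nonempty_relMatching hI (restrictMap f {y | I.rel y x})
    obtain ⟨ρ, h, hρ⟩ := R.exists_map
    -- The map `f.app x` is the relative matching map followed by the projection to `B_x`, and both
    -- are acyclic fibrations.
    have h₁ := R.trivialFibrations_hom fun y _ => H y
    have h₂ := (R.injAt_iff h hρ (cofibrations C)).1 (H x)
    rw [← trivialFibrations_eq_rlp] at h₂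
    rw [← h]
    exact ((trivialFibrations C).comp_mem _ _ h₂ h₁).2
  · rintro ⟨H, hW⟩ x
    induction x using I.rel_wf.induction with
    | _ x ih =>
      obtain ⟨R⟩ := nonempty_relMatching hI (restrictMap f {y | I.rel y x})
      obtain ⟨ρ, h, hρ⟩ := R.exists_map
      -- By induction the projection is acyclic. As `f.app x` is a weak equivalence, so is the
      -- relative matching map by two-out-of-three, and it is already a fibration.
      have h₁ := R.trivialFibrations_hom ih
      have h₂ := (R.injAt_iff h hρ _).1 (H x)
      rw [← fibrations_eq_rlp] at h₂
      rw [R.injAt_iff h hρ, ← trivialFibrations_eq_rlp]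
      refine ⟨h₂, (weakEquivalences C).of_postcomp ρ R.hom h₁.2 ?_⟩
      rw [h]
      exact hW x

end ModelCategory

end Diagram

end InternalInverseCategory

/-! ### Factorizations by well-founded recursion. -/

namespace InternalInverseCategory

namespace Diagram

attribute [local simp] pullback.lift_fst pullback.lift_fst_assoc pullback.lift_snd
  pullback.lift_snd_assoc

section

variable {C : Type u} [Category.{v} C] [HasPullbacks C] {I : InternalInverseCategory.{w} C}
  {X : C} {A B : Diagram I X}

/-- The part at `x` of a factorization of `f`; the targets of the actions are recorded as part of
the data. -/
structure FactorStage (f : A ⟶ B) (x : I.Ob) where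
  obj : C
  left : A.obj x ⟶ obj
  right : obj ⟶ B.obj x
  fac : left ≫ right = f.app x
  -- The target of an action should be the stage at `y`, but the type of choices at `x` may not
  -- depend on earlier choices. The target is therefore a free object here, and `IsAct` later forces
  -- it to be the right one.
  act : ∀ (y : I.Ob) (h : I.rel y x), Σ E : C, (pullback (right ≫ B.toObj x) (I.src h) ⟶ E)

namespace FactorStage

variable {f : A ⟶ B} {x : I.Ob}

/-- The maps `m` are the actions recorded by the stage `a`, and they are compatible with the
stages `s` below. -/
structure IsAct (a : FactorStage f x) (s : ∀ y, I.rel y x → FactorStage f y)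
    (m : ∀ y (h : I.rel y x), pullback (a.right ≫ B.toObj x) (I.src h) ⟶ (s y h).obj) :
    Prop where
  act_eq : ∀ y (h : I.rel y x), a.act y h = ⟨_, m y h⟩
  act_right : ∀ y (h : I.rel y x) {T : C} (u : T ⟶ a.obj) (b : T ⟶ I.hom h)
    (e : u ≫ a.right ≫ B.toObj x = b ≫ I.src h),
    (pullback.lift u b e ≫ m y h) ≫ (s y h).right =
      B.actEl h (u ≫ a.right) b (by rw [Category.assoc, e])
  act_left : ∀ y (h : I.rel y x) {T : C} (u : T ⟶ A.obj x) (b : T ⟶ I.hom h)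
    (e : u ≫ A.toObj x = b ≫ I.src h) (e' : (u ≫ a.left) ≫ a.right ≫ B.toObj x = b ≫ I.src h),
    pullback.lift (u ≫ a.left) b e' ≫ m y h = A.actEl h u b e ≫ (s y h).left
  assoc : ∀ y z (h : I.rel y x) (k : I.rel z y)
    (m' : pullback ((s y h).right ≫ B.toObj y) (I.src k) ⟶ (s z (I.rel_trans k h)).obj),
    (s y h).act z k = ⟨_, m'⟩ → ∀ {T : C} (u : T ⟶ a.obj) (b : T ⟶ I.hom h) (c : T ⟶ I.hom k)
      (e : u ≫ a.right ≫ B.toObj x = b ≫ I.src h) (hbc : b ≫ I.tgt h = c ≫ I.src k)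
      (e₁ : (pullback.lift u b e ≫ m y h) ≫ (s y h).right ≫ B.toObj y = c ≫ I.src k)
      (e₂ : u ≫ a.right ≫ B.toObj x = I.compEl h k b c hbc ≫ I.src _),
      pullback.lift (pullback.lift u b e ≫ m y h) c e₁ ≫ m' =
        pullback.lift u (I.compEl h k b c hbc) e₂ ≫ m z (I.rel_trans k h)

/-- A stage records its actions, so they are determined by it. Existential and universal
quantification over systems of actions therefore agree, as `Good` requires. -/
lemma IsAct.ext {a : FactorStage f x} {s : ∀ y, I.rel y x → FactorStage f y}
    {m m' : ∀ y (h : I.rel y x), pullback (a.right ≫ B.toObj x) (I.src h) ⟶ (s y h).obj}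
    (hm : a.IsAct s m) (hm' : a.IsAct s m') : m = m' := by
  funext y h
  have := (hm.act_eq y h).symm.trans (hm'.act_eq y h)
  exact eq_of_heq (Sigma.mk.inj this).2

/-- The diagram with given stages and actions. -/
def diagram (s : ∀ x, FactorStage f x)
    (m : ∀ x y (h : I.rel y x), pullback ((s x).right ≫ B.toObj x) (I.src h) ⟶ (s y).obj)
    (hm : ∀ x, (s x).IsAct (fun y _ => s y) (m x)) : Diagram I X where
  obj x := (s x).obj
  toBase x := (s x).right ≫ B.toBase x
  toObj x := (s x).right ≫ B.toObj x
  act h := m _ _ h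
  act_base {x y} h := by
    have := (hm x).act_right y h _ _ pullback.condition
    rw [pullback.lift_fst_snd, Category.id_comp] at this
    rw [← Category.assoc, this, actEl_toBase, Category.assoc]
  act_obj {x y} h := by
    have := (hm x).act_right y h _ _ pullback.condition
    rw [pullback.lift_fst_snd, Category.id_comp] at this
    rw [← Category.assoc, this, actEl_toObj]
  assoc {x y z} h k T a b c hab hbc :=
    (hm x).assoc y z h k (m y z k) ((hm y).act_eq z k) a b c hab hbc _ _

section

variable (s : ∀ x, FactorStage f x)
    (m : ∀ x y (h : I.rel y x), pullback ((s x).right ≫ B.toObj x) (I.src h) ⟶ (s y).obj)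
    (hm : ∀ x, (s x).IsAct (fun y _ => s y) (m x))

/-- The second map of the factorization with given stages. -/
def toRight : diagram s m hm ⟶ B :=
  Hom.ofElements (fun x => (s x).right) (fun _ => rfl) (fun _ => rfl)
    (fun h _ a b hab => (hm _).act_right _ h a b hab)

/-- The first map of the factorization with given stages. -/
def toLeft : A ⟶ diagram s m hm :=
  Hom.ofElements (fun x => (s x).left)
    (fun x => (Category.assoc _ _ _).symm.trans
      ((congrArg (· ≫ _) (s x).fac).trans (f.app_base x)))
    (fun x => (Category.assoc _ _ _).symm.trans
      ((congrArg (· ≫ _) (s x).fac).trans (f.app_obj x)))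
    (fun h _ a b hab => ((hm _).act_left _ h a b hab _).symm)

lemma toLeft_toRight : toLeft s m hm ≫ toRight s m hm = f := hom_ext fun x => (s x).fac

end

/-- A stage at an object of a full subcategory. -/
def restrict {S : Set I.Ob} (y : (I.full S).Ob) (a : FactorStage f y.1) :
    FactorStage (restrictMap f S) y where
  obj := a.obj
  left := a.left
  right := a.right
  fac := a.fac
  act z h := a.act z.1 h

/-- The stages below `x`. -/
abbrev below (s : ∀ y, I.rel y x → FactorStage f y) (y : (I.below x).Ob) :
    FactorStage (restrictMap f {y | I.rel y x}) y :=
  (s y.1 y.2).restrict y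

lemma IsAct.below {s : ∀ y, I.rel y x → FactorStage f y} {y : (I.below x).Ob}
    {m : ∀ z (k : I.rel z y.1), pullback ((s y.1 y.2).right ≫ B.toObj y.1) (I.src k) ⟶
      (s z (I.rel_trans k y.2)).obj}
    (hm : (s y.1 y.2).IsAct (fun z k => s z (I.rel_trans k y.2)) m) :
    (FactorStage.below s y).IsAct (fun z _ => FactorStage.below s z) (fun z k => m z.1 k) where
  act_eq z k := hm.act_eq z.1 k
  act_right z k := hm.act_right z.1 k
  act_left z k := hm.act_left z.1 k
  assoc z t k l := hm.assoc z.1 t.1 k l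

/-- The stage `a` is suitable for a factorization as a `Q`-map followed by a map that has the
extension property for `Q`. -/
def Good (Q : MorphismProperty C) (s : ∀ y, I.rel y x → FactorStage f y) (a : FactorStage f x) :
    Prop :=
  Q a.left ∧ ∃ m, a.IsAct s m ∧
    -- The extension property needs the diagram formed by the stages below `x`, whose actions are
    -- not part of `s`. Quantifying over all systems of actions is harmless, since there is at most
    -- one.
    ∀ m' (hm' : ∀ y : (I.below x).Ob,
      (below s y).IsAct (fun z _ => below s z) (m' y)),
      ∀ ⦃Z W : C⦄ (j : Z ⟶ W), Q j → ∀ (u : Z ⟶ a.obj) (b : W ⟶ B.obj x)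
        (_ : u ≫ a.right = j ≫ b)
        (φ : HomEl (I.homFrom x) (diagram (below s) m' hm') (b ≫ B.toObj x) (b ≫ B.toBase x)),
        (∀ (y : I.Ob) (h : I.rel y x) {T : C} (w : T ⟶ Z) (c : T ⟶ I.hom h)
          (e : (w ≫ u) ≫ a.right ≫ B.toObj x = c ≫ I.src h)
          (e' : (w ≫ j) ≫ b ≫ B.toObj x = c ≫ I.src h),
          φ.el (⟨y, h⟩ : {y // I.rel y x}) (w ≫ j) c e' = pullback.lift (w ≫ u) c e ≫ m y h) →
        φ.map (toRight (below s) m' hm') = B.ofAct x b rfl rfl →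
        ∃ l : W ⟶ a.obj, j ≫ l = u ∧ l ≫ a.right = b ∧
          ∀ (y : I.Ob) (h : I.rel y x) {T : C} (w : T ⟶ W) (c : T ⟶ I.hom h)
            (e : (w ≫ l) ≫ a.right ≫ B.toObj x = c ≫ I.src h)
            (e' : w ≫ b ≫ B.toObj x = c ≫ I.src h),
            pullback.lift (w ≫ l) c e ≫ m y h = φ.el (⟨y, h⟩ : {y // I.rel y x}) w c e'

end FactorStage

end

section ModelCategory

variable {C : Type u} [Category.{v} C] [ModelCategory C] [IsTypeTheoreticModelCategory.{w} C]
  {I : InternalInverseCategory.{w} C} (hI : I.IsFibrant) {X : C} {A B : Diagram I X}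

include hI

lemma FactorStage.exists_good (f : A ⟶ B) (Q : MorphismProperty C) [Q.HasFactorization Q.rlp]
    {x : I.Ob} (s : ∀ y, I.rel y x → FactorStage f y)
    (hs : ∀ y (h : I.rel y x), (s y h).Good Q (fun z k => s z (I.rel_trans k h))) :
    ∃ a : FactorStage f x, a.Good Q s := by
  unfold FactorStage.Good at hs
  choose hQ m hm hext using hs
  have hm₀ : ∀ y : (I.below x).Ob, (below s y).IsAct (fun z _ => below s z)
    (fun z k => m y.1 y.2 z.1 k) := fun y => IsAct.below (hm y.1 y.2)
  set M : ∀ (y z : (I.below x).Ob) (k : (I.below x).rel z y),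
    pullback ((below s y).right ≫ (B.restrict {y | I.rel y x}).toObj y) ((I.below x).src k) ⟶
      (below s z).obj := fun y z k => m y.1 y.2 z.1 k with hM
  -- The stages below `x` form the middle diagram `E` of a factorization there, and `R` is `B_x
  -- ×_{M_x B} M_x E`.
  obtain ⟨R⟩ := nonempty_relMatching hI (toRight (below s) M hm₀)
  let φ₀ : HomEl (I.homFrom x) (diagram (below s) M hm₀) (f.app x ≫ B.toObj x)
      (f.app x ≫ B.toBase x) := (A.ofAct x (𝟙 _) (by rw [Category.id_comp, f.app_obj])
      (by rw [Category.id_comp, f.app_base])).map (toLeft (below s) M hm₀)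
  obtain ⟨ρ₀, hρ₀, hρ₀'⟩ := R.exists_lift (f.app x) φ₀ (HomEl.ext' fun y T w c e => by
    have e' : w ≫ A.toObj x = c ≫ I.src y.2 := by rw [← f.app_obj]; exact e
    refine (Category.assoc _ _ _).trans ?_
    refine (congrArg (_ ≫ ·) ((s y.1 y.2).fac)).trans ?_
    refine (f.actEl_app y.2 (w ≫ 𝟙 _) c (by rw [Category.comp_id]; exact e')).trans ?_
    exact B.actEl_congr _ (by rw [Category.comp_id]) rfl _ _)
  -- The new stage is the middle object of a factorization of `A_x ⟶ R.obj`: its first map is in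
  -- `Q`, and its second becomes the relative matching map at `x`.
  obtain ⟨F⟩ := MorphismProperty.HasFactorization.nonempty_mapFactorizationData
    (W₁ := Q) (W₂ := Q.rlp) ρ₀
  -- The actions out of the new stage are the universal operations of `R`, restricted along `F.p`.
  let act (y : I.Ob) (h : I.rel y x) :
      pullback ((F.p ≫ R.hom) ≫ B.toObj x) (I.src h) ⟶ (s y h).obj :=
    R.el.el (⟨y, h⟩ : {y // I.rel y x}) (pullback.fst _ _ ≫ F.p) (pullback.snd _ _)
      (by
        have := pullback.condition (f := (F.p ≫ R.hom) ≫ B.toObj x) (g := I.src h)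
        simp only [Category.assoc] at this ⊢
        exact this)
  have hact (y : I.Ob) (h : I.rel y x) {T : C} (u : T ⟶ F.Z) (b : T ⟶ I.hom h)
      (e : u ≫ (F.p ≫ R.hom) ≫ B.toObj x = b ≫ I.src h)
      (e' : (u ≫ F.p) ≫ R.hom ≫ B.toObj x = b ≫ I.src h) :
      pullback.lift u b e ≫ act y h = R.el.el (⟨y, h⟩ : {y // I.rel y x}) (u ≫ F.p) b e' := by
    refine (R.el.comp_el ..).trans (R.el.el_congr ?_ ?_ _ _)
    · simp
    · exact pullback.lift_snd _ _ _
  have hel (y : I.Ob) (h : I.rel y x) {T : C} (v : T ⟶ R.obj) (b : T ⟶ I.hom h)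
      (e : v ≫ R.hom ≫ B.toObj x = b ≫ I.src h) :
      R.el.el (⟨y, h⟩ : {y // I.rel y x}) v b e ≫ (s y h).right =
        B.actEl h (v ≫ R.hom) b (by rw [Category.assoc, e]) :=
    congrArg (fun ψ : HomEl (I.homFrom x) (B.restrict _) (R.hom ≫ B.toObj x)
      (R.hom ≫ B.toBase x) => ψ.el (⟨y, h⟩ : {y // I.rel y x}) v b e) R.el_map
  let a : FactorStage f x :=
    { obj := F.Z
      left := F.i
      right := F.p ≫ R.hom
      fac := by rw [← Category.assoc, F.fac, hρ₀]
      act := fun y h => ⟨_, act y h⟩ }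
  have ha : a.IsAct s act :=
    { act_eq := fun y h => rfl
      act_right := fun y h T u b e => by
        have e' : (u ≫ F.p) ≫ R.hom ≫ B.toObj x = b ≫ I.src h := by rw [← e]; simp [a]
        refine (congrArg (· ≫ (s y h).right) (hact y h u b e e')).trans ?_
        exact (hel y h (u ≫ F.p) b e').trans (B.actEl_congr _ (Category.assoc _ _ _) rfl _ _)
      act_left := fun y h T u b e e' => by
        have e₂ : ((u ≫ F.i) ≫ F.p) ≫ R.hom ≫ B.toObj x = b ≫ I.src h := by
          rw [← e']; simp [a]
        have e₃ : u ≫ f.app x ≫ B.toObj x = b ≫ I.src h := by rw [f.app_obj, e]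
        refine (hact y h (u ≫ F.i) b e' e₂).trans ?_
        refine Eq.trans ?_ ((congrArg (fun ψ : HomEl (I.homFrom x) _ (f.app x ≫ B.toObj x)
          (f.app x ≫ B.toBase x) => ψ.el (⟨y, h⟩ : {y // I.rel y x}) u b e₃) hρ₀').trans ?_)
        · exact R.el.el_congr (by rw [Category.assoc, F.fac]) rfl _ _
        · exact congrArg (· ≫ _) (A.actEl_congr h (Category.comp_id _) rfl _ _)
      assoc := fun y z h k m' hm' T u b c e hbc e₁ e₂ => by
        have := (hm y h).act_eq z k
        -- Both are the action recorded by the stage at `y`.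
        obtain rfl : m' = m y h z k := eq_of_heq (Sigma.mk.inj (hm'.symm.trans this)).2
        have e₃ : (u ≫ F.p) ≫ R.hom ≫ B.toObj x = b ≫ I.src h := by rw [← e]; simp [a]
        have e₄ : (u ≫ F.p) ≫ R.hom ≫ B.toObj x = I.compEl h k b c hbc ≫ I.src _ := by
          rw [← e₂]; simp [a]
        refine Eq.trans ?_ (Eq.trans (R.el.actEl_el (y := (⟨y, h⟩ : {y // I.rel y x}))
          (z := (⟨z, I.rel_trans k h⟩ : {y // I.rel y x})) k (u ≫ F.p) b e₃ c hbc) ?_)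
        · exact (diagram (below s) M hm₀).actEl_congr (x := (⟨y, h⟩ : {y // I.rel y x}))
            (y := (⟨z, I.rel_trans k h⟩ : {y // I.rel y x})) k (hact y h u b e e₃) rfl _ _
        · exact (hact z _ u _ e₂ e₄).symm }
  refine ⟨a, F.hi, act, ha, fun m' hm' Z W j hj u b hab φ h₁ h₂ => ?_⟩
  -- Any admissible system of actions is the one from which `R` was built, so the extension problem
  -- is a lifting problem against `F.p`.
  obtain rfl : m' = M := funext fun y => (hm' y).ext (hm₀ y)
  have := F.hp j hj
  obtain ⟨l, e₁, e₂, e₃⟩ := R.exists_of_rlp F.p j u b hab φ h₂ (HomEl.ext' fun y T w c e => by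
    have e' : (w ≫ j) ≫ b ≫ B.toObj x = c ≫ I.src y.2 := by rw [Category.assoc]; exact e
    have e'' : (w ≫ u) ≫ (F.p ≫ R.hom) ≫ B.toObj x = c ≫ I.src y.2 := by
      have := congrArg (fun t => w ≫ t ≫ B.toObj x) hab
      rw [← e']
      simpa [a] using this
    refine (h₁ y.1 y.2 w c e'' e').trans ?_
    refine (hact y.1 y.2 (w ≫ u) c e'' (by refine Eq.trans ?_ e''; simp)).trans ?_
    exact R.el.el_congr (Category.assoc _ _ _) rfl _ _)
  refine ⟨l, e₁, e₂, fun y h T w c e e' => ?_⟩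
  refine (hact y h (w ≫ l) c e (by rw [← e]; simp [a])).trans ?_
  refine Eq.trans ?_ (congrArg (fun ψ : HomEl (I.homFrom x) _ (b ≫ B.toObj x)
    (b ≫ B.toBase x) => ψ.el (⟨y, h⟩ : {y // I.rel y x}) w c e') e₃)
  exact R.el.el_congr (Category.assoc _ _ _) rfl _ _

theorem exists_factorization (f : A ⟶ B) (Q : MorphismProperty C) [Q.HasFactorization Q.rlp] :
    ∃ (D : Diagram I X) (i : A ⟶ D) (p : D ⟶ B), IsLevelwise Q i ∧ (∀ x, InjAt Q p x) ∧
      i ≫ p = f := by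
  obtain ⟨s, hs⟩ := exists_wellFounded_choice I.rel_wf I.rel_trans
    (fun x s (a : FactorStage f x) => a.Good Q s)
    (fun x s hs => FactorStage.exists_good hI f Q s hs)
  unfold FactorStage.Good at hs
  choose hQ m hm hext using hs
  refine ⟨_, FactorStage.toLeft s m hm, FactorStage.toRight s m hm, hQ, fun x => ?_,
    FactorStage.toLeft_toRight s m hm⟩
  intro Z W j hj u b hab φ h₁ h₂
  obtain ⟨l, e₁, e₂, e₃⟩ := hext x (fun y z k => m y.1 z.1 k) (fun y => (hm y.1).below) j hj u b
    hab φ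
    (fun y h T w c e e' => congrArg (fun ψ : HomEl (I.homFrom x)
      ((FactorStage.diagram s m hm).restrict _) (j ≫ b ≫ B.toObj x) (j ≫ b ≫ B.toBase x) =>
        ψ.el (⟨y, h⟩ : {y // I.rel y x}) w c (by rw [← Category.assoc]; exact e')) h₁) h₂
  refine ⟨l, e₁, e₂, HomEl.ext' fun y T w c e => ?_⟩
  exact e₃ y.1 y.2 w c _ _

end ModelCategory

end Diagram

end InternalInverseCategory

/-! ### Limits of diagrams. -/

namespace InternalInverseCategory

namespace Diagram

attribute [local simp] pullback.lift_fst pullback.lift_fst_assoc pullback.lift_snd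
  pullback.lift_snd_assoc prod.lift_fst prod.lift_fst_assoc prod.lift_snd prod.lift_snd_assoc

section Limits

variable {C : Type u} [Category.{v} C] [HasPullbacks C]
  {I : InternalInverseCategory.{w} C} {X : C} {J : Type w} [Category.{w} J]

/-- A limit over `I(x) × X` of the values at `x` of a diagram of `I`-diagrams. -/
structure LevelLimit (K : J ⥤ Diagram I X) (x : I.Ob) where
  obj : C
  toObj : obj ⟶ I.obj x
  toBase : obj ⟶ X
  π : ∀ j, obj ⟶ (K.obj j).obj x
  π_toObj : ∀ j, π j ≫ (K.obj j).toObj x = toObj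
  π_toBase : ∀ j, π j ≫ (K.obj j).toBase x = toBase
  π_app : ∀ {j j' : J} (u : j ⟶ j'), π j ≫ (K.map u).app x = π j'
  lift : ∀ {T : C} (p : T ⟶ I.obj x) (q : T ⟶ X) (t : ∀ j, T ⟶ (K.obj j).obj x)
    (_ : ∀ j, t j ≫ (K.obj j).toObj x = p) (_ : ∀ j, t j ≫ (K.obj j).toBase x = q)
    (_ : ∀ (j j' : J) (u : j ⟶ j'), t j ≫ (K.map u).app x = t j'), T ⟶ obj
  lift_toObj : ∀ {T : C} (p : T ⟶ I.obj x) (q : T ⟶ X) (t : ∀ j, T ⟶ (K.obj j).obj x)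
    (h₁ : ∀ j, t j ≫ (K.obj j).toObj x = p) (h₂ : ∀ j, t j ≫ (K.obj j).toBase x = q)
    (h₃ : ∀ (j j' : J) (u : j ⟶ j'), t j ≫ (K.map u).app x = t j'),
    lift p q t h₁ h₂ h₃ ≫ toObj = p
  lift_toBase : ∀ {T : C} (p : T ⟶ I.obj x) (q : T ⟶ X) (t : ∀ j, T ⟶ (K.obj j).obj x)
    (h₁ : ∀ j, t j ≫ (K.obj j).toObj x = p) (h₂ : ∀ j, t j ≫ (K.obj j).toBase x = q)
    (h₃ : ∀ (j j' : J) (u : j ⟶ j'), t j ≫ (K.map u).app x = t j'),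
    lift p q t h₁ h₂ h₃ ≫ toBase = q
  lift_π : ∀ {T : C} (p : T ⟶ I.obj x) (q : T ⟶ X) (t : ∀ j, T ⟶ (K.obj j).obj x)
    (h₁ : ∀ j, t j ≫ (K.obj j).toObj x = p) (h₂ : ∀ j, t j ≫ (K.obj j).toBase x = q)
    (h₃ : ∀ (j j' : J) (u : j ⟶ j'), t j ≫ (K.map u).app x = t j') (j : J),
    lift p q t h₁ h₂ h₃ ≫ π j = t j
  hom_ext : ∀ {T : C} {l l' : T ⟶ obj}, l ≫ toObj = l' ≫ toObj → l ≫ toBase = l' ≫ toBase →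
    (∀ j, l ≫ π j = l' ≫ π j) → l = l'

/-- The values at `x`, as a functor to `C/(I(x) × X)`. -/
def overFunctor [HasBinaryProducts C] (x : I.Ob) : Diagram I X ⥤ Over (I.obj x ⨯ X) where
  obj A := A.overObj x
  map f := overMap f x
  map_id _ := rfl
  map_comp _ _ := rfl

/-- The limit is taken in the slice over `I(x) × X`: for an empty or disconnected shape, a limit in
`C` would not carry the required structure maps. -/
lemma nonempty_levelLimit [HasBinaryProducts C] [HasLimitsOfSize.{w, w} C]
    (K : J ⥤ Diagram I X) (x : I.Ob) : Nonempty (LevelLimit K x) := by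
  let F := K ⋙ overFunctor x
  let L := limit F
  have hL (j : J) : (limit.π F j).left ≫ prod.lift ((K.obj j).toObj x) ((K.obj j).toBase x) =
    L.hom := Over.w (limit.π F j)
  let c {T : C} (p : T ⟶ I.obj x) (q : T ⟶ X) (t : ∀ j, T ⟶ (K.obj j).obj x)
      (h₁ : ∀ j, t j ≫ (K.obj j).toObj x = p) (h₂ : ∀ j, t j ≫ (K.obj j).toBase x = q)
      (h₃ : ∀ (j j' : J) (u : j ⟶ j'), t j ≫ (K.map u).app x = t j') : Cone F :=
    { pt := Over.mk (prod.lift p q)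
      π :=
        { app := fun j => Over.homMk (t j) (by
            apply Limits.prod.hom_ext <;> simp [F, overFunctor, overObj, h₁, h₂])
          naturality := fun j j' u => by
            apply Over.OverMorphism.ext
            exact (Category.id_comp _).trans (h₃ _ _ u).symm } }
  refine ⟨{
    obj := L.left
    toObj := L.hom ≫ prod.fst
    toBase := L.hom ≫ prod.snd
    π := fun j => (limit.π F j).left
    π_toObj := fun j => (Eq.trans (congrArg (_ ≫ ·) (prod.lift_fst _ _).symm)
      (Category.assoc _ _ _).symm).trans (congrArg (· ≫ prod.fst) (hL j))
    π_toBase := fun j => (Eq.trans (congrArg (_ ≫ ·) (prod.lift_snd _ _).symm)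
      (Category.assoc _ _ _).symm).trans (congrArg (· ≫ prod.snd) (hL j))
    π_app := fun u => congrArg Over.Hom.left (limit.w F u)
    lift := fun p q t h₁ h₂ h₃ => (limit.lift F (c p q t h₁ h₂ h₃)).left
    lift_toObj := fun p q t h₁ h₂ h₃ => by
      have := Over.w (limit.lift F (c p q t h₁ h₂ h₃))
      rw [← Category.assoc]
      exact (congrArg (· ≫ prod.fst) this).trans (prod.lift_fst _ _)
    lift_toBase := fun p q t h₁ h₂ h₃ => by
      have := Over.w (limit.lift F (c p q t h₁ h₂ h₃))
      rw [← Category.assoc]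
      exact (congrArg (· ≫ prod.snd) this).trans (prod.lift_snd _ _)
    lift_π := fun p q t h₁ h₂ h₃ j =>
      congrArg Over.Hom.left (limit.lift_π (c p q t h₁ h₂ h₃) j)
    hom_ext := fun {T l l'} h₁ h₂ h₃ => ?_ }⟩
  have e : l ≫ L.hom = l' ≫ L.hom := by
    apply Limits.prod.hom_ext <;> simpa
  have : (Over.homMk l rfl : Over.mk (l ≫ L.hom) ⟶ L) = Over.homMk l' e.symm :=
    limit.hom_ext fun j => Over.OverMorphism.ext (h₃ j)
  exact congrArg Over.Hom.left this

/-- The actions on levelwise limits. -/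
def levelLimitEl {K : J ⥤ Diagram I X} (L : ∀ x, LevelLimit K x) {x y : I.Ob}
    (h : I.rel y x) {T : C} (a : T ⟶ (L x).obj) (b : T ⟶ I.hom h)
    (hab : a ≫ (L x).toObj = b ≫ I.src h) : T ⟶ (L y).obj :=
  (L y).lift (b ≫ I.tgt h) (a ≫ (L x).toBase)
    (fun j => (K.obj j).actEl h (a ≫ (L x).π j) b (by rw [Category.assoc, (L x).π_toObj, hab]))
    (fun j => actEl_toObj ..)
    (fun j => by rw [actEl_toBase, Category.assoc, (L x).π_toBase])
    (fun j j' u => by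
      rw [Hom.actEl_app]
      exact (K.obj j').actEl_congr h (by rw [Category.assoc, (L x).π_app]) rfl _ _)

section

variable {K : J ⥤ Diagram I X} (L : ∀ x, LevelLimit K x) {x y : I.Ob}
    (h : I.rel y x) {T : C} (a : T ⟶ (L x).obj) (b : T ⟶ I.hom h)
    (hab : a ≫ (L x).toObj = b ≫ I.src h)

lemma levelLimitEl_toObj : levelLimitEl L h a b hab ≫ (L y).toObj = b ≫ I.tgt h :=
  (L y).lift_toObj ..

lemma levelLimitEl_toBase : levelLimitEl L h a b hab ≫ (L y).toBase = a ≫ (L x).toBase :=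
  (L y).lift_toBase ..

lemma levelLimitEl_π (j : J) : levelLimitEl L h a b hab ≫ (L y).π j =
    (K.obj j).actEl h (a ≫ (L x).π j) b (by rw [Category.assoc, (L x).π_toObj, hab]) :=
  (L y).lift_π ..

lemma comp_levelLimitEl {T' : C} (t : T' ⟶ T) : t ≫ levelLimitEl L h a b hab =
    levelLimitEl L h (t ≫ a) (t ≫ b) (by rw [Category.assoc, hab, Category.assoc]) := by
  apply (L y).hom_ext
  · rw [Category.assoc, levelLimitEl_toObj, levelLimitEl_toObj, Category.assoc]
  · rw [Category.assoc, levelLimitEl_toBase, levelLimitEl_toBase, Category.assoc]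
  · intro j
    rw [Category.assoc, levelLimitEl_π, levelLimitEl_π, comp_actEl]
    exact (K.obj j).actEl_congr h (Category.assoc _ _ _).symm rfl _ _

end

/-- The limit diagram, constructed from levelwise limits. -/
def limitDiagram (K : J ⥤ Diagram I X) (L : ∀ x, LevelLimit K x) : Diagram I X :=
  ofElements (fun x => (L x).obj) (fun x => (L x).toBase) (fun x => (L x).toObj)
    (levelLimitEl L) (fun h _ _ t a b hab => comp_levelLimitEl L h a b hab t)
    (levelLimitEl_toBase L) (levelLimitEl_toObj L)
    (fun {x y z} h k T a b c hab hbc => by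
      apply (L z).hom_ext
      · rw [levelLimitEl_toObj, levelLimitEl_toObj, compEl_tgt]
      · rw [levelLimitEl_toBase, levelLimitEl_toBase, levelLimitEl_toBase]
      · intro j
        refine (levelLimitEl_π ..).trans (Eq.trans ?_ (levelLimitEl_π ..).symm)
        refine Eq.trans ((K.obj j).actEl_congr k (levelLimitEl_π ..) rfl _ ?_)
          ((K.obj j).actEl_actEl ..)
        rw [actEl_toObj, hbc])

lemma limitDiagram_actEl (K : J ⥤ Diagram I X) (L : ∀ x, LevelLimit K x) {x y : I.Ob}
    (h : I.rel y x) {T : C} (a : T ⟶ (L x).obj) (b : T ⟶ I.hom h)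
    (hab : a ≫ (L x).toObj = b ≫ I.src h) :
    (limitDiagram K L).actEl h a b hab = levelLimitEl L h a b hab :=
  ofElements_actEl _ _ _ _ (fun h _ _ t a b hab => comp_levelLimitEl L h a b hab t) _ _ _ h a b hab

/-- The projections from the limit diagram. -/
def limitDiagramπ (K : J ⥤ Diagram I X) (L : ∀ x, LevelLimit K x) (j : J) :
    limitDiagram K L ⟶ K.obj j :=
  Hom.ofElements (fun x => (L x).π j) (fun x => (L x).π_toBase j) (fun x => (L x).π_toObj j)
    (fun {x y} h T a b hab => by
      refine (congrArg (· ≫ (L y).π j) (limitDiagram_actEl ..)).trans ?_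
      exact levelLimitEl_π ..)

section

variable {K : J ⥤ Diagram I X} (L : ∀ x, LevelLimit K x) (s : Cone K)

/-- The components of the map to the limit diagram induced by a cone. -/
def levelLimitLift (x : I.Ob) : s.pt.obj x ⟶ (L x).obj :=
  (L x).lift (s.pt.toObj x) (s.pt.toBase x) (fun j => (s.π.app j).app x)
    (fun j => (s.π.app j).app_obj x) (fun j => (s.π.app j).app_base x)
    (fun _ _ u => congrArg (fun g => Hom.app g x) (s.w u))

lemma levelLimitLift_toObj (x : I.Ob) : levelLimitLift L s x ≫ (L x).toObj = s.pt.toObj x :=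
  (L x).lift_toObj ..

lemma levelLimitLift_toBase (x : I.Ob) : levelLimitLift L s x ≫ (L x).toBase = s.pt.toBase x :=
  (L x).lift_toBase ..

lemma levelLimitLift_π (x : I.Ob) (j : J) :
    levelLimitLift L s x ≫ (L x).π j = (s.π.app j).app x :=
  (L x).lift_π ..

lemma actEl_levelLimitLift {x y : I.Ob} (h : I.rel y x) {T : C} (a : T ⟶ s.pt.obj x)
    (b : T ⟶ I.hom h) (hab : a ≫ s.pt.toObj x = b ≫ I.src h) :
    s.pt.actEl h a b hab ≫ levelLimitLift L s y =
      levelLimitEl L h (a ≫ levelLimitLift L s x) b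
        (by rw [Category.assoc, levelLimitLift_toObj, hab]) := by
  apply (L y).hom_ext
  · rw [levelLimitEl_toObj, Category.assoc, levelLimitLift_toObj, actEl_toObj]
  · rw [levelLimitEl_toBase, Category.assoc, levelLimitLift_toBase, actEl_toBase, Category.assoc,
      levelLimitLift_toBase]
  · intro j
    rw [levelLimitEl_π, Category.assoc, levelLimitLift_π]
    exact ((s.π.app j).actEl_app h a b hab).trans
      ((K.obj j).actEl_congr h (by rw [Category.assoc, levelLimitLift_π]) rfl _ _)

end

theorem hasLimitsOfSize [HasBinaryProducts C] [HasLimitsOfSize.{w, w} C] :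
    HasLimitsOfSize.{w, w} (Diagram I X) := by
  refine ⟨fun J _ => ⟨fun K => ?_⟩⟩
  let L x := (nonempty_levelLimit K x).some
  refine ⟨⟨⟨{ pt := limitDiagram K L
              π := { app := limitDiagramπ K L
                     naturality := fun j j' u => ?_ } },
    { lift := fun s => Hom.ofElements (levelLimitLift L s) (levelLimitLift_toBase L s)
        (levelLimitLift_toObj L s) (fun h T a b hab =>
          (actEl_levelLimitLift L s h a b hab).trans (limitDiagram_actEl K L h _ b _).symm)
      fac := fun s j => hom_ext fun x => levelLimitLift_π L s x j
      uniq := fun s m hm => hom_ext fun x => (L x).hom_ext ?_ ?_ fun j => ?_ }⟩⟩⟩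
  · exact hom_ext fun x => (Category.id_comp _).trans ((L x).π_app u).symm
  · exact (m.app_obj x).trans (levelLimitLift_toObj L s x).symm
  · exact (m.app_base x).trans (levelLimitLift_toBase L s x).symm
  · exact (congrArg (fun g => Hom.app g x) (hm j)).trans (levelLimitLift_π L s x j).symm

end Limits

/-! ### Descent from pullbacks of colimits along fibrations. -/

section Colimits

variable {C : Type u} [Category.{v} C] [ModelCategory C] [IsTypeTheoreticModelCategory.{w} C]

section

variable {J : Type w} [Category.{w} J] {F : J ⥤ C} {c : Cocone F} (hc : IsColimit c) {S Y : C}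
  (s : c.pt ⟶ S) (g : Y ⟶ S) [Fibration g]

include hc

/-- Pullback along the fibration `g` is a left adjoint, and so preserves colimits, as does
forgetting the base. Hence `pullback s g` is the colimit of the pullbacks of the `F.obj j`, and
compatible operations on these glue. -/
lemma exists_pullback_desc {E : C} (el : ∀ (j : J) {T : C} (a : T ⟶ F.obj j) (b : T ⟶ Y),
      a ≫ c.ι.app j ≫ s = b ≫ g → (T ⟶ E))
    (comp_el : ∀ (j : J) {T T' : C} (t : T' ⟶ T) (a : T ⟶ F.obj j) (b : T ⟶ Y)
      (e : a ≫ c.ι.app j ≫ s = b ≫ g), t ≫ el j a b e = el j (t ≫ a) (t ≫ b) (by simp [e]))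
    (el_map : ∀ {j j' : J} (u : j ⟶ j') {T : C} (a : T ⟶ F.obj j) (b : T ⟶ Y)
      (e : a ≫ c.ι.app j ≫ s = b ≫ g) (e' : (a ≫ F.map u) ≫ c.ι.app j' ≫ s = b ≫ g),
      el j' (a ≫ F.map u) b e' = el j a b e) :
    ∃ m : pullback s g ⟶ E, ∀ (j : J) {T : C} (a : T ⟶ F.obj j) (b : T ⟶ Y)
      (e : a ≫ c.ι.app j ≫ s = b ≫ g) (e' : (a ≫ c.ι.app j) ≫ s = b ≫ g),
      pullback.lift (a ≫ c.ι.app j) b e' ≫ m = el j a b e := by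
  have := IsTypeTheoreticModelCategory.pullback_isLeftAdjoint.{w} g
  have hP := isColimitOfPreserves (Over.pullback g ⋙ Over.forget Y)
    (Over.isColimitLiftCocone c s hc)
  have elc {j : J} {T : C} {a a' : T ⟶ F.obj j} {b b' : T ⟶ Y} (ha : a = a') (hb : b = b')
      (e : a ≫ c.ι.app j ≫ s = b ≫ g) (e' : a' ≫ c.ι.app j ≫ s = b' ≫ g) :
      el j a b e = el j a' b' e' := by
    subst ha hb; rfl
  let k : Cocone (Over.lift F (c.ι ≫ (Functor.const J).map s) ⋙
      Over.pullback g ⋙ Over.forget Y) :=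
    { pt := E
      ι :=
        { app := fun j => el j (pullback.fst (c.ι.app j ≫ s) g) (pullback.snd _ _)
            pullback.condition
          naturality := fun j j' u => by
            refine Eq.trans ?_ (Category.comp_id _).symm
            refine (comp_el j' _ _ _ _).trans ?_
            have e : (pullback.fst (c.ι.app j ≫ s) g ≫ F.map u) ≫ c.ι.app j' ≫ s =
                pullback.snd (c.ι.app j ≫ s) g ≫ g := by
              rw [← pullback.condition, Category.assoc, c.w_assoc]
            exact (elc (pullback.lift_fst _ _ _) (pullback.lift_snd _ _ _) _ e).trans
              (el_map u _ _ pullback.condition e) } }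
  refine ⟨hP.desc k, fun j T a b e e' => ?_⟩
  have h := congrArg (pullback.lift a b e ≫ ·) (hP.fac k j)
  refine Eq.trans ?_ (h.trans ((comp_el ..).trans
    (elc (pullback.lift_fst _ _ _) (pullback.lift_snd _ _ _) _ _)))
  refine Eq.trans (congrArg (· ≫ hP.desc k) ?_) (Category.assoc _ _ _)
  apply pullback.hom_ext
  · refine (pullback.lift_fst _ _ _).trans (Eq.symm ?_)
    refine (Category.assoc _ _ _).trans ?_
    refine (congrArg (_ ≫ ·) (pullback.lift_fst _ _ _)).trans ?_
    exact (Category.assoc _ _ _).symm.trans (congrArg (· ≫ _) (pullback.lift_fst _ _ _))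
  · refine (pullback.lift_snd _ _ _).trans (Eq.symm ?_)
    refine (Category.assoc _ _ _).trans ?_
    exact (congrArg (_ ≫ ·) (pullback.lift_snd _ _ _)).trans (pullback.lift_snd _ _ _)

lemma pullback_hom_ext {E : C} {m m' : pullback s g ⟶ E}
    (h : ∀ (j : J) {T : C} (a : T ⟶ F.obj j) (b : T ⟶ Y) (e : (a ≫ c.ι.app j) ≫ s = b ≫ g),
      pullback.lift (a ≫ c.ι.app j) b e ≫ m = pullback.lift (a ≫ c.ι.app j) b e ≫ m') :
    m = m' := by
  have := IsTypeTheoreticModelCategory.pullback_isLeftAdjoint.{w} g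
  have hP := isColimitOfPreserves (Over.pullback g ⋙ Over.forget Y)
    (Over.isColimitLiftCocone c s hc)
  refine hP.hom_ext fun j => ?_
  exact h j (pullback.fst (c.ι.app j ≫ s) g) (pullback.snd _ _)
    ((Category.assoc _ _ _).trans pullback.condition)

end

end Colimits

end Diagram

end InternalInverseCategory

/-! ### Colimits of diagrams, computed levelwise. -/

namespace InternalInverseCategory

namespace Diagram

attribute [local simp] pullback.lift_fst pullback.lift_fst_assoc pullback.lift_snd
  pullback.lift_snd_assoc

section

variable {C : Type u} [Category.{v} C] [HasPullbacks C]
  {I : InternalInverseCategory.{w} C} {X : C}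

/-- Evaluation of diagrams at `x`. -/
abbrev evaluation (x : I.Ob) : Diagram I X ⥤ C where
  obj A := A.obj x
  map f := f.app x

variable {J : Type w} [Category.{w} J] [HasColimitsOfSize.{w, w} C] (K : J ⥤ Diagram I X)

/-- The levelwise colimit. -/
abbrev colimitObj (x : I.Ob) : C := colimit (K ⋙ evaluation x)

/-- The structure map of the levelwise colimit to `I(x)`. -/
def colimitToObj (x : I.Ob) : colimitObj K x ⟶ I.obj x :=
  colimit.desc (K ⋙ evaluation x)
    { pt := I.obj x
      ι := { app := fun j => (K.obj j).toObj x
             naturality := fun _ _ u =>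
               ((K.map u).app_obj x).trans (Category.comp_id _).symm } }

/-- The structure map of the levelwise colimit to `X`. -/
def colimitToBase (x : I.Ob) : colimitObj K x ⟶ X :=
  colimit.desc (K ⋙ evaluation x)
    { pt := X
      ι := { app := fun j => (K.obj j).toBase x
             naturality := fun _ _ u =>
               ((K.map u).app_base x).trans (Category.comp_id _).symm } }

/-- The maps to the levelwise colimit. -/
def colimitι (x : I.Ob) (j : J) : (K.obj j).obj x ⟶ colimitObj K x :=
  colimit.ι (K ⋙ evaluation x) j

lemma colimitι_toObj (x : I.Ob) (j : J) :
    colimitι K x j ≫ colimitToObj K x = (K.obj j).toObj x := colimit.ι_desc _ _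

lemma colimitι_toBase (x : I.Ob) (j : J) :
    colimitι K x j ≫ colimitToBase K x = (K.obj j).toBase x := colimit.ι_desc _ _

lemma app_colimitι (x : I.Ob) {j j' : J} (u : j ⟶ j') :
    (K.map u).app x ≫ colimitι K x j' = colimitι K x j := colimit.w (K ⋙ evaluation x) u

variable {K} in
lemma colimitObj_hom_ext {x : I.Ob} {E : C} {f g : colimitObj K x ⟶ E}
    (h : ∀ j, colimitι K x j ≫ f = colimitι K x j ≫ g) : f = g := colimit.hom_ext h

end

section ModelCategory

variable {C : Type u} [Category.{v} C] [ModelCategory C] [IsTypeTheoreticModelCategory.{w} C]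
  {I : InternalInverseCategory.{w} C} (hI : I.IsFibrant) {X : C} {J : Type w} [Category.{w} J]
  [HasColimitsOfSize.{w, w} C] (K : J ⥤ Diagram I X)

-- The actions of the diagrams `K.obj j` glue, since the source map `I.src h` is a fibration and
-- pullback along it preserves the colimit at `x`.
include hI in
lemma exists_colimitAct {x y : I.Ob} (h : I.rel y x) :
    ∃ m : pullback (colimitToObj K x) (I.src h) ⟶ colimitObj K y,
      ∀ (j : J) {T : C} (a : T ⟶ (K.obj j).obj x) (b : T ⟶ I.hom h)
        (e : a ≫ (K.obj j).toObj x = b ≫ I.src h)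
        (e' : (a ≫ colimitι K x j) ≫ colimitToObj K x = b ≫ I.src h),
        pullback.lift (a ≫ colimitι K x j) b e' ≫ m =
          (K.obj j).actEl h a b e ≫ colimitι K y j := by
  have := hI.fibration_src x y h
  have hι (j : J) {T : C} {a : T ⟶ (K.obj j).obj x} {b : T ⟶ I.hom h}
      (e : a ≫ colimitι K x j ≫ colimitToObj K x = b ≫ I.src h) :
      a ≫ (K.obj j).toObj x = b ≫ I.src h := by rw [← e, colimitι_toObj]
  obtain ⟨m, hm⟩ := exists_pullback_desc.{w} (colimit.isColimit (K ⋙ evaluation x))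
    (colimitToObj K x) (I.src h)
    (fun j T a b e => (K.obj j).actEl h a b (hι j e) ≫ colimitι K y j)
    (fun j T T' t a b e => by rw [← Category.assoc, comp_actEl])
    (fun {j j'} u T a b e e' => by
      have := (K.map u).actEl_app h a b (hι j e)
      refine Eq.trans (congrArg (· ≫ colimitι K y j') this.symm) ?_
      rw [Category.assoc, app_colimitι])
  exact ⟨m, fun j T a b e e' => hm j a b ((Category.assoc _ _ _).symm.trans e') e'⟩

variable {K}
  (m : ∀ {x y : I.Ob} (h : I.rel y x),
    pullback (colimitToObj K x) (I.src h) ⟶ colimitObj K y)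
  (hm : ∀ {x y : I.Ob} (h : I.rel y x) (j : J) {T : C} (a : T ⟶ (K.obj j).obj x)
    (b : T ⟶ I.hom h) (e : a ≫ (K.obj j).toObj x = b ≫ I.src h)
    (e' : (a ≫ colimitι K x j) ≫ colimitToObj K x = b ≫ I.src h),
    pullback.lift (a ≫ colimitι K x j) b e' ≫ m h = (K.obj j).actEl h a b e ≫ colimitι K y j)

/-- Stated for an arbitrary fibration `g` over `I(x)`, because associativity is tested over the
object of composable pairs, not over a single `I(x,y)`. -/
lemma colimit_hom_ext {x : I.Ob} {Y : C} (g : Y ⟶ I.obj x) [Fibration g] {E : C}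
    {f f' : pullback (colimitToObj K x) g ⟶ E}
    (h : ∀ (j : J) {T : C} (a : T ⟶ (K.obj j).obj x) (b : T ⟶ Y)
      (_ : a ≫ (K.obj j).toObj x = b ≫ g)
      (e : (a ≫ colimitι K x j) ≫ colimitToObj K x = b ≫ g),
      pullback.lift (a ≫ colimitι K x j) b e ≫ f = pullback.lift (a ≫ colimitι K x j) b e ≫ f') :
    f = f' :=
  pullback_hom_ext.{w} (colimit.isColimit (K ⋙ evaluation x)) _ _ fun j T a b e =>
    h j a b (by rw [← e, Category.assoc]; exact congrArg (a ≫ ·) (colimitι_toObj K x j).symm) e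

include hI hm in
lemma colimitAct_toBase {x y : I.Ob} (h : I.rel y x) : m h ≫ colimitToBase K y =
    pullback.fst (colimitToObj K x) (I.src h) ≫ colimitToBase K x := by
  have := hI.fibration_src x y h
  refine colimit_hom_ext (I.src h) fun j T a b e e' => ?_
  rw [← Category.assoc, hm h j a b e e', Category.assoc, colimitι_toBase, actEl_toBase,
    pullback.lift_fst_assoc, Category.assoc, colimitι_toBase]

include hI hm in
lemma colimitAct_toObj {x y : I.Ob} (h : I.rel y x) : m h ≫ colimitToObj K y =
    pullback.snd (colimitToObj K x) (I.src h) ≫ I.tgt h := by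
  have := hI.fibration_src x y h
  refine colimit_hom_ext (I.src h) fun j T a b e e' => ?_
  rw [← Category.assoc, hm h j a b e e', Category.assoc, colimitι_toObj, actEl_toObj,
    pullback.lift_snd_assoc]

include hI hm in
lemma colimitAct_assoc {x y z : I.Ob} (h : I.rel y x) (k : I.rel z y) {T : C}
    (a : T ⟶ colimitObj K x) (b : T ⟶ I.hom h) (c : T ⟶ I.hom k)
    (hab : a ≫ colimitToObj K x = b ≫ I.src h) (hbc : b ≫ I.tgt h = c ≫ I.src k) :
    pullback.lift (pullback.lift a b hab ≫ m h) c
        (by rw [Category.assoc, colimitAct_toObj hI m hm, pullback.lift_snd_assoc, hbc]) ≫ m k =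
      pullback.lift a (pullback.lift b c hbc ≫ I.comp h k)
        (by rw [Category.assoc, I.comp_src, pullback.lift_fst_assoc, hab]) ≫
        m (I.rel_trans k h) := by
  have := hI.fibration_src x y h
  have := hI.fibration_src y z k
  -- The source map of composable pairs, a fibration as a base change of `I.src k` followed by
  -- `I.src h`. Associativity is proved for the generic triple over it, where it can be tested on
  -- the diagrams `K.obj j`.
  let g := pullback.fst (I.tgt h) (I.src k) ≫ I.src h
  let p := pullback.fst (colimitToObj K x) g
  let q := pullback.snd (colimitToObj K x) g
  have hp : p ≫ colimitToObj K x = (q ≫ pullback.fst _ _) ≫ I.src h := by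
    rw [Category.assoc]; exact pullback.condition
  have hq : (q ≫ pullback.fst (I.tgt h) (I.src k)) ≫ I.tgt h =
      (q ≫ pullback.snd _ _) ≫ I.src k := by
    rw [Category.assoc, pullback.condition, Category.assoc]
  have key : pullback.lift (pullback.lift p (q ≫ pullback.fst _ _) hp ≫ m h)
      (q ≫ pullback.snd _ _) (by
        rw [Category.assoc, colimitAct_toObj hI m hm, pullback.lift_snd_assoc, hq]) ≫ m k =
      pullback.lift p (q ≫ I.comp h k)
        (by rw [Category.assoc, I.comp_src]; exact pullback.condition) ≫
        m (I.rel_trans k h) := by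
    refine colimit_hom_ext g fun j T a b e e' => ?_
    have e₁ : a ≫ (K.obj j).toObj x = (b ≫ pullback.fst _ _) ≫ I.src h := by
      rw [e, Category.assoc]
    have e₁' : (a ≫ colimitι K x j) ≫ colimitToObj K x = (b ≫ pullback.fst _ _) ≫ I.src h := by
      rw [e', Category.assoc]
    have e₂ : (b ≫ pullback.fst (I.tgt h) (I.src k)) ≫ I.tgt h =
        (b ≫ pullback.snd _ _) ≫ I.src k := by
      rw [Category.assoc, pullback.condition, Category.assoc]
    have e₃ : (K.obj j).actEl h a (b ≫ pullback.fst _ _) e₁ ≫ (K.obj j).toObj y =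
      (b ≫ pullback.snd _ _) ≫ I.src k := by rw [actEl_toObj, e₂]
    have e₃' : ((K.obj j).actEl h a (b ≫ pullback.fst _ _) e₁ ≫ colimitι K y j) ≫
        colimitToObj K y = (b ≫ pullback.snd _ _) ≫ I.src k := by
      rw [Category.assoc, colimitι_toObj, e₃]
    have e₄ : a ≫ (K.obj j).toObj x = (b ≫ I.comp h k) ≫ I.src _ := by
      rw [e, Category.assoc, I.comp_src]
    have e₄' : (a ≫ colimitι K x j) ≫ colimitToObj K x = (b ≫ I.comp h k) ≫ I.src _ := by
      rw [Category.assoc, colimitι_toObj, e₄]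
    have h₁ := hm h j a _ e₁ e₁'
    have h₂ := hm k j _ _ e₃ e₃'
    have h₃ := hm (I.rel_trans k h) j a _ e₄ e₄'
    refine Eq.trans ?_ ((h₂.trans ?_).trans (h₃.symm.trans ?_))
    · rw [← Category.assoc]
      congr 1
      apply pullback.hom_ext
      · rw [Category.assoc, pullback.lift_fst, pullback.lift_fst, ← h₁, ← Category.assoc]
        congr 1
        apply pullback.hom_ext <;> simp [p, q]
      · simp [q]
    · rw [actEl_actEl _ h k a _ _ e₁ e₂]
      congr 1
      refine (K.obj j).actEl_congr _ rfl ?_ _ _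
      rw [compEl]
      congr 1
      apply pullback.hom_ext <;> simp
    · rw [← Category.assoc]
      congr 1
      apply pullback.hom_ext <;> simp [p, q]
  have ht : a ≫ colimitToObj K x = pullback.lift b c hbc ≫ g := by
    rw [hab, pullback.lift_fst_assoc]
  -- The arbitrary triple is obtained from the generic one by precomposition.
  have := congrArg (pullback.lift a (pullback.lift b c hbc) ht ≫ ·) key
  simp only [← Category.assoc] at this
  refine Eq.trans ?_ (this.trans ?_)
  · congr 1
    apply pullback.hom_ext
    · rw [pullback.lift_fst, Category.assoc, pullback.lift_fst, ← Category.assoc]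
      congr 1
      apply pullback.hom_ext <;> simp [p, q]
    · simp [q]
  · congr 1
    apply pullback.hom_ext <;> simp [p, q]

/-- The colimit diagram, with given actions. -/
def colimitDiagram : Diagram I X where
  obj := colimitObj K
  toBase := colimitToBase K
  toObj := colimitToObj K
  act h := m h
  act_base := colimitAct_toBase hI m hm
  act_obj := colimitAct_toObj hI m hm
  assoc := colimitAct_assoc hI m hm

/-- The map of diagrams out of the colimit diagram with given components. -/
def colimitDiagramDesc {D : Diagram I X} (φ : ∀ j, K.obj j ⟶ D)
    (f : ∀ x, colimitObj K x ⟶ D.obj x)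
    (hf : ∀ x j, colimitι K x j ≫ f x = (φ j).app x) : colimitDiagram hI m hm ⟶ D where
  app := f
  app_base x := colimitObj_hom_ext fun j => by
    refine (Category.assoc _ _ _).symm.trans ?_
    refine (congrArg (· ≫ D.toBase x) (hf x j)).trans ?_
    exact ((φ j).app_base x).trans (colimitι_toBase K x j).symm
  app_obj x := colimitObj_hom_ext fun j => by
    refine (Category.assoc _ _ _).symm.trans ?_
    refine (congrArg (· ≫ D.toObj x) (hf x j)).trans ?_
    exact ((φ j).app_obj x).trans (colimitι_toObj K x j).symm
  act_app {x y} h := by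
    have := hI.fibration_src x y h
    refine colimit_hom_ext (I.src h) fun j T a b e e' => ?_
    refine (Category.assoc _ _ _).symm.trans ?_
    refine (congrArg (· ≫ f y) (hm h j a b e e')).trans ?_
    rw [Category.assoc, hf, (φ j).actEl_app, actEl]
    refine Eq.trans ?_ (Category.assoc _ _ _)
    congr 1
    apply pullback.hom_ext
    · refine (pullback.lift_fst _ _ _).trans (Eq.symm ((Category.assoc _ _ _).trans ?_))
      refine (congrArg (_ ≫ ·) (pullback.lift_fst _ _ _)).trans ?_
      refine (Category.assoc _ _ _).symm.trans ?_
      refine (congrArg (· ≫ f x) (pullback.lift_fst _ _ _)).trans ?_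
      rw [Category.assoc, hf]
    · refine (pullback.lift_snd _ _ _).trans (Eq.symm ((Category.assoc _ _ _).trans ?_))
      exact (congrArg (_ ≫ ·) (pullback.lift_snd _ _ _)).trans (pullback.lift_snd _ _ _)

include hI in
theorem hasColimitsOfSize : HasColimitsOfSize.{w, w} (Diagram I X) := by
  refine ⟨fun J _ => ⟨fun K => ?_⟩⟩
  choose m hm using fun x y (h : I.rel y x) => exists_colimitAct hI K h
  have hm' {x y : I.Ob} (h : I.rel y x) := hm x y h
  let ι (j : J) : K.obj j ⟶ colimitDiagram hI (fun {x y} h => m x y h) hm' :=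
    Hom.ofElements (fun x => colimitι K x j) (fun x => colimitι_toBase K x j)
      (fun x => colimitι_toObj K x j) (fun h T a b hab => (hm' h j a b hab _).symm)
  let d (s : Cocone K) (x : I.Ob) : colimitObj K x ⟶ s.pt.obj x :=
    colimit.desc (K ⋙ evaluation x) ((evaluation x).mapCocone s)
  have hd (s : Cocone K) (x : I.Ob) (j : J) : colimitι K x j ≫ d s x = (s.ι.app j).app x :=
    colimit.ι_desc _ _
  refine ⟨⟨⟨{ pt := colimitDiagram hI (fun {x y} h => m x y h) hm'
              ι := { app := ι
                     naturality := fun j j' u => ?_ } },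
    { desc := fun s => colimitDiagramDesc hI _ hm' s.ι.app (d s) (hd s)
      fac := fun s j => hom_ext fun x => hd s x j
      uniq := fun s f hf => hom_ext fun x => colimitObj_hom_ext fun j => ?_ }⟩⟩⟩
  · exact hom_ext fun x => (app_colimitι K x u).trans (Category.comp_id _).symm
  · exact (congrArg (fun g => Hom.app g x) (hf j)).trans (hd s x j).symm

end ModelCategory

end Diagram

end InternalInverseCategory

/-! ### Retracts and the Reedy model structure. -/

namespace InternalInverseCategory

namespace Diagram

section

variable {C : Type u} [Category.{v} C] [HasPullbacks C] {I : InternalInverseCategory.{w} C}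
  {X : C} {A B A' B' : Diagram I X} {f : A ⟶ B} {g : A' ⟶ B'}

/-- `InjAt` is stable under retracts. -/
lemma InjAt.of_retract {i₁ : A ⟶ A'} {i₂ : B ⟶ B'} {r₁ : A' ⟶ A} {r₂ : B' ⟶ B}
    (hi : i₁ ≫ g = f ≫ i₂) (hr : r₁ ≫ f = g ≫ r₂) (hl : i₁ ≫ r₁ = 𝟙 A) (hr' : i₂ ≫ r₂ = 𝟙 B)
    {Q : MorphismProperty C} {x : I.Ob} (hg : InjAt Q g x) : InjAt Q f x := by
  intro Z W j hj a b hab φ h₁ h₂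
  have hab' : (a ≫ i₁.app x) ≫ g.app x = j ≫ b ≫ i₂.app x := by
    rw [Category.assoc, ← comp_app, hi, comp_app, ← Category.assoc, hab, Category.assoc]
  -- The lifting problem is carried to `g` by `i₁` and `i₂`, solved there, and its solution is
  -- brought back by `r₁`.
  obtain ⟨l, e₁, e₂, e₃⟩ := hg j hj (a ≫ i₁.app x) (b ≫ i₂.app x) hab'
    ((φ.map (restrictMap i₁ _)).pre (𝟙 W)
      (by rw [Category.id_comp, Category.assoc, i₂.app_obj])
      (by rw [Category.id_comp, Category.assoc, i₂.app_base]))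
    (HomEl.ext' fun y T w c e => by
      have e' : w ≫ j ≫ b ≫ B.toObj x = c ≫ I.src y.2 := by
        rw [← i₂.app_obj]
        simp only [Category.assoc] at e ⊢
        exact e
      refine (congrArg (· ≫ i₁.app y.1) ((φ.el_congr (Category.comp_id _) rfl _ (by
        rw [Category.assoc]; exact e')).trans (congrArg (fun ψ : HomEl (I.homFrom x)
          (A.restrict _) (j ≫ b ≫ B.toObj x) (j ≫ b ≫ B.toBase x) => ψ.el y w c e') h₁))).trans ?_
      refine (i₁.actEl_app y.2 (w ≫ a) c _).trans ?_
      exact A'.actEl_congr _ (Category.assoc _ _ _) rfl _ _)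
    (HomEl.ext' fun y T w c e => by
      have e' : w ≫ b ≫ B.toObj x = c ≫ I.src y.2 := by
        rw [← i₂.app_obj]
        simp only [Category.assoc] at e ⊢
        exact e
      have h₃ := congrArg (fun ψ : HomEl (I.homFrom x)
          (B.restrict _) (b ≫ B.toObj x) (b ≫ B.toBase x) => ψ.el y w c e') h₂
      refine (congrArg (fun t => (t ≫ i₁.app y.1) ≫ g.app y.1)
        (φ.el_congr (Category.comp_id _) rfl _ e')).trans ?_
      refine (Category.assoc _ _ _).trans ?_
      refine (congrArg (_ ≫ ·) (congrArg (fun t => Hom.app t y.1) hi)).trans ?_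
      refine (Category.assoc _ _ _).symm.trans ?_
      refine (congrArg (· ≫ i₂.app y.1) h₃).trans ?_
      refine (i₂.actEl_app y.2 (w ≫ b) c _).trans ?_
      exact B'.actEl_congr _ (Category.assoc _ _ _) rfl _ _)
  refine ⟨l ≫ r₁.app x, ?_, ?_, HomEl.ext' fun y T w c e => ?_⟩
  · rw [← Category.assoc, e₁, Category.assoc, ← comp_app, hl]
    exact Category.comp_id _
  · rw [Category.assoc, ← comp_app, hr, comp_app, ← Category.assoc, e₂, Category.assoc,
      ← comp_app, hr']
    exact Category.comp_id _
  · have e' : w ≫ (b ≫ i₂.app x) ≫ B'.toObj x = c ≫ I.src y.2 := by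
      rw [Category.assoc, i₂.app_obj]; exact e
    have e'' : (w ≫ l) ≫ A'.toObj x = c ≫ I.src y.2 := by
      rw [← e', ← e₂]; simp [g.app_obj]
    have h₃ := congrArg (fun ψ : HomEl (I.homFrom x) (A'.restrict _)
      ((b ≫ i₂.app x) ≫ B'.toObj x) ((b ≫ i₂.app x) ≫ B'.toBase x) =>
        ψ.el y w c e') e₃
    refine (A.actEl_congr y.2 (Category.assoc _ _ _).symm rfl _ (by
      rw [Category.assoc, r₁.app_obj]; exact e'')).trans ?_
    refine (r₁.actEl_app y.2 (w ≫ l) c e'').symm.trans ?_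
    refine (congrArg (· ≫ r₁.app y.1) h₃).trans ?_
    refine (Category.assoc _ _ _).trans ?_
    refine (congrArg (_ ≫ ·) (congrArg (fun t => Hom.app t y.1) hl)).trans ?_
    exact (Category.comp_id _).trans (φ.el_congr (Category.comp_id _) rfl _ _)

/-- Levelwise retracts. -/
def retractArrowApp (r : RetractArrow f g) (x : I.Ob) : RetractArrow (f.app x) (g.app x) :=
  Retract.map r (evaluation x).mapArrow

end

section ModelCategory

variable {C : Type u} [Category.{v} C] [ModelCategory C] [IsTypeTheoreticModelCategory.{w} C]
  {I : InternalInverseCategory.{w} C} (hI : I.IsFibrant) {X : C}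

include hI

/-- Matching objects exist because `I` is fibrant, and `InjAt` mentions none of them, so the
condition does not depend on which ones are chosen. -/
lemma isReedyFibration_iff {A B : Diagram I X} (f : A ⟶ B) (Q : MorphismProperty C) :
    IsReedyFibration Q.rlp f ↔ ∀ x, InjAt Q f x := by
  have hA := matchingFunctor_isRepresentable hI A
  have hB := matchingFunctor_isRepresentable hI B
  constructor
  · intro H x
    obtain ⟨MA, ⟨rA⟩⟩ := (hA x).has_representation
    obtain ⟨MB, ⟨rB⟩⟩ := (hB x).has_representation
    exact (rlp_relMatchingMap_iff f x rA rB Q).1 ((H x).2.2 MA MB rA rB)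
  · exact fun H x => ⟨hA x, hB x, fun MA MB rA rB => (rlp_relMatchingMap_iff f x rA rB Q).2 (H x)⟩

/-- The Reedy model structure. -/
abbrev reedyModelCategory : ModelCategory (Diagram I X) :=
  -- Fibrations are defined through `InjAt`, so that the lifting and retract axioms need no chosen
  -- matching objects.
  letI : CategoryWithFibrations (Diagram I X) :=
    ⟨fun _ _ f => ∀ x, InjAt (trivialCofibrations C) f x⟩
  letI : CategoryWithCofibrations (Diagram I X) := ⟨fun _ _ f => IsLevelwise (cofibrations C) f⟩
  letI : CategoryWithWeakEquivalences (Diagram I X) :=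
    ⟨fun _ _ f => IsLevelwise (weakEquivalences C) f⟩
  have := IsTypeTheoreticModelCategory.hasLimits.{w} (C := C)
  have := IsTypeTheoreticModelCategory.hasColimits.{w} (C := C)
  have : HasLimitsOfSize.{w, w} (Diagram I X) := hasLimitsOfSize
  have : HasColimitsOfSize.{w, w} (Diagram I X) := hasColimitsOfSize hI
  have hF {A B : Diagram I X} {f : A ⟶ B} : fibrations (Diagram I X) f ↔
      ∀ x, InjAt (trivialCofibrations C) f x := Iff.rfl
  have hC {A B : Diagram I X} {f : A ⟶ B} : cofibrations (Diagram I X) f ↔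
      IsLevelwise (cofibrations C) f := Iff.rfl
  have hW {A B : Diagram I X} {f : A ⟶ B} : weakEquivalences (Diagram I X) f ↔
      IsLevelwise (weakEquivalences C) f := Iff.rfl
  have htc {A B : Diagram I X} {f : A ⟶ B} : trivialCofibrations (Diagram I X) f ↔
      IsLevelwise (trivialCofibrations C) f :=
    ⟨fun h x => ⟨h.1 x, h.2 x⟩, fun h => ⟨fun x => (h x).1, fun x => (h x).2⟩⟩
  -- This is where acyclic fibrations, defined as an intersection, become maps that lift against all
  -- levelwise cofibrations; the second lifting axiom and the second factorization axiom rest on it.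
  have htf {A B : Diagram I X} {f : A ⟶ B} : trivialFibrations (Diagram I X) f ↔
      ∀ x, InjAt (cofibrations C) f x :=
    (injAt_cofibrations_iff hI f).symm
  { cm1a := hasFiniteLimits_of_hasLimitsOfSize.{w, w} _
    cm1b := hasFiniteColimits_of_hasColimitsOfSize.{w, w} _
    cm2 :=
      { comp_mem := fun f g hf hg => hW.2 fun x =>
          (weakEquivalences C).comp_mem _ _ (hW.1 hf x) (hW.1 hg x)
        of_postcomp := fun f g hg hfg => hW.2 fun x =>
          (weakEquivalences C).of_postcomp (f.app x) (g.app x) (hW.1 hg x) (hW.1 hfg x)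
        of_precomp := fun f g hg hfg => hW.2 fun x =>
          (weakEquivalences C).of_precomp (f.app x) (g.app x) (hW.1 hg x) (hW.1 hfg x) }
    cm3a := ⟨fun r hg => hW.2 fun x =>
      (weakEquivalences C).of_retract (retractArrowApp r x) (hW.1 hg x)⟩
    cm3b := ⟨@fun _ _ _ _ f g r hg => hF.2 fun x => InjAt.of_retract (f := f) (g := g) r.i.w r.r.w
      r.retract_left r.retract_right (hF.1 hg x)⟩
    cm3c := ⟨fun r hg => hC.2 fun x =>
      (cofibrations C).of_retract (retractArrowApp r x) (hC.1 hg x)⟩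
    cm4a := fun i p hi hi' hp => hasLiftingProperty_of_injAt (trivialCofibrations C) i p
      (htc.1 ⟨hi.1, hi'.1⟩) (hF.1 hp.1)
    cm4b := fun i p hi hp hp' => hasLiftingProperty_of_injAt (cofibrations C) i p
      (hC.1 hi.1) (htf.1 ⟨hp.1, hp'.1⟩)
    cm5a := ⟨fun f => by
      have : (trivialCofibrations C).HasFactorization (trivialCofibrations C).rlp := by
        rw [← fibrations_eq_rlp]; infer_instance
      obtain ⟨D, i, p, hi, hp, h⟩ := exists_factorization hI f (trivialCofibrations C)
      exact ⟨{ Z := D, i := i, p := p, fac := h, hi := htc.2 hi, hp := hp }⟩⟩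
    cm5b := ⟨fun f => by
      have : (cofibrations C).HasFactorization (cofibrations C).rlp := by
        rw [← trivialFibrations_eq_rlp]; infer_instance
      obtain ⟨D, i, p, hi, hp, h⟩ := exists_factorization hI f (cofibrations C)
      exact ⟨{ Z := D, i := i, p := p, fac := h, hi := hi, hp := htf.2 hp }⟩⟩ }

end ModelCategory

end Diagram

end InternalInverseCategory

end

theorem mainTheorem3 {C : Type u} [Category.{v} C] [ModelCategory C]
    [IsTypeTheoreticModelCategory.{w} C] (I : InternalInverseCategory.{w} C) (hI : I.IsFibrant) :
    HasLimitsOfSize.{w, w} (I.Diagram (⊤_ C)) ∧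
    HasColimitsOfSize.{w, w} (I.Diagram (⊤_ C)) ∧
    ∃ _ : ModelCategory (I.Diagram (⊤_ C)),
      ∀ {A B : I.Diagram (⊤_ C)} (f : A ⟶ B),
        (fibrations (I.Diagram (⊤_ C)) f ↔
          InternalInverseCategory.Diagram.IsReedyFibration (fibrations C) f) ∧
        (trivialFibrations (I.Diagram (⊤_ C)) f ↔
          InternalInverseCategory.Diagram.IsReedyFibration (trivialFibrations C) f) ∧
        (cofibrations (I.Diagram (⊤_ C)) f ↔
          InternalInverseCategory.Diagram.IsLevelwise (cofibrations C) f) ∧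
        (weakEquivalences (I.Diagram (⊤_ C)) f ↔
          InternalInverseCategory.Diagram.IsLevelwise (weakEquivalences C) f) ∧
        (trivialCofibrations (I.Diagram (⊤_ C)) f ↔
          InternalInverseCategory.Diagram.IsLevelwise (trivialCofibrations C) f) := by
  have := IsTypeTheoreticModelCategory.hasLimits.{w} (C := C)
  have := IsTypeTheoreticModelCategory.hasColimits.{w} (C := C)
  refine ⟨InternalInverseCategory.Diagram.hasLimitsOfSize,
    InternalInverseCategory.Diagram.hasColimitsOfSize hI,
    InternalInverseCategory.Diagram.reedyModelCategory hI, fun f => ⟨?_, ?_, Iff.rfl, Iff.rfl, ?_⟩⟩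
  -- Fibrations of `C` are the maps lifting against acyclic cofibrations, so the Reedy condition
  -- turns into the `InjAt` condition by which the model structure is defined.
  · rw [InternalInverseCategory.fibrations_eq_rlp C, InternalInverseCategory.Diagram.isReedyFibration_iff hI]
    exact Iff.rfl
  · rw [InternalInverseCategory.trivialFibrations_eq_rlp C, InternalInverseCategory.Diagram.isReedyFibration_iff hI]
    exact (InternalInverseCategory.Diagram.injAt_cofibrations_iff hI f).symm
  · exact ⟨fun h x => ⟨h.1 x, h.2 x⟩, fun h => ⟨fun x => (h x).1, fun x => (h x).2⟩⟩
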